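/- **Conventions.** Let $n\ge 0$, let $\mathbb T^n=(S^1)^n$ with Lie algebra $\mathfrak t=\mathbb R^n$, lattice $\mathbb Z^n$, exponential map $\xi\mapsto(e^{\sqrt{-1}\xi_1},\dots,e^{\sqrt{-1}\xi_n})$, and dual $\mathfrak t^*=\mathbb R^n$ with dual lattice $\mathbb Z^n$. A *polyhedron* in $\mathfrak t^*$ is a finite intersection $P=\bigcap_i\{x : \langle x,\nu_i\rangle+a_i\ge 0\}$. A face of $P$ is a set $P\cap\{\langle x,\nu\rangle+a=0\}$ with $\langle x,\nu\rangle+a\ge 0$ on $P$ ($P$ is a face of itself); nonempty faces of dimension $n-1$, $1$, $0$ are facets, edges, vertices. $P$ is *proper* if its asymptotic cone $\bigcap_i\{\langle x,\nu_i\rangle\ge0\}$ contains no line, *rational* if for each vertex $v$ every edge of the cone $\mathbb R_+(P-v)$ is generated by a lattice vector, and *simple* if exactly $n$ edges emanate from each vertex and their generators form a basis of $\mathfrak t^*$. A *labeled polyhedron* is a nonempty proper, rational, simple polyhedron with a positive integer attached to each facet. A smooth *orbifold* is a connected Hausdorff paracompact space with a maximal atlas of local charts $(U,\tilde U,\Gamma,\pi)$,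 where $\Gamma$ is a finite group acting smoothly and effectively on a connected open set $\tilde U$ of Euclidean space and $\pi$ induces a homeomorphism $\tilde U/\Gamma\cong U$; the structure group of a point $p$ is the group of a chart for which $\pi^{-1}(p)$ is a single point. A *symplectic toric orbifold* $(M^{2n},\omega,\mathbb T^n,\Phi)$ is a $2n$-dimensional orbifold with a closed nondegenerate $2$-form $\omega$, a smooth effective action of $\mathbb T^n$ preserving $\omega$, and a smooth invariant map $\Phi:M\to\mathfrak t^*$ with $-\iota(\xi_M)\omega=d\langle\Phi,\xi\rangle$ for all $\xi\in\mathfrak t$. It satisfies $(\dagger)$ if (a) $\mathbb T^n$ has finitely many fixed points, and (b) there is $b\in\mathfrak t$ such that $\langle\Phi,b\rangle$ is proper and bounded below on $M$. **Theorem T206.** Let $P\subset\mathfrak t^*$ be a labeled polyhedron. Then there is a symplectic toric orbifold $(M^{2n},\omega,\mathbb T^n,\Phi)$ satisfying $(\dagger)$ such that 1. $\Phi(M)=P$; 2. for every facet $F$ of $P$ with label $m$, every point of $M$ that $\Phi$ maps into the relative interior of $F$ has structure group isomorphic to $\mathbb Z/m\mathbb Z$; 3. $M$ is a symplectic reduction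 of $\mathbb C^N$, in the following sense. There is a presentation $P=\bigcap_{i=1}^N\{x:\langle x,m_in_i\rangle+a_i\ge0\}$ with primitive $n_i\in\mathbb Z^n$, whose facets are, without repetition, the sets $F_i=P\cap\{\langle x,m_in_i\rangle+a_i=0\}$, and where $m_i$ is the label of $F_i$. Let $\varpi:\mathbb R^N\to\mathfrak t$, $e_i\mapsto m_in_i$, let $K$ be the kernel of the induced homomorphism $\mathbb T^N\to\mathbb T^n$, let $i:\ker\varpi\to\mathbb R^N$ be the inclusion, and let $\Phi_K(z)=i^*(\tfrac12|z_1|^2,\dots,\tfrac12|z_N|^2)$. Then $M=\Phi_K^{-1}(i^*(a))/K$ as a topological space with the residual action of $\mathbb T^n=\mathbb T^N/K$; the orbifold charts of $M$ lift locally to smooth maps into $\Phi_K^{-1}(i^*(a))\subset\mathbb C^N$; $\omega$ is the pullback by these lifts of the standard form $\sum_j\frac{\sqrt{-1}}2dz_j\wedge d\bar z_j$; and $\tfrac12|z_i|^2=\langle\Phi([z]),m_in_i\rangle+a_i$ for all $i$. -/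

import Mathlib

noncomputable section

open scoped ContDiff

namespace ToricOrbifold

/-! ### The torus, its Lie algebra and its dual -/

/-- The standard torus `𝕋ⁿ`. -/
abbrev Torus (n : ℕ) : Type := Fin n → Circle

/-- The Lie algebra `𝔱 = ℝⁿ` of `𝕋ⁿ`, with lattice `ℤⁿ`. -/
abbrev LieAlg (n : ℕ) : Type := Fin n → ℝ

/-- The dual `𝔱*`, identified with `ℝⁿ` by the pairing `pair`; the dual lattice is `ℤⁿ`. -/
abbrev LieDual (n : ℕ) : Type := Fin n → ℝ

/-- The natural pairing of `𝔱*` and `𝔱`. -/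
def pair {n : ℕ} (x : LieDual n) (ξ : LieAlg n) : ℝ := ∑ j, x j * ξ j

/-- The exponential map `ξ ↦ (e^{i ξ₁}, …, e^{i ξₙ})`. The normalization is the one for which the
standard action of `𝕋ᴺ` on `ℂᴺ` has moment map `z ↦ (|z₁|² / 2, …, |z_N|² / 2)`; a vector `ξ` is in
the lattice `ℤⁿ` exactly if `torusExp (2 π ξ) = 1`. -/
def torusExp {n : ℕ} (ξ : LieAlg n) : Torus n := fun j => Circle.exp (ξ j)

/-! ### Polyhedra -/

/-- The intersection of the half spaces `{x | ⟨x, ν i⟩ + a i ≥ 0}`. -/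
def halfSpaces {n N : ℕ} (ν : Fin N → LieAlg n) (a : Fin N → ℝ) : Set (LieDual n) :=
  {x | ∀ i, 0 ≤ pair x (ν i) + a i}

def IsPolyhedron {n : ℕ} (P : Set (LieDual n)) : Prop :=
  ∃ (N : ℕ) (ν : Fin N → LieAlg n) (a : Fin N → ℝ), P = halfSpaces ν a

/-- `F` is cut out of `S` by `⟨x, ν⟩ + a = 0`, where `⟨x, ν⟩ + a ≥ 0` on `S`. The choice `ν = 0`,
`a = 0` is allowed, so that `S` is a face of itself (a one-dimensional polyhedron is its own
edge). -/
def IsFace {n : ℕ} (S F : Set (LieDual n)) : Prop :=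
  ∃ (ν : LieAlg n) (a : ℝ), (∀ x ∈ S, 0 ≤ pair x ν + a) ∧ F = {x ∈ S | pair x ν + a = 0}

/-- A nonempty face whose affine span has dimension `k`. -/
def IsFaceOfDim {n : ℕ} (k : ℕ) (S F : Set (LieDual n)) : Prop :=
  IsFace S F ∧ F.Nonempty ∧ Module.finrank ℝ (vectorSpan ℝ F) = k

/-- A face of dimension `n - 1`. -/
def IsFacet {n : ℕ} (S F : Set (LieDual n)) : Prop := ∃ k, k + 1 = n ∧ IsFaceOfDim k S F

def IsEdge {n : ℕ} (S E : Set (LieDual n)) : Prop := IsFaceOfDim 1 S E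

def IsVertex {n : ℕ} (S : Set (LieDual n)) (v : LieDual n) : Prop := IsFaceOfDim 0 S {v}

def ContainsLine {n : ℕ} (S : Set (LieDual n)) : Prop :=
  ∃ x w : LieDual n, w ≠ 0 ∧ ∀ s : ℝ, x + s • w ∈ S

/-- The asymptotic cone `⋂ {x | ⟨x, ν i⟩ ≥ 0}` of `P = ⋂ {x | ⟨x, ν i⟩ + a i ≥ 0}` contains no line.
(For nonempty `P` the asymptotic cone does not depend on the presentation of `P`.) -/
def IsProperPolyhedron {n : ℕ} (P : Set (LieDual n)) : Prop :=
  ∃ (N : ℕ) (ν : Fin N → LieAlg n) (a : Fin N → ℝ),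
    P = halfSpaces ν a ∧ ¬ ContainsLine (halfSpaces ν 0)

/-- The cone `ℝ₊ (P - v)`. -/
def coneAt {n : ℕ} (P : Set (LieDual n)) (v : LieDual n) : Set (LieDual n) :=
  {y | ∃ s : ℝ, 0 ≤ s ∧ ∃ x ∈ P, y = s • (x - v)}

/-- The lattice vectors `ℤⁿ ⊂ ℝⁿ`. -/
def IsLatticeVector {n : ℕ} (w : Fin n → ℝ) : Prop := ∀ j, ∃ k : ℤ, w j = k

/-- Every edge of the cone is a ray generated by a lattice vector. -/
def IsRationalCone {n : ℕ} (C : Set (LieDual n)) : Prop :=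
  ∀ R, IsEdge C R → ∃ w, IsLatticeVector w ∧ R = {y | ∃ s : ℝ, 0 ≤ s ∧ y = s • w}

def IsRationalPolyhedron {n : ℕ} (P : Set (LieDual n)) : Prop :=
  ∀ v, IsVertex P v → IsRationalCone (coneAt P v)

/-- `w` generates the edge `E` emanating from `v`: `E` lies on the ray from `v` in direction
`w`. -/
def IsEdgeGenerator {n : ℕ} (v : LieDual n) (E : Set (LieDual n)) (w : LieDual n) : Prop :=
  w ≠ 0 ∧ ∀ y ∈ E, ∃ s : ℝ, 0 ≤ s ∧ y = v + s • w

def edgesAt {n : ℕ} (P : Set (LieDual n)) (v : LieDual n) : Set (Set (LieDual n)) :=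
  {E | IsEdge P E ∧ v ∈ E}

/-- There are exactly `n` edges at any vertex, and their generators form a basis of `𝔱*`. -/
def IsSimplePolyhedron {n : ℕ} (P : Set (LieDual n)) : Prop :=
  ∀ v, IsVertex P v → (edgesAt P v).encard = n ∧
    ∃ b : Module.Basis (edgesAt P v) ℝ (LieDual n), ∀ E : edgesAt P v, IsEdgeGenerator v E (b E)

/-- A (nonempty) proper, rational, simple polyhedron with a positive integer attached to each
facet. -/
structure LabeledPolyhedron (n : ℕ) where
  carrier : Set (LieDual n)
  nonempty : carrier.Nonempty
  polyhedron : IsPolyhedron carrier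
  proper : IsProperPolyhedron carrier
  rational : IsRationalPolyhedron carrier
  simple : IsSimplePolyhedron carrier
  label : {F : Set (LieDual n) // IsFacet carrier F} → ℕ+

/-! ### Smooth orbifolds -/

/-- A `d`-dimensional local chart `(U, Ũ, Γ, π)` of the space `X`. The maps `act γ` and `proj`
matter only on `dom = Ũ`. -/
structure LocalChart (d : ℕ) (X : Type) [TopologicalSpace X] where
  U : Set X
  isOpen_U : IsOpen U
  dom : Set (EuclideanSpace ℝ (Fin d))
  isOpen_dom : IsOpen dom
  isConnected_dom : IsConnected dom
  Γ : Type
  [group : Group Γ]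
  [finite : Finite Γ]
  act : Γ → EuclideanSpace ℝ (Fin d) → EuclideanSpace ℝ (Fin d)
  act_mapsTo : ∀ γ, Set.MapsTo (act γ) dom dom
  act_one : ∀ u ∈ dom, act 1 u = u
  act_mul : ∀ γ δ, ∀ u ∈ dom, act (γ * δ) u = act γ (act δ u)
  act_smooth : ∀ γ, ContDiffOn ℝ ∞ (act γ) dom
  act_effective : ∀ γ, (∀ u ∈ dom, act γ u = u) → γ = 1
  proj : EuclideanSpace ℝ (Fin d) → X
  /-- `π` induces a homeomorphism `Ũ / Γ → U`: it is continuous and open, maps onto `U`, and its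
  fibres are the orbits. -/
  proj_image : proj '' dom = U
  proj_continuousOn : ContinuousOn proj dom
  proj_isOpen : ∀ W ⊆ dom, IsOpen W → IsOpen (proj '' W)
  proj_eq_iff : ∀ u ∈ dom, ∀ v ∈ dom, proj u = proj v ↔ ∃ γ, act γ u = v

attribute [instance] LocalChart.group LocalChart.finite

/-- The chart is good around `p`: the fibre of `p` is a single point. -/
def LocalChart.IsGoodAt {d : ℕ} {X : Type} [TopologicalSpace X] (c : LocalChart d X) (p : X) :
    Prop :=
  ∃ u, {v ∈ c.dom | c.proj v = p} = {u}

/-- An embedding of local charts over the inclusion of the underlying open sets. (The two charts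
have the same dimension, so an injective immersion is an open embedding.) -/
structure ChartEmbedding {d : ℕ} {X : Type} [TopologicalSpace X] (c c' : LocalChart d X) where
  toFun : EuclideanSpace ℝ (Fin d) → EuclideanSpace ℝ (Fin d)
  hom : c.Γ →* c'.Γ
  mapsTo : Set.MapsTo toFun c.dom c'.dom
  smooth : ContDiffOn ℝ ∞ toFun c.dom
  injOn : Set.InjOn toFun c.dom
  immersion : ∀ u ∈ c.dom, Function.Injective (fderiv ℝ toFun u)
  equivariant : ∀ γ, ∀ u ∈ c.dom, toFun (c.act γ u) = c'.act (hom γ) (toFun u)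
  proj_comp : ∀ u ∈ c.dom, c'.proj (toFun u) = c.proj u

/-- The charts cover the space, and any two charts are locally compatible. -/
def IsOrbifoldAtlas {d : ℕ} {X : Type} [TopologicalSpace X] (A : Set (LocalChart d X)) : Prop :=
  (∀ p : X, ∃ c ∈ A, p ∈ c.U) ∧
  ∀ c₁ ∈ A, ∀ c₂ ∈ A, ∀ p ∈ c₁.U ∩ c₂.U, ∃ c₃ ∈ A, p ∈ c₃.U ∧ c₃.U ⊆ c₁.U ∩ c₂.U ∧
    Nonempty (ChartEmbedding c₃ c₁) ∧ Nonempty (ChartEmbedding c₃ c₂)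

/-- A `d`-dimensional smooth orbifold: a connected, Hausdorff, paracompact space with a maximal
orbifold atlas. -/
structure SmoothOrbifold (d : ℕ) where
  carrier : Type
  [topology : TopologicalSpace carrier]
  [t2 : T2Space carrier]
  [paracompact : ParacompactSpace carrier]
  [connected : ConnectedSpace carrier]
  charts : Set (LocalChart d carrier)
  maximal : Maximal IsOrbifoldAtlas charts

attribute [instance] SmoothOrbifold.topology SmoothOrbifold.t2 SmoothOrbifold.paracompact
  SmoothOrbifold.connected

/-- The structure group at `p`, that is, the group of a good local chart around `p`, is isomorphic
to `G`. -/
def SmoothOrbifold.HasStructureGroup {d : ℕ} (M : SmoothOrbifold d) (p : M.carrier)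
    (G : Type) [Group G] : Prop :=
  (∃ c ∈ M.charts, c.IsGoodAt p) ∧ ∀ c ∈ M.charts, c.IsGoodAt p → Nonempty (c.Γ ≃* G)

/-! ### Symplectic forms -/

/-- A smooth `2`-form on an orbifold: smooth `2`-forms on the domains of the charts that correspond
to each other under the embeddings of charts. As every `γ` in the group of a chart is an embedding
of the chart into itself, the forms are invariant under these groups. Only the values at charts of
`M` matter. -/
structure TwoForm {d : ℕ} (M : SmoothOrbifold d) where
  toFun : LocalChart d M.carrier → EuclideanSpace ℝ (Fin d) →
    EuclideanSpace ℝ (Fin d) [⋀^Fin 2]→L[ℝ] ℝ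
  smooth : ∀ c ∈ M.charts, ContDiffOn ℝ ∞ (toFun c) c.dom
  compatible : ∀ c ∈ M.charts, ∀ c' ∈ M.charts, ∀ φ : ChartEmbedding c c', ∀ u ∈ c.dom,
    (toFun c' (φ.toFun u)).compContinuousLinearMap (fderiv ℝ φ.toFun u) = toFun c u

/-- The form is closed and nondegenerate. -/
def TwoForm.IsSymplectic {d : ℕ} {M : SmoothOrbifold d} (σ : TwoForm M) : Prop :=
  (∀ c ∈ M.charts, ∀ u ∈ c.dom, extDeriv (σ.toFun c) u = 0) ∧
  ∀ c ∈ M.charts, ∀ u ∈ c.dom, ∀ v, (∀ w, σ.toFun c u ![v, w] = 0) → v = 0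

/-! ### Hamiltonian torus actions -/

/-- The map `(t, x) ↦ t • x` is a smooth map of orbifolds `𝕋ⁿ × M → M`: it is continuous, and around
every `(t₀, x₀)` it has a smooth equivariant lift to charts. The torus is parametrized near `t₀` by
`ξ ↦ t₀ exp ξ`. -/
def IsSmoothAction {d : ℕ} (n : ℕ) (M : SmoothOrbifold d) [MulAction (Torus n) M.carrier] : Prop :=
  ContinuousSMul (Torus n) M.carrier ∧
  ∀ (t₀ : Torus n) (x₀ : M.carrier), ∃ c ∈ M.charts, ∃ c' ∈ M.charts,
    x₀ ∈ c.U ∧ t₀ • x₀ ∈ c'.U ∧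
    ∃ (A : Set (LieAlg n)) (f : LieAlg n × EuclideanSpace ℝ (Fin d) → EuclideanSpace ℝ (Fin d))
      (h : c.Γ →* c'.Γ),
      IsOpen A ∧ 0 ∈ A ∧ ContDiffOn ℝ ∞ f (A ×ˢ c.dom) ∧
      ∀ ξ ∈ A, ∀ u ∈ c.dom, f (ξ, u) ∈ c'.dom ∧
        c'.proj (f (ξ, u)) = (t₀ * torusExp ξ) • c.proj u ∧
        ∀ γ, f (ξ, c.act γ u) = c'.act (h γ) (f (ξ, u))

/-- Every element `t` of the torus preserves the form: `g^* σ = σ` for every smooth local lift `g`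
of `x ↦ t • x` to charts. -/
def TwoForm.IsInvariant {d : ℕ} (n : ℕ) {M : SmoothOrbifold d} [MulAction (Torus n) M.carrier]
    (σ : TwoForm M) : Prop :=
  ∀ (t : Torus n), ∀ c ∈ M.charts, ∀ c' ∈ M.charts,
    ∀ (W : Set (EuclideanSpace ℝ (Fin d))) (g : EuclideanSpace ℝ (Fin d) →
      EuclideanSpace ℝ (Fin d)), IsOpen W → W ⊆ c.dom → Set.MapsTo g W c'.dom →
      ContDiffOn ℝ ∞ g W → (∀ u ∈ W, c'.proj (g u) = t • c.proj u) →
      ∀ u ∈ W, (σ.toFun c' (g u)).compContinuousLinearMap (fderiv ℝ g u) = σ.toFun c u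

/-- The fundamental vector field of `ξ`, written in charts: its value at `u₀` is the velocity at
`s = 0` of a smooth local lift `f s`, with `f 0 = id`, of the flow `x ↦ exp (s ξ) • x`. -/
def IsFundamentalField {d n : ℕ} (M : SmoothOrbifold d) [MulAction (Torus n) M.carrier]
    (ξ : LieAlg n)
    (X : LocalChart d M.carrier → EuclideanSpace ℝ (Fin d) → EuclideanSpace ℝ (Fin d)) : Prop :=
  ∀ c ∈ M.charts, ∀ u₀ ∈ c.dom,
    ∃ (ε : ℝ) (W : Set (EuclideanSpace ℝ (Fin d)))
      (f : ℝ × EuclideanSpace ℝ (Fin d) → EuclideanSpace ℝ (Fin d)),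
      0 < ε ∧ IsOpen W ∧ u₀ ∈ W ∧ W ⊆ c.dom ∧ ContDiffOn ℝ ∞ f (Set.Ioo (-ε) ε ×ˢ W) ∧
      (∀ u ∈ W, f (0, u) = u) ∧
      (∀ s ∈ Set.Ioo (-ε) ε, ∀ u ∈ W,
        f (s, u) ∈ c.dom ∧ c.proj (f (s, u)) = torusExp (s • ξ) • c.proj u) ∧
      HasDerivAt (fun s => f (s, u₀)) (X c u₀) 0

/-- `Φ : M → 𝔱*` is a moment map: it is smooth, invariant (the coadjoint action of a torus is
trivial), and `-ι(ξ_M) σ = d⟨Φ, ξ⟩` for all `ξ`. -/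
def IsMomentMap {d n : ℕ} {M : SmoothOrbifold d} [MulAction (Torus n) M.carrier] (σ : TwoForm M)
    (Φ : M.carrier → LieDual n) : Prop :=
  Continuous Φ ∧ (∀ c ∈ M.charts, ContDiffOn ℝ ∞ (fun u => Φ (c.proj u)) c.dom) ∧
  (∀ (t : Torus n) (x : M.carrier), Φ (t • x) = Φ x) ∧
  ∀ ξ : LieAlg n, ∃ X, IsFundamentalField M ξ X ∧
    ∀ c ∈ M.charts, ∀ u ∈ c.dom, ∀ v,
      -(σ.toFun c u ![X c u, v]) = fderiv ℝ (fun u => pair (Φ (c.proj u)) ξ) u v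

/-- A symplectic toric orbifold `(M²ⁿ, ω, 𝕋ⁿ, Φ)`: a symplectic orbifold with an effective
Hamiltonian action of `𝕋ⁿ` and a moment map. -/
structure SymplecticToricOrbifold (n : ℕ) extends SmoothOrbifold (2 * n) where
  form : TwoForm toSmoothOrbifold
  symplectic : form.IsSymplectic
  [action : MulAction (Torus n) carrier]
  smooth_action : IsSmoothAction n toSmoothOrbifold
  effective : FaithfulSMul (Torus n) carrier
  invariant : form.IsInvariant n
  moment : carrier → LieDual n
  isMomentMap : IsMomentMap form moment

attribute [instance] SymplecticToricOrbifold.action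

/-- The condition (†): the action has finitely many fixed points, and some component `⟨Φ, b⟩` of the
moment map is proper and bounded below. -/
def SymplecticToricOrbifold.Dagger {n : ℕ} (M : SymplecticToricOrbifold n) : Prop :=
  {x : M.carrier | ∀ t : Torus n, t • x = x}.Finite ∧
  ∃ b : LieAlg n, IsProperMap (fun x => pair (M.moment x) b) ∧
    BddBelow (Set.range fun x => pair (M.moment x) b)

/-! ### Symplectic reduction of `ℂᴺ` -/

/-- The presentation `P = ⋂ {x | ⟨x, mᵢ nᵢ⟩ + aᵢ ≥ 0}` of a labeled polyhedron with primitive lattice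
vectors `nᵢ`, where `mᵢ` is the label of the facet `P ∩ {x | ⟨x, mᵢ nᵢ⟩ + aᵢ = 0}`. -/
structure FacetPresentation {n : ℕ} (P : LabeledPolyhedron n) where
  N : ℕ
  facet : Fin N ≃ {F : Set (LieDual n) // IsFacet P.carrier F}
  normal : Fin N → Fin n → ℤ
  offset : Fin N → ℝ
  primitive : ∀ i, ∀ k : ℕ, 1 < k → ¬ ∃ μ : Fin n → ℤ, normal i = (k : ℤ) • μ
  carrier_eq : P.carrier = halfSpaces
    (fun i j => ((P.label (facet i) : ℕ) : ℝ) * (normal i j : ℝ)) offset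
  facet_eq : ∀ i, (facet i : Set (LieDual n)) = {x ∈ P.carrier |
    pair x (fun j => ((P.label (facet i) : ℕ) : ℝ) * (normal i j : ℝ)) + offset i = 0}

namespace FacetPresentation

variable {n : ℕ} {P : LabeledPolyhedron n} (D : FacetPresentation P)

/-- The integer vector `mᵢ nᵢ`. -/
def weight (i : Fin D.N) (j : Fin n) : ℤ := (P.label (D.facet i) : ℕ) * D.normal i j

/-- The linear map `ϖ : ℝᴺ → 𝔱`, `eᵢ ↦ mᵢ nᵢ`. -/
def varpi (κ : Fin D.N → ℝ) : LieAlg n := fun j => ∑ i, κ i * (D.weight i j : ℝ)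

/-- The homomorphism `𝕋ᴺ → 𝕋ⁿ` induced by `ϖ`. Its kernel is the group `K`. -/
def torusMap (t : Torus D.N) : Torus n := fun j => ∏ i, t i ^ D.weight i j

/-- The level set `Φ_K⁻¹(i^* a)` in `ℂᴺ` of the moment map `Φ_K = i^* ∘ (|z₁|² / 2, …, |z_N|² / 2)` of
`K`, where `i` is the inclusion of the Lie algebra `ker ϖ` of `K`. -/
def levelSet : Set (Fin D.N → ℂ) :=
  {z | ∀ κ : Fin D.N → ℝ, D.varpi κ = 0 → ∑ i, ‖z i‖ ^ 2 / 2 * κ i = ∑ i, D.offset i * κ i}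

/-- The standard action of `𝕋ᴺ` on `ℂᴺ`. -/
def rotate (t : Torus D.N) (z : Fin D.N → ℂ) : Fin D.N → ℂ := fun i => (t i : ℂ) * z i

/-- The standard symplectic form `∑ (√-1 / 2) dzᵢ ∧ dz̄ᵢ = ∑ dxᵢ ∧ dyᵢ` of `ℂᴺ`. -/
def stdForm (v w : Fin D.N → ℂ) : ℝ := ∑ i, ((v i).re * (w i).im - (v i).im * (w i).re)

/-- `M` is the symplectic reduction `Φ_K⁻¹(i^* a) / K` of `ℂᴺ` with the residual action of
`𝕋ⁿ = 𝕋ᴺ / K`, by means of the quotient map `q`. The orbifold charts of `M` lift locally to smooth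
maps `s` into the level set, and the symplectic form of `M` is induced by that of `ℂᴺ`. -/
def IsReduction (M : SymplecticToricOrbifold n) : Prop :=
  ∃ q : D.levelSet → M.carrier, Topology.IsQuotientMap q ∧
    (∀ z w : D.levelSet, q z = q w ↔
      ∃ t : Torus D.N, D.torusMap t = 1 ∧ (w : Fin D.N → ℂ) = D.rotate t z) ∧
    (∀ (t : Torus D.N) (z w : D.levelSet), (w : Fin D.N → ℂ) = D.rotate t z →
      q w = D.torusMap t • q z) ∧
    (∀ (z : D.levelSet) (i : Fin D.N), ‖(z : Fin D.N → ℂ) i‖ ^ 2 / 2 =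
      pair (M.moment (q z)) (fun j => (D.weight i j : ℝ)) + D.offset i) ∧
    ∀ c ∈ M.charts, ∀ u₀ ∈ c.dom,
      ∃ (W : Set (EuclideanSpace ℝ (Fin (2 * n))))
        (s : EuclideanSpace ℝ (Fin (2 * n)) → (Fin D.N → ℂ)),
        IsOpen W ∧ u₀ ∈ W ∧ W ⊆ c.dom ∧ ContDiffOn ℝ ∞ s W ∧
        (∀ u ∈ W, ∃ h : s u ∈ D.levelSet, q ⟨s u, h⟩ = c.proj u) ∧
        ∀ u ∈ W, ∀ v w, M.form.toFun c u ![v, w] =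
          D.stdForm (fderiv ℝ s u v) (fderiv ℝ s u w)

end FacetPresentation

end ToricOrbifold

end

noncomputable section

open scoped ContDiff

namespace ToricOrbifold

/-! ### The pairing -/

section Pairing

variable {n : ℕ}

/-! This is Delzant's construction, in the form that Lerman and Tolman gave it for labeled
polyhedra. Describe `P` by its facet inequalities with normals `mᵢ nᵢ`, and call the value of the
`i`-th one at `x` its slack. The level set in `ℂᴺ` consists of the `z` for which the numbers `|zᵢ|²
/ 2` are the slacks of some `x` (`mem_levelSet_iff`). This `x` is unique, because the normals at a
vertex span `𝔱`, and `z ↦ x` descends to the moment map. Hence its image is `P`, and the `𝕋ᴺ`-orbits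
in the level set are exactly its fibres.

The combinatorial input is that simplicity and rationality make the cone at each vertex simplicial
with lattice generators (`IsPinned.exists_lattice_basis`). Its primitive dual vectors are the facet
normals there (`IsPinned.exists_isFrame`, `IsFrame.eq_facetThrough`). This yields the presentation
by facets and, at each point of `P`, a vertex lying on all facets through that point
(`exists_vertex`).

At a vertex the `n` active normals form a basis of `𝔱`. An element of `K` can therefore make the
other `N - n` coordinates of a nearby point of the level set positive real, and only a finite
subgroup of `K` preserves this normal form. The remaining `n` complex coordinates are thus an
orbifold chart (`Vertex.sec`, `Vertex.slice`, `Vertex.proj_eq_iff`). In it the symplectic form is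
the standard one, since real coordinates contribute nothing (`Vertex.pull_sec`), and the torus acts
by rotations.

The form on an arbitrary chart is the pullback of the standard form by any smooth lift to the level
set. It does not depend on the lift: over the interior of `P` two lifts differ by a differentiable
map to `K`, along whose orbits the restricted form degenerates (`IsLift.pull_eq_of_isPrincipal`),
and the other points follow by density. Closedness, compatibility, torus invariance and the
immersivity of transition maps come from this.

Over the relative interior of a facet the isotropy in `K` lies in a single circle, where it is `{t |
(t ^ m) ^ n = 1}` for the primitive normal `n`; these are the `m`-th roots of unity. That the group
of a good chart is an invariant of the point is a Baire category argument
(`ChartEmbedding.hom_surjective`). For (†), pairing with the sum of the normals gives `∑ |zᵢ|² / 2`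
up to a constant, which is proper and bounded below, and fixed points lie over vertices. -/

theorem pair_add_left (x y : LieDual n) (ξ : LieAlg n) : pair (x + y) ξ = pair x ξ + pair y ξ := by
  simp [pair, add_mul, Finset.sum_add_distrib]

theorem pair_sub_left (x y : LieDual n) (ξ : LieAlg n) : pair (x - y) ξ = pair x ξ - pair y ξ := by
  simp [pair, sub_mul, Finset.sum_sub_distrib]

theorem pair_smul_left (s : ℝ) (x : LieDual n) (ξ : LieAlg n) : pair (s • x) ξ = s * pair x ξ := by
  simp [pair, Finset.mul_sum, mul_assoc]

theorem pair_neg_left (x : LieDual n) (ξ : LieAlg n) : pair (-x) ξ = -pair x ξ := by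
  simp [pair]

theorem pair_comm (x ξ : Fin n → ℝ) : pair x ξ = pair ξ x := by
  simp [pair, mul_comm]

@[simp] theorem pair_zero_right (x : LieDual n) : pair x 0 = 0 := by simp [pair]

theorem pair_sum_right {ι : Type*} (s : Finset ι) (x : LieDual n) (ξ : ι → LieAlg n) :
    pair x (∑ i ∈ s, ξ i) = ∑ i ∈ s, pair x (ξ i) := by
  simp only [pair, Finset.sum_apply, Finset.mul_sum]
  exact Finset.sum_comm

theorem pair_sum_left {ι : Type*} (s : Finset ι) (x : ι → LieDual n) (ξ : LieAlg n) :
    pair (∑ i ∈ s, x i) ξ = ∑ i ∈ s, pair (x i) ξ := by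
  rw [pair_comm, pair_sum_right]; simp only [pair_comm]

theorem pair_smul_right (s : ℝ) (x : LieDual n) (ξ : LieAlg n) : pair x (s • ξ) = s * pair x ξ := by
  rw [pair_comm, pair_smul_left, pair_comm]

/-- Pairing with `ξ` as a linear form. -/
def pairLeft (ξ : LieAlg n) : LieDual n →ₗ[ℝ] ℝ where
  toFun x := pair x ξ
  map_add' x y := pair_add_left x y ξ
  map_smul' s x := pair_smul_left s x ξ

@[simp] theorem pairLeft_apply (ξ : LieAlg n) (x : LieDual n) : pairLeft ξ x = pair x ξ := rfl

theorem exists_pair_eq (f : LieDual n →ₗ[ℝ] ℝ) : ∃ ξ : LieAlg n, ∀ x, f x = pair x ξ := by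
  refine ⟨fun j => f (Pi.single j 1), fun x => ?_⟩
  conv_lhs => rw [pi_eq_sum_univ' x]
  simp [pair, map_sum]

theorem continuous_pair_left (ξ : LieAlg n) : Continuous fun x : LieDual n => pair x ξ := by
  unfold pair; fun_prop

end Pairing

/-! ### Polyhedra without lines -/

section Polyhedron

variable {n m : ℕ} {ν : Fin m → LieAlg n} {a : Fin m → ℝ}

/-- The ratio test: among the constraints that decrease along `w`, the one with the least ratio of
slack to speed is reached first. -/
theorem exists_exit_point {x w : LieDual n} (hx : x ∈ halfSpaces ν a) (hw : ∃ j, pair w (ν j) < 0) :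
    ∃ t : ℝ, 0 ≤ t ∧ x + t • w ∈ halfSpaces ν a ∧
      ∃ j, pair w (ν j) < 0 ∧ pair (x + t • w) (ν j) + a j = 0 := by
  classical
  obtain ⟨j₀, hj₀⟩ := hw
  obtain ⟨j, hj, hmin⟩ := Finset.exists_min_image (Finset.univ.filter fun j => pair w (ν j) < 0)
    (fun j => (pair x (ν j) + a j) / (-pair w (ν j))) ⟨j₀, by simpa using hj₀⟩
  replace hj : pair w (ν j) < 0 := by simpa using hj
  set t := (pair x (ν j) + a j) / (-pair w (ν j)) with ht
  have ht0 : 0 ≤ t := div_nonneg (hx j) (by linarith)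
  refine ⟨t, ht0, fun i => ?_, j, hj, ?_⟩
  · rw [pair_add_left, pair_smul_left]
    rcases le_or_gt 0 (pair w (ν i)) with h | h
    · have := hx i
      have := mul_nonneg ht0 h
      linarith
    · have h1 := hmin i (by simpa using h)
      rw [le_div_iff₀ (by linarith)] at h1
      linarith
  · have := hj.ne
    rw [pair_add_left, pair_smul_left, ht]
    field_simp
    ring

/-- A point of the polyhedron is pinned if only `0` is orthogonal to all constraints active
there. -/
def IsPinned (ν : Fin m → LieAlg n) (a : Fin m → ℝ) (v : LieDual n) : Prop :=
  v ∈ halfSpaces ν a ∧ ∀ w, (∀ j, pair v (ν j) + a j = 0 → pair w (ν j) = 0) → w = 0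

/-- As long as some direction is orthogonal to all active constraints, one can follow it, or its
negative, until another constraint becomes active; without lines in the asymptotic cone one of the
two must exit. Active constraints are never lost, so `v` lies on every face through `x`. -/
theorem exists_isPinned_of_mem (hν : ¬ ContainsLine (halfSpaces ν 0)) {x : LieDual n}
    (hx : x ∈ halfSpaces ν a) :
    ∃ v, IsPinned ν a v ∧ ∀ j, pair x (ν j) + a j = 0 → pair v (ν j) + a j = 0 := by
  classical
  induction hk : (Finset.univ.filter fun j => pair x (ν j) + a j ≠ 0).card
    using Nat.strong_induction_on generalizing x with
  | _ k ih =>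
    by_cases hp : ∀ w, (∀ j, pair x (ν j) + a j = 0 → pair w (ν j) = 0) → w = 0
    · exact ⟨x, ⟨hx, hp⟩, fun _ h => h⟩
    push Not at hp
    obtain ⟨w, hw, hw0⟩ := hp
    have key : ∀ w, (∀ j, pair x (ν j) + a j = 0 → pair w (ν j) = 0) → (∃ j, pair w (ν j) < 0) →
        ∃ v, IsPinned ν a v ∧ ∀ j, pair x (ν j) + a j = 0 → pair v (ν j) + a j = 0 := by
      intro w hw hneg
      obtain ⟨t, -, hxt, j, hj, hj0⟩ := exists_exit_point hx hneg
      have hact : ∀ i, pair x (ν i) + a i = 0 → pair (x + t • w) (ν i) + a i = 0 := by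
        intro i hi
        rw [pair_add_left, pair_smul_left, hw i hi]; linarith
      obtain ⟨v, hv, hv'⟩ := ih _ (by
        rw [← hk]
        apply Finset.card_lt_card
        refine ⟨fun i hi => ?_, fun h => ?_⟩
        · simp only [Finset.mem_filter, Finset.mem_univ, true_and] at hi ⊢
          exact fun h => hi (hact i h)
        · have : j ∈ Finset.univ.filter fun j => pair x (ν j) + a j ≠ 0 := by
            simp only [Finset.mem_filter, Finset.mem_univ, true_and]
            exact fun h => hj.ne (hw j h)
          simpa [hj0] using h this) hxt rfl
      exact ⟨v, hv, fun i hi => hv' i (hact i hi)⟩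
    obtain ⟨j, hj⟩ : ∃ j, pair w (ν j) ≠ 0 := by
      by_contra! h
      exact hν ⟨0, w, hw0, fun s i => by simp [pair_smul_left, h]⟩
    rcases hj.lt_or_gt with h | h
    · exact key w hw ⟨j, h⟩
    · exact key (-w) (fun i hi => by rw [pair_neg_left, hw i hi, neg_zero])
        ⟨j, by rw [pair_neg_left]; linarith⟩

/-- The sum of the active constraints is a supporting function that vanishes only at `v`. -/
theorem IsPinned.isVertex {v : LieDual n} (hv : IsPinned ν a v) : IsVertex (halfSpaces ν a) v := by
  classical
  refine ⟨⟨∑ j ∈ Finset.univ.filter (fun j => pair v (ν j) + a j = 0), ν j,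
    ∑ j ∈ Finset.univ.filter (fun j => pair v (ν j) + a j = 0), a j, fun x hx => ?_, ?_⟩,
    Set.singleton_nonempty v, by simp [vectorSpan_singleton]⟩
  · rw [pair_sum_right, ← Finset.sum_add_distrib]
    exact Finset.sum_nonneg fun j _ => hx j
  · ext x
    simp only [Set.mem_singleton_iff, Set.mem_ofPred_eq]
    rw [pair_sum_right, ← Finset.sum_add_distrib]
    constructor
    · rintro rfl
      exact ⟨hv.1, Finset.sum_eq_zero fun j hj => by simpa using hj⟩
    · rintro ⟨hx, h⟩
      rw [Finset.sum_eq_zero_iff_of_nonneg fun j _ => hx j] at h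
      rw [← sub_eq_zero]
      refine hv.2 _ fun j hj => ?_
      have := h j (by simpa using hj)
      rw [pair_sub_left]; linarith

/-- Inactive constraints stay positive for small `t`, so only the active ones restrict the
direction. -/
theorem exists_pos_smul_mem {v y : LieDual n} (hv : v ∈ halfSpaces ν a)
    (hy : ∀ j, pair v (ν j) + a j = 0 → 0 ≤ pair y (ν j)) :
    ∃ t : ℝ, 0 < t ∧ v + t • y ∈ halfSpaces ν a := by
  have h : ∀ j, ∀ᶠ t : ℝ in nhdsWithin 0 (Set.Ioi 0), 0 ≤ pair (v + t • y) (ν j) + a j := by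
    intro j
    simp only [pair_add_left, pair_smul_left]
    rcases (hv j).eq_or_lt with h0 | h0
    · filter_upwards [self_mem_nhdsWithin] with t ht
      have := mul_nonneg (le_of_lt (Set.mem_Ioi.1 ht)) (hy j h0.symm)
      linarith
    · have hc : Filter.Tendsto (fun t : ℝ => pair v (ν j) + t * pair y (ν j) + a j)
          (nhdsWithin 0 (Set.Ioi 0)) (nhds (pair v (ν j) + 0 * pair y (ν j) + a j)) := by
        apply Filter.Tendsto.mono_left _ nhdsWithin_le_nhds
        exact Continuous.tendsto (by fun_prop) 0
      exact (hc.eventually (lt_mem_nhds (by linarith))).mono fun _ h => h.le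
  obtain ⟨t, ht, ht'⟩ := ((Filter.eventually_all.2 h).and self_mem_nhdsWithin).exists
  exact ⟨t, ht', ht⟩

theorem mem_coneAt_iff {v y : LieDual n} (hv : v ∈ halfSpaces ν a) :
    y ∈ coneAt (halfSpaces ν a) v ↔ ∀ j, pair v (ν j) + a j = 0 → 0 ≤ pair y (ν j) := by
  constructor
  · rintro ⟨s, hs, x, hx, rfl⟩ j hj
    rw [pair_smul_left, pair_sub_left]
    have := hx j
    exact mul_nonneg hs (by linarith)
  · intro hy
    obtain ⟨t, ht, htm⟩ := exists_pos_smul_mem hv hy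
    refine ⟨t⁻¹, by positivity, _, htm, ?_⟩
    rw [add_sub_cancel_left, smul_smul, inv_mul_cancel₀ ht.ne', one_smul]

/-- A pointed polyhedral cone is generated by its extreme rays. -/
theorem cone_induction {μ : Fin m → LieAlg n} (hμ : ∀ w, (∀ j, pair w (μ j) = 0) → w = 0)
    {Q : LieDual n → Prop} (hzero : Q 0) (hadd : ∀ y z, Q y → Q z → Q (y + z))
    (hsmul : ∀ (s : ℝ) y, 0 ≤ s → Q y → Q (s • y))
    (hext : ∀ y, (∀ j, 0 ≤ pair y (μ j)) → y ≠ 0 →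
      (∀ w, (∀ j, pair y (μ j) = 0 → pair w (μ j) = 0) → ∃ s : ℝ, w = s • y) → Q y)
    (y : LieDual n) (hy : ∀ j, 0 ≤ pair y (μ j)) : Q y := by
  classical
  induction hk : (Finset.univ.filter fun j => pair y (μ j) ≠ 0).card
    using Nat.strong_induction_on generalizing y with
  | _ k ih =>
    by_cases hy0 : y = 0
    · rwa [hy0]
    by_cases hline : ∀ w, (∀ j, pair y (μ j) = 0 → pair w (μ j) = 0) → ∃ s : ℝ, w = s • y
    · exact hext y hy hy0 hline
    push Not at hline
    obtain ⟨w, hw, hws⟩ := hline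
    have hsum_pos : 0 < ∑ j, pair y (μ j) := by
      rcases (Finset.sum_nonneg fun j (_ : j ∈ Finset.univ) => hy j).eq_or_lt with h | h
      · exact absurd (hμ y fun j => (Finset.sum_eq_zero_iff_of_nonneg fun j _ => hy j).1 h.symm j
          (Finset.mem_univ j)) hy0
      · exact h
    -- Subtracting this multiple of `y` makes the entries of `w'` sum to zero. As the cone is
    -- pointed, both `w'` and `-w'` then have a negative entry, and both rays from `y` leave the
    -- cone.
    set c := (∑ j, pair w (μ j)) / ∑ j, pair y (μ j) with hc
    set w' := w - c • y with hw'
    have hw'0 : w' ≠ 0 := fun h => hws c (sub_eq_zero.1 h)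
    have hw'J : ∀ j, pair y (μ j) = 0 → pair w' (μ j) = 0 := fun j hj => by
      rw [hw', pair_sub_left, pair_smul_left, hj, hw j hj]; ring
    have hw's : ∑ j, pair w' (μ j) = 0 := by
      simp only [hw', pair_sub_left, pair_smul_left, Finset.sum_sub_distrib, ← Finset.mul_sum]
      rw [hc]; field_simp; ring
    have key : ∀ w', w' ≠ 0 → (∀ j, pair y (μ j) = 0 → pair w' (μ j) = 0) →
        ∑ j, pair w' (μ j) = 0 → ∃ t : ℝ, 0 < t ∧ Q (y + t • w') := by
      intro w' hw'0 hw'J hw's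
      have hneg : ∃ j, pair w' (μ j) < 0 := by
        by_contra! h
        exact hw'0 (hμ w' fun j => (Finset.sum_eq_zero_iff_of_nonneg fun j _ => h j).1 hw's j
          (Finset.mem_univ j))
      obtain ⟨t, ht, hyt, j, hj, hj0⟩ := exists_exit_point (ν := μ) (a := 0) (x := y)
        (fun j => by simpa using hy j) hneg
      simp only [Pi.zero_apply, add_zero] at hj0
      -- At `t = 0` the constraint reached would be active at `y`, hence orthogonal to `w'`.
      have htpos : 0 < t := by
        rcases ht.eq_or_lt with h | h
        · subst h
          simp only [zero_smul, add_zero] at hj0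
          exact absurd (hw'J j hj0) hj.ne
        · exact h
      refine ⟨t, htpos, ih _ ?_ _ (fun j => by simpa using hyt j) rfl⟩
      rw [← hk]
      apply Finset.card_lt_card
      refine ⟨fun i hi => ?_, fun h => ?_⟩
      · simp only [Finset.mem_filter, Finset.mem_univ, true_and] at hi ⊢
        exact fun h => hi (by rw [pair_add_left, pair_smul_left, h, hw'J i h]; ring)
      · have : j ∈ Finset.univ.filter fun j => pair y (μ j) ≠ 0 := by
          simp only [Finset.mem_filter, Finset.mem_univ, true_and]
          exact fun h => hj.ne (hw'J j h)
        simpa [hj0] using h this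
    obtain ⟨t₁, ht₁, h₁⟩ := key w' hw'0 hw'J hw's
    obtain ⟨t₂, ht₂, h₂⟩ := key (-w') (neg_ne_zero.2 hw'0)
      (fun j hj => by rw [pair_neg_left, hw'J j hj, neg_zero]) (by simp [pair_neg_left, hw's])
    -- `y` lies on the segment between the two exit points, each of which has more active
    -- constraints.
    have hsplit : y = (t₂ / (t₁ + t₂)) • (y + t₁ • w') + (t₁ / (t₁ + t₂)) • (y + t₂ • -w') := by
      have : t₁ + t₂ ≠ 0 := by positivity
      ext j
      simp only [Pi.add_apply, Pi.smul_apply, Pi.neg_apply, smul_eq_mul]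
      field_simp
      ring
    rw [hsplit]
    exact hadd _ _ (hsmul _ _ (by positivity) h₁) (hsmul _ _ (by positivity) h₂)

end Polyhedron

/-! ### Lattice vectors and dual bases -/

section Lattice

variable {n : ℕ}

/-- An integer vector as a real vector. -/
def intVec (w : Fin n → ℤ) : Fin n → ℝ := fun j => w j

theorem pair_intVec (x y : Fin n → ℤ) : pair (intVec x) (intVec y) = ((∑ j, x j * y j : ℤ) : ℝ) := by
  simp [pair, intVec]

def IsPrimitive (η : Fin n → ℤ) : Prop := ∀ k : ℕ, 1 < k → ¬ ∃ μ : Fin n → ℤ, η = (k : ℤ) • μ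

theorem exists_isPrimitive_smul {η : Fin n → ℤ} (hη : η ≠ 0) :
    ∃ (d : ℤ) (μ : Fin n → ℤ), 0 < d ∧ η = d • μ ∧ IsPrimitive μ := by
  obtain ⟨j, hj⟩ := Function.ne_iff.1 hη
  obtain ⟨μ, hμ, h1⟩ := Finset.extract_gcd η (s := Finset.univ) ⟨j, Finset.mem_univ j⟩
  have hd : 0 < Finset.univ.gcd η := by
    refine lt_of_le_of_ne ?_ fun h => ?_
    · rw [← Finset.normalize_gcd]; exact Int.nonneg_of_normalize_eq_self (normalize_idem _)
    · exact hj (Finset.gcd_eq_zero_iff.1 h.symm j (Finset.mem_univ j))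
  refine ⟨Finset.univ.gcd η, μ, hd, ?_, ?_⟩
  · ext i; simpa using hμ i (Finset.mem_univ i)
  · rintro k hk ⟨κ, rfl⟩
    have h : (k : ℤ) ∣ 1 := by
      rw [← h1]
      exact Finset.dvd_gcd fun i _ => ⟨κ i, by simp⟩
    have := Int.le_of_dvd one_pos h
    omega

/-- Normalized, the two families are the rows and columns of square matrices with product `1`; the
product in the other order is then also `1`, which is the expansion. -/
theorem eq_sum_of_biorthogonal {G H : Fin n → Fin n → ℝ} (hpos : ∀ k, pair (G k) (H k) ≠ 0)
    (horth : ∀ k k', k ≠ k' → pair (G k) (H k') = 0) (y : Fin n → ℝ) :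
    y = ∑ k, (pair y (H k) / pair (G k) (H k)) • G k := by
  have hAB : (Matrix.of fun k j => G k j / pair (G k) (H k)) * (Matrix.of fun j k => H k j) = 1 := by
    ext k k'
    simp only [Matrix.mul_apply, Matrix.of_apply, div_mul_eq_mul_div, ← Finset.sum_div]
    change pair (G k) (H k') / _ = _
    by_cases h : k = k'
    · subst h; simp [hpos]
    · simp [horth k k' h, h]
  have hBA := mul_eq_one_comm.1 hAB
  ext j
  have := congrFun (Matrix.vecMul_one y) j
  rw [← hBA, ← Matrix.vecMul_vecMul] at this
  rw [← this]
  simp only [Matrix.vecMul, dotProduct, Matrix.of_apply, Finset.sum_apply, Pi.smul_apply,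
    smul_eq_mul]
  refine Finset.sum_congr rfl fun k _ => ?_
  change pair y (H k) * (G k j / pair (G k) (H k)) = _
  ring

end Lattice

/-! ### The cone at a vertex of a simple rational polyhedron -/

section Vertex

variable {n m : ℕ} {ν : Fin m → LieAlg n} {a : Fin m → ℝ}

/-- The edge is cut out by the sum of the constraints that are active at `v` and orthogonal to `y`;
by `hline` its direction space is the line through `y`. -/
theorem IsPinned.isEdge_of_extreme {v y : LieDual n} (hv : IsPinned ν a v)
    (hy : ∀ j, pair v (ν j) + a j = 0 → 0 ≤ pair y (ν j)) (hy0 : y ≠ 0)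
    (hline : ∀ w, (∀ j, pair v (ν j) + a j = 0 → pair y (ν j) = 0 → pair w (ν j) = 0) →
      ∃ s : ℝ, w = s • y) :
    ∃ E ∈ edgesAt (halfSpaces ν a) v, ∃ t : ℝ, 0 < t ∧ v + t • y ∈ E := by
  classical
  obtain ⟨t, ht, htm⟩ := exists_pos_smul_mem hv.1 hy
  set J := Finset.univ.filter (fun j => pair v (ν j) + a j = 0 ∧ pair y (ν j) = 0) with hJ
  set E := {x ∈ halfSpaces ν a | pair x (∑ j ∈ J, ν j) + ∑ j ∈ J, a j = 0} with hE
  have hsum : ∀ x, pair x (∑ j ∈ J, ν j) + ∑ j ∈ J, a j = ∑ j ∈ J, (pair x (ν j) + a j) := by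
    intro x; rw [pair_sum_right, Finset.sum_add_distrib]
  have hmem : ∀ x, x ∈ E ↔ x ∈ halfSpaces ν a ∧ ∀ j ∈ J, pair x (ν j) + a j = 0 := by
    intro x
    refine and_congr_right fun hx => ?_
    rw [hsum, Finset.sum_eq_zero_iff_of_nonneg fun j _ => hx j]
  have hvE : v ∈ E := (hmem v).2 ⟨hv.1, fun j hj => by simp [hJ] at hj; exact hj.1⟩
  have htE : v + t • y ∈ E := (hmem _).2 ⟨htm, fun j hj => by
    simp only [hJ, Finset.mem_filter, Finset.mem_univ, true_and] at hj
    rw [pair_add_left, pair_smul_left, hj.2]; linarith [hj.1]⟩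
  have hspan : vectorSpan ℝ E = Submodule.span ℝ {y} := by
    apply le_antisymm
    · rw [vectorSpan_eq_span_vsub_set_right ℝ hvE, Submodule.span_le]
      rintro _ ⟨x, hx, rfl⟩
      obtain ⟨s, hs⟩ := hline (x - v) fun j hj hj' => by
        have h1 := ((hmem x).1 hx).2 j (by simp [hJ, hj, hj'])
        rw [pair_sub_left]; linarith
      simp only [vsub_eq_sub, SetLike.mem_coe, hs]
      exact Submodule.smul_mem _ _ (Submodule.mem_span_singleton_self y)
    · rw [Submodule.span_singleton_le_iff_mem]
      have h := vsub_mem_vectorSpan ℝ htE hvE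
      rw [vsub_eq_sub, add_sub_cancel_left] at h
      have h2 := Submodule.smul_mem _ t⁻¹ h
      rwa [smul_smul, inv_mul_cancel₀ ht.ne', one_smul] at h2
  refine ⟨E, ⟨⟨⟨∑ j ∈ J, ν j, ∑ j ∈ J, a j, fun x hx => ?_, rfl⟩, ⟨v, hvE⟩, ?_⟩, hvE⟩, t, ht, htE⟩
  · rw [hsum]; exact Finset.sum_nonneg fun j _ => hx j
  · rw [hspan, finrank_span_singleton hy0]

/-- Otherwise the edge would be the single point `v`, of dimension `0`. -/
theorem exists_pos_smul_mem_edge {P : Set (LieDual n)} {v w : LieDual n} {E : Set (LieDual n)}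
    (hE : E ∈ edgesAt P v) (hw : IsEdgeGenerator v E w) : ∃ s : ℝ, 0 < s ∧ v + s • w ∈ E := by
  by_contra! h
  have hsub : E = {v} := by
    refine Set.eq_singleton_iff_unique_mem.2 ⟨hE.2, fun x hx => ?_⟩
    obtain ⟨s, hs, rfl⟩ := hw.2 x hx
    rcases hs.eq_or_lt with h0 | h0
    · simp [← h0]
    · exact absurd hx (h s h0)
  have h1 := hE.1.2.2
  rw [hsub, vectorSpan_singleton] at h1
  simp at h1

/-- At a pinned point the cone of a simple rational polyhedron is spanned by a basis of lattice
vectors. -/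
theorem IsPinned.exists_lattice_basis {v : LieDual n} (hv : IsPinned ν a v)
    (hs : IsSimplePolyhedron (halfSpaces ν a)) (hr : IsRationalPolyhedron (halfSpaces ν a)) :
    ∃ (g : Fin n → Fin n → ℤ) (B : Module.Basis (Fin n) ℝ (LieDual n)),
      (∀ k, B k = intVec (g k)) ∧
      ∀ y, (∀ j, pair v (ν j) + a j = 0 → 0 ≤ pair y (ν j)) ↔ ∀ k, 0 ≤ B.repr y k := by
  classical
  obtain ⟨-, b, hb⟩ := hs v hv.isVertex
  have hfin : Finite (edgesAt (halfSpaces ν a) v) := Module.Finite.finite_basis b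
  have hfint := Fintype.ofFinite (edgesAt (halfSpaces ν a) v)
  have hbC : ∀ E, ∀ j, pair v (ν j) + a j = 0 → 0 ≤ pair (b E) (ν j) := by
    intro E j hj
    obtain ⟨s, hs, hsE⟩ := exists_pos_smul_mem_edge E.2 (hb E)
    obtain ⟨⟨_, _, _, hEq⟩, _⟩ := E.2.1
    rw [hEq] at hsE
    have h := hsE.1 j
    rw [pair_add_left, pair_smul_left] at h
    have h' : 0 ≤ s * pair (b E) (ν j) := by linarith
    exact nonneg_of_mul_nonneg_right h' hs
  have hcone : ∀ y, (∀ j, pair v (ν j) + a j = 0 → 0 ≤ pair y (ν j)) ↔ ∀ E, 0 ≤ b.repr y E := by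
    intro y
    constructor
    · intro hy
      -- Constraints inactive at `v` are replaced by `0`, so that the cone of `μ` is the cone at
      -- `v`. Its extreme rays are edges of the polyhedron, hence nonnegative multiples of basis
      -- vectors.
      set μ : Fin m → LieAlg n := fun j => if pair v (ν j) + a j = 0 then ν j else 0 with hμ
      refine cone_induction (μ := μ) (Q := fun y => ∀ E, 0 ≤ b.repr y E) (fun w hw => ?_) (by simp)
        (fun y z hy hz E => by simpa using add_nonneg (hy E) (hz E))
        (fun s y hs hy E => by simpa using mul_nonneg hs (hy E)) (fun y hy hy0 hline => ?_) y ?_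
      · refine hv.2 w fun j hj => ?_
        simpa [hμ, hj] using hw j
      · obtain ⟨E, hE, t, ht, htE⟩ := hv.isEdge_of_extreme (y := y)
          (fun j hj => by simpa [hμ, hj] using hy j) hy0 (fun w hw => hline w fun j hj => by
            by_cases h : pair v (ν j) + a j = 0
            · simpa [hμ, h] using hw j h (by simpa [hμ, h] using hj)
            · simp [hμ, h])
        obtain ⟨-, hgen⟩ := hb ⟨E, hE⟩
        obtain ⟨s, hs, hsy⟩ := hgen _ htE
        have hys : y = (t⁻¹ * s) • b ⟨E, hE⟩ := by
          rw [mul_smul, ← add_left_cancel hsy, smul_smul, inv_mul_cancel₀ ht.ne', one_smul]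
        intro E'
        rw [hys, map_smul, b.repr_self]
        simp only [Finsupp.smul_apply, Finsupp.single_apply, smul_eq_mul]
        split_ifs <;> positivity
      · intro j
        by_cases h : pair v (ν j) + a j = 0
        · simpa [hμ, h] using hy j h
        · simp [hμ, h]
    · intro hy j hj
      rw [← b.sum_repr y, pair_sum_left]
      refine Finset.sum_nonneg fun E _ => ?_
      rw [pair_smul_left]
      exact mul_nonneg (hy E) (hbC E j hj)
  have hray : ∀ E, ∃ (g : Fin n → ℤ) (r : ℝ), 0 < r ∧ intVec g = r • b E := by
    intro E
    -- The sum of the other coordinate functions vanishes on the cone exactly along the ray of `b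
    -- E`. That ray is therefore an edge of the cone, and rationality supplies a lattice generator.
    obtain ⟨ξ, hξ⟩ := exists_pair_eq (∑ E' ∈ Finset.univ.erase E, b.coord E')
    have hξ' : ∀ y, pair y ξ = ∑ E' ∈ Finset.univ.erase E, b.repr y E' := fun y => by
      rw [← hξ]; simp
    set R := {y ∈ coneAt (halfSpaces ν a) v | pair y ξ + 0 = 0} with hR
    have hRmem : ∀ y, y ∈ R ↔ ∃ s : ℝ, 0 ≤ s ∧ y = s • b E := by
      intro y
      constructor
      · rintro ⟨hy, hy0⟩
        rw [mem_coneAt_iff hv.1, hcone] at hy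
        rw [add_zero, hξ', Finset.sum_eq_zero_iff_of_nonneg fun E' _ => hy E'] at hy0
        refine ⟨b.repr y E, hy E, ?_⟩
        conv_lhs => rw [← b.sum_repr y]
        rw [Finset.sum_eq_single E (fun E' _ h => by rw [hy0 E' (by simp [h]), zero_smul])
          (fun h => absurd (Finset.mem_univ E) h)]
      · rintro ⟨s, hs, rfl⟩
        refine ⟨?_, ?_⟩
        · rw [mem_coneAt_iff hv.1]
          intro j hj
          rw [pair_smul_left]; exact mul_nonneg hs (hbC E j hj)
        · rw [add_zero, hξ']
          refine Finset.sum_eq_zero fun E' hE' => ?_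
          rw [map_smul, b.repr_self, Finsupp.smul_apply, Finsupp.single_eq_of_ne
            (Finset.ne_of_mem_erase hE'), smul_zero]
    have hbR : b E ∈ R := (hRmem _).2 ⟨1, zero_le_one, (one_smul _ _).symm⟩
    have h0R : (0 : LieDual n) ∈ R := (hRmem _).2 ⟨0, le_rfl, (zero_smul _ _).symm⟩
    have hedge : IsEdge (coneAt (halfSpaces ν a) v) R := by
      refine ⟨⟨ξ, 0, fun y hy => ?_, rfl⟩, ⟨_, h0R⟩, ?_⟩
      · rw [mem_coneAt_iff hv.1, hcone] at hy
        rw [add_zero, hξ']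
        exact Finset.sum_nonneg fun E' _ => hy E'
      · have : vectorSpan ℝ R = Submodule.span ℝ {b E} := by
          apply le_antisymm
          · rw [vectorSpan_eq_span_vsub_set_right ℝ h0R, Submodule.span_le]
            rintro _ ⟨x, hx, rfl⟩
            obtain ⟨s, -, rfl⟩ := (hRmem x).1 hx
            simp only [vsub_eq_sub, sub_zero, SetLike.mem_coe]
            exact Submodule.smul_mem _ _ (Submodule.mem_span_singleton_self _)
          · rw [Submodule.span_singleton_le_iff_mem]
            simpa using vsub_mem_vectorSpan ℝ hbR h0R
        rw [this, finrank_span_singleton (b.ne_zero E)]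
    obtain ⟨w, hw, hwR⟩ := hr v hv.isVertex R hedge
    choose g hg using hw
    have hgw : intVec g = w := funext fun j => (hg j).symm
    obtain ⟨s, hs, hsw⟩ : ∃ s : ℝ, 0 ≤ s ∧ b E = s • w := by
      have := hbR
      rw [hwR] at this
      exact this
    have hs0 : s ≠ 0 := by rintro rfl; exact b.ne_zero E (by simpa using hsw)
    refine ⟨g, s⁻¹, by positivity, ?_⟩
    rw [hgw, hsw, smul_smul, inv_mul_cancel₀ hs0, one_smul]
  choose g r hr hgr using hray
  have hcard : Nat.card (edgesAt (halfSpaces ν a) v) = n := by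
    rw [← Module.finrank_eq_nat_card_basis b]; simp
  let e := Finite.equivFinOfCardEq hcard
  refine ⟨fun k => g (e.symm k), (b.isUnitSMul fun E => (hr E).ne'.isUnit).reindex e, fun k => ?_,
    fun y => ?_⟩
  · simp [Module.Basis.isUnitSMul_apply, hgr]
  · rw [hcone, ← e.symm.forall_congr_right]
    refine forall_congr' fun k => ?_
    rw [Module.Basis.repr_reindex_apply, Module.Basis.repr_isUnitSMul]
    have := hr (e.symm k)
    rw [Units.smul_def, smul_eq_mul, Units.val_inv_eq_inv_val, IsUnit.unit_spec]
    constructor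
    · intro h; positivity
    · intro h; exact nonneg_of_mul_nonneg_right h (by positivity)

end Vertex

/-! ### Facets at a vertex -/

section Frame

variable {n m : ℕ} {ν : Fin m → LieAlg n} {a : Fin m → ℝ}

/-- The cone of the polyhedron at `v` is spanned by the lattice basis `g` and is cut out by the
primitive normals `η`, which are proportional to the dual basis. -/
structure IsFrame (ν : Fin m → LieAlg n) (a : Fin m → ℝ) (v : LieDual n)
    (g η : Fin n → Fin n → ℤ) : Prop where
  mem : v ∈ halfSpaces ν a
  pos : ∀ k, 0 < pair (intVec (g k)) (intVec (η k))
  orth : ∀ k k', k ≠ k' → pair (intVec (g k)) (intVec (η k')) = 0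
  primitive : ∀ k, IsPrimitive (η k)
  cone : ∀ y, (∀ j, pair v (ν j) + a j = 0 → 0 ≤ pair y (ν j)) ↔ ∀ k, 0 ≤ pair y (intVec (η k))

/-- The dual basis of an integral basis is given, up to scale, by the columns of the adjugate
matrix; dividing by the gcd of the entries makes them primitive. -/
theorem IsPinned.exists_isFrame {v : LieDual n} (hv : IsPinned ν a v)
    (hs : IsSimplePolyhedron (halfSpaces ν a)) (hr : IsRationalPolyhedron (halfSpaces ν a)) :
    ∃ g η, IsFrame ν a v g η := by
  obtain ⟨g, B, hB, hcone⟩ := hv.exists_lattice_basis hs hr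
  set A : Matrix (Fin n) (Fin n) ℤ := Matrix.of g with hA
  have hdet : A.det ≠ 0 := by
    have h1 : LinearIndependent ℝ (A.map (Int.castRingHom ℝ)).row := by
      convert B.linearIndependent using 1
      ext k j
      simp [hA, hB, intVec, Matrix.row]
    rw [Matrix.linearIndependent_rows_iff_isUnit, Matrix.isUnit_iff_isUnit_det,
      ← RingHom.mapMatrix_apply, ← RingHom.map_det] at h1
    intro h
    simp [h] at h1
  -- The extra factor `A.det` turns the diagonal value into a square, positive for either
  -- orientation of `g`.
  have hadj : ∀ k k', ∑ j, g k j * (A.det * A.adjugate j k') = if k = k' then A.det * A.det else 0 := by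
    intro k k'
    have := congrFun (congrFun (Matrix.mul_adjugate A) k) k'
    simp only [Matrix.mul_apply, Matrix.smul_apply, Matrix.one_apply, hA, Matrix.of_apply,
      smul_eq_mul] at this
    calc _ = A.det * ∑ j, g k j * A.adjugate j k' := by
          rw [Finset.mul_sum]; exact Finset.sum_congr rfl fun j _ => by ring
      _ = _ := by rw [this]; split_ifs <;> ring
  have hη : ∀ k, ∃ η : Fin n → ℤ, IsPrimitive η ∧ ∀ k',
      (k' = k → 0 < ∑ j, g k' j * η j) ∧ (k' ≠ k → ∑ j, g k' j * η j = 0) := by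
    intro k
    have hne : (fun j => A.det * A.adjugate j k) ≠ 0 := by
      intro h
      have h2 := hadj k k
      simp only [congrFun h] at h2
      simp [hdet] at h2
    obtain ⟨d, μ, hd, hμ, hprim⟩ := exists_isPrimitive_smul hne
    have hsum : ∀ k', d * ∑ j, g k' j * μ j = if k' = k then A.det * A.det else 0 := by
      intro k'
      rw [← hadj, Finset.mul_sum]
      refine Finset.sum_congr rfl fun j _ => ?_
      have := congrFun hμ j
      simp only [Pi.smul_apply, smul_eq_mul] at this
      rw [this]; ring
    refine ⟨μ, hprim, fun k' => ⟨fun h => ?_, fun h => ?_⟩⟩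
    · have h2 := hsum k'
      rw [if_pos h] at h2
      exact pos_of_mul_pos_right (h2 ▸ mul_self_pos.2 hdet) hd.le
    · have h2 := hsum k'
      rw [if_neg h] at h2
      exact (mul_eq_zero.1 h2).resolve_left hd.ne'
  choose η hprim hη using hη
  have hpos : ∀ k, 0 < pair (intVec (g k)) (intVec (η k)) := fun k => by
    rw [pair_intVec]; exact_mod_cast (hη k k).1 rfl
  have horth : ∀ k k', k ≠ k' → pair (intVec (g k)) (intVec (η k')) = 0 := fun k k' h => by
    rw [pair_intVec]; exact_mod_cast (hη k' k).2 h
  refine ⟨g, η, hv.1, hpos, horth, hprim, fun y => ?_⟩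
  rw [hcone]
  refine forall_congr' fun k => ?_
  have : pair y (intVec (η k)) = B.repr y k * pair (intVec (g k)) (intVec (η k)) := by
    conv_lhs => rw [← B.sum_repr y]
    rw [pair_sum_left, Finset.sum_eq_single k]
    · rw [pair_smul_left, hB]
    · intro k' _ h
      rw [pair_smul_left, hB, horth k' k h, mul_zero]
    · simp
  rw [this]
  exact (mul_nonneg_iff_of_pos_right (hpos k)).symm

/-! ### Facets and supporting functions through the apex of a frame -/

namespace IsFrame

variable {v : LieDual n} {g η : Fin n → Fin n → ℤ}

/-- The facet of the polyhedron with normal `ξ` through `v`. -/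
def facetThrough (ν : Fin m → LieAlg n) (a : Fin m → ℝ) (v : LieDual n) (ξ : LieAlg n) :
    Set (LieDual n) :=
  {x ∈ halfSpaces ν a | pair x ξ + -pair v ξ = 0}

theorem pair_sub_nonneg (h : IsFrame ν a v g η) {x : LieDual n} (hx : x ∈ halfSpaces ν a)
    (k : Fin n) : 0 ≤ pair (x - v) (intVec (η k)) := by
  refine (h.cone (x - v)).1 (fun j hj => ?_) k
  have := hx j
  rw [pair_sub_left]; linarith

theorem expand (h : IsFrame ν a v g η) (y : LieDual n) :
    y = ∑ k, (pair y (intVec (η k)) / pair (intVec (g k)) (intVec (η k))) • intVec (g k) :=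
  eq_sum_of_biorthogonal (fun k => (h.pos k).ne') h.orth y

theorem exists_step (h : IsFrame ν a v g η) (k : Fin n) :
    ∃ t : ℝ, 0 < t ∧ v + t • intVec (g k) ∈ halfSpaces ν a := by
  refine exists_pos_smul_mem h.mem ((h.cone _).2 fun k' => ?_)
  by_cases hk : k = k'
  · subst hk; exact (h.pos k).le
  · rw [h.orth k k' hk]

theorem mem_facetThrough (h : IsFrame ν a v g η) (ξ : LieAlg n) : v ∈ facetThrough ν a v ξ :=
  ⟨h.mem, add_neg_cancel _⟩

theorem step_mem_facetThrough (h : IsFrame ν a v g η) {k k' : Fin n} (hk : k ≠ k') {t : ℝ}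
    (ht : v + t • intVec (g k) ∈ halfSpaces ν a) :
    v + t • intVec (g k) ∈ facetThrough ν a v (intVec (η k')) := by
  refine ⟨ht, ?_⟩
  rw [pair_add_left, pair_smul_left, h.orth k k' hk]; ring

/-- The edge vectors other than the `k`-th stay in the facet for a short time, and they span the
hyperplane. -/
theorem vectorSpan_facetThrough (h : IsFrame ν a v g η) (k : Fin n) :
    vectorSpan ℝ (facetThrough ν a v (intVec (η k))) = (pairLeft (intVec (η k))).ker := by
  apply le_antisymm
  · rw [vectorSpan_eq_span_vsub_set_right ℝ (h.mem_facetThrough _), Submodule.span_le]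
    rintro _ ⟨x, hx, rfl⟩
    have : pair x (intVec (η k)) + -pair v (intVec (η k)) = 0 := hx.2
    simp only [vsub_eq_sub, SetLike.mem_coe, LinearMap.mem_ker, pairLeft_apply, pair_sub_left]
    linarith
  · intro y hy
    rw [LinearMap.mem_ker, pairLeft_apply] at hy
    rw [h.expand y]
    refine Submodule.sum_mem _ fun k' _ => ?_
    by_cases hk : k' = k
    · subst hk; rw [hy, zero_div, zero_smul]; exact Submodule.zero_mem _
    · obtain ⟨t, ht, htm⟩ := h.exists_step k'
      have h1 := vsub_mem_vectorSpan ℝ (h.step_mem_facetThrough hk htm) (h.mem_facetThrough _)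
      rw [vsub_eq_sub, add_sub_cancel_left] at h1
      have h2 := Submodule.smul_mem _ t⁻¹ h1
      rw [smul_smul, inv_mul_cancel₀ ht.ne', one_smul] at h2
      exact Submodule.smul_mem _ _ h2

theorem isFacet_facetThrough (h : IsFrame ν a v g η) (k : Fin n) :
    IsFacet (halfSpaces ν a) (facetThrough ν a v (intVec (η k))) := by
  refine ⟨n - 1, by have := k.pos; omega, ⟨_, _, fun x hx => ?_, rfl⟩, ⟨v, h.mem_facetThrough _⟩, ?_⟩
  · have := h.pair_sub_nonneg hx k
    rw [pair_sub_left] at this; linarith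
  · rw [h.vectorSpan_facetThrough]
    have hne : pairLeft (intVec (η k)) ≠ 0 := fun h0 => by
      have := h.pos k
      rw [← pairLeft_apply, h0] at this
      simp at this
    have := Module.Dual.finrank_ker_add_one_of_ne_zero hne
    rw [Module.finrank_fin_fun] at this
    exact Nat.eq_sub_of_add_eq this

/-- On the polyhedron a function supporting `F` is a sum of nonnegative terms, one for each edge
vector. So `F` lies in the `k`-th facet whenever the `k`-th edge vector has positive value. Some
value is positive, else `F` would span everything; by dimension no second one can be. -/
theorem eq_facetThrough (h : IsFrame ν a v g η) {F : Set (LieDual n)}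
    (hF : IsFacet (halfSpaces ν a) F) (hvF : v ∈ F) :
    ∃ k, F = facetThrough ν a v (intVec (η k)) := by
  obtain ⟨r, hr, ⟨ξ, c, hξ, rfl⟩, -, hdim⟩ := hF
  have hvc : pair v ξ + c = 0 := hvF.2
  have hc : ∀ k, 0 ≤ pair (intVec (g k)) ξ := fun k => by
    obtain ⟨t, ht, htm⟩ := h.exists_step k
    have := hξ _ htm
    rw [pair_add_left, pair_smul_left] at this
    exact nonneg_of_mul_nonneg_right (by linarith : 0 ≤ t * pair (intVec (g k)) ξ) ht
  have hexp : ∀ x, pair x ξ + c = ∑ k, pair (x - v) (intVec (η k)) /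
      pair (intVec (g k)) (intVec (η k)) * pair (intVec (g k)) ξ := by
    intro x
    have : pair (x - v) ξ = pair x ξ + c := by rw [pair_sub_left]; linarith
    rw [← this]
    conv_lhs => rw [h.expand (x - v)]
    simp only [pair_sum_left, pair_smul_left]
  have hterm : ∀ x ∈ halfSpaces ν a, ∀ k, 0 ≤ pair (x - v) (intVec (η k)) /
      pair (intVec (g k)) (intVec (η k)) * pair (intVec (g k)) ξ := fun x hx k =>
    mul_nonneg (div_nonneg (h.pair_sub_nonneg hx k) (h.pos k).le) (hc k)
  have hsub : ∀ k, 0 < pair (intVec (g k)) ξ →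
      {x ∈ halfSpaces ν a | pair x ξ + c = 0} ⊆ facetThrough ν a v (intVec (η k)) := by
    rintro k hk x ⟨hx, hx0⟩
    rw [hexp, Finset.sum_eq_zero_iff_of_nonneg fun k _ => hterm x hx k] at hx0
    have h1 := hx0 k (Finset.mem_univ k)
    have h2 := h.pos k
    have h3 : pair (x - v) (intVec (η k)) = 0 := by
      rcases mul_eq_zero.1 h1 with h4 | h4
      · exact (div_eq_zero_iff.1 h4).resolve_right h2.ne'
      · exact absurd h4 hk.ne'
    refine ⟨hx, ?_⟩
    rw [pair_sub_left] at h3; linarith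
  obtain ⟨k, hk⟩ : ∃ k, 0 < pair (intVec (g k)) ξ := by
    by_contra! hall
    have hz : ∀ k, pair (intVec (g k)) ξ = 0 := fun k => le_antisymm (hall k) (hc k)
    have htop : vectorSpan ℝ {x ∈ halfSpaces ν a | pair x ξ + c = 0} = ⊤ := by
      rw [eq_top_iff]
      intro y _
      rw [h.expand y]
      refine Submodule.sum_mem _ fun k _ => Submodule.smul_mem _ _ ?_
      obtain ⟨t, ht, htm⟩ := h.exists_step k
      have hmem : v + t • intVec (g k) ∈ {x ∈ halfSpaces ν a | pair x ξ + c = 0} :=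
        ⟨htm, by rw [pair_add_left, pair_smul_left, hz]; linarith⟩
      have h1 := vsub_mem_vectorSpan ℝ hmem hvF
      rw [vsub_eq_sub, add_sub_cancel_left] at h1
      have h2 := Submodule.smul_mem _ t⁻¹ h1
      rwa [smul_smul, inv_mul_cancel₀ ht.ne', one_smul] at h2
    rw [htop] at hdim
    simp at hdim
    omega
  have hspan : vectorSpan ℝ {x ∈ halfSpaces ν a | pair x ξ + c = 0} =
      vectorSpan ℝ (facetThrough ν a v (intVec (η k))) := by
    apply Submodule.eq_of_le_of_finrank_eq (vectorSpan_mono ℝ (hsub k hk))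
    obtain ⟨r', hr', -, -, hdim'⟩ := h.isFacet_facetThrough k
    rw [hdim, hdim']; omega
  -- A second positive edge would put `F` into two facets through `v`, and the two hyperplanes would
  -- agree, although `g k'` lies in one and not in the other.
  have hother : ∀ k', k' ≠ k → pair (intVec (g k')) ξ = 0 := by
    intro k' hk'
    by_contra hne
    have h1 := vectorSpan_mono ℝ (hsub k' (lt_of_le_of_ne (hc k') (Ne.symm hne)))
    rw [hspan, h.vectorSpan_facetThrough, h.vectorSpan_facetThrough] at h1
    have h2 := h1 (show intVec (g k') ∈ _ by simp [h.orth k' k hk'])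
    rw [LinearMap.mem_ker, pairLeft_apply] at h2
    exact (h.pos k').ne' h2
  refine ⟨k, (hsub k hk).antisymm ?_⟩
  rintro x ⟨hx, hx0⟩
  refine ⟨hx, ?_⟩
  rw [hexp, Finset.sum_eq_single k (fun k' _ hk' => by rw [hother k' hk', mul_zero]) (by simp),
    pair_sub_left]
  rw [← sub_eq_add_neg] at hx0
  rw [hx0]; simp

/-- Any function that supports the `k`-th facet is, up to a constant, a positive multiple of its
normal. This is read off from short steps along the edges. -/
theorem pair_of_facetThrough (h : IsFrame ν a v g η) {ξ : LieAlg n} {c : ℝ} {k : Fin n}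
    (hξ : ∀ x ∈ halfSpaces ν a, 0 ≤ pair x ξ + c)
    (hk : {x ∈ halfSpaces ν a | pair x ξ + c = 0} = facetThrough ν a v (intVec (η k))) :
    0 < pair (intVec (g k)) ξ ∧ ∀ k', k' ≠ k → pair (intVec (g k')) ξ = 0 := by
  have hv : pair v ξ + c = 0 := by
    have := h.mem_facetThrough (intVec (η k)); rw [← hk] at this; exact this.2
  constructor
  · obtain ⟨t, ht, htm⟩ := h.exists_step k
    have h1 : 0 < pair (v + t • intVec (g k)) ξ + c := by
      refine lt_of_le_of_ne (hξ _ htm) fun h0 => ?_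
      have : v + t • intVec (g k) ∈ facetThrough ν a v (intVec (η k)) := hk ▸ ⟨htm, h0.symm⟩
      have h2 := this.2
      rw [pair_add_left, pair_smul_left] at h2
      have := mul_pos ht (h.pos k)
      linarith
    rw [pair_add_left, pair_smul_left] at h1
    exact pos_of_mul_pos_right (by linarith : 0 < t * pair (intVec (g k)) ξ) ht.le
  · intro k' hk'
    obtain ⟨t, ht, htm⟩ := h.exists_step k'
    have h1 := h.step_mem_facetThrough hk' htm
    rw [← hk] at h1
    have h2 := h1.2
    rw [pair_add_left, pair_smul_left] at h2
    have : t * pair (intVec (g k')) ξ = 0 := by linarith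
    exact (mul_eq_zero.1 this).resolve_left ht.ne'

end IsFrame

/-- A face containing `x` contains every point at which all constraints active at `x` are active. -/
theorem face_vanishes {x v : LieDual n} (hx : x ∈ halfSpaces ν a) (hv : v ∈ halfSpaces ν a)
    (hxv : ∀ j, pair x (ν j) + a j = 0 → pair v (ν j) + a j = 0) {ξ : LieAlg n} {c : ℝ}
    (hξ : ∀ x ∈ halfSpaces ν a, 0 ≤ pair x ξ + c) (h0 : pair x ξ + c = 0) : pair v ξ + c = 0 := by
  obtain ⟨t, ht, htm⟩ := exists_pos_smul_mem (y := x - v) hx fun j hj => by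
    rw [pair_sub_left]; linarith [hxv j hj]
  have h1 := hξ _ htm
  have h2 := hξ _ hv
  rw [pair_add_left, pair_smul_left, pair_sub_left] at h1
  have h3 : 0 ≤ t * -(pair v ξ + c) := by
    have : pair x ξ = -c := by linarith
    rw [this] at h1
    linarith
  have := nonneg_of_mul_nonneg_right h3 ht
  linarith

/-- A pinned point is determined by its set of active constraints. -/
theorem finite_isPinned : {v | IsPinned ν a v}.Finite := by
  classical
  refine Set.Finite.of_finite_image (f := fun v => Finset.univ.filter fun j => pair v (ν j) + a j = 0)
    (Set.toFinite _) fun v hv v' hv' h => ?_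
  rw [← sub_eq_zero]
  refine hv.2 _ fun j hj => ?_
  have : j ∈ Finset.univ.filter fun j => pair v' (ν j) + a j = 0 := by
    have h' : (Finset.univ.filter fun j => pair v (ν j) + a j = 0) =
      Finset.univ.filter fun j => pair v' (ν j) + a j = 0 := h
    rw [← h']; simpa using hj
  simp only [Finset.mem_filter, Finset.mem_univ, true_and] at this
  rw [pair_sub_left]; linarith

theorem exists_isPinned_mem_facet (hν : ¬ ContainsLine (halfSpaces ν 0)) {F : Set (LieDual n)}
    (hF : IsFacet (halfSpaces ν a) F) : ∃ v ∈ F, IsPinned ν a v := by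
  obtain ⟨r, hr, ⟨ξ, c, hξ, rfl⟩, ⟨x, hx⟩, -⟩ := hF
  obtain ⟨v, hv, hxv⟩ := exists_isPinned_of_mem hν hx.1
  exact ⟨v, ⟨hv.1, face_vanishes hx.1 hv.1 hxv hξ hx.2⟩, hv⟩

theorem exists_primitive_normal (hν : ¬ ContainsLine (halfSpaces ν 0))
    (hs : IsSimplePolyhedron (halfSpaces ν a)) (hr : IsRationalPolyhedron (halfSpaces ν a))
    {F : Set (LieDual n)} (hF : IsFacet (halfSpaces ν a) F) :
    ∃ (μ : Fin n → ℤ) (c : ℝ), IsPrimitive μ ∧ (∀ x ∈ halfSpaces ν a, 0 ≤ pair x (intVec μ) + c) ∧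
      F = {x ∈ halfSpaces ν a | pair x (intVec μ) + c = 0} := by
  obtain ⟨v, hvF, hv⟩ := exists_isPinned_mem_facet hν hF
  obtain ⟨g, η, h⟩ := hv.exists_isFrame hs hr
  obtain ⟨k, hk⟩ := h.eq_facetThrough hF hvF
  refine ⟨η k, _, h.primitive k, fun x hx => ?_, hk⟩
  have := h.pair_sub_nonneg hx k
  rw [pair_sub_left] at this; linarith

theorem finite_isFacet (hν : ¬ ContainsLine (halfSpaces ν 0))
    (hs : IsSimplePolyhedron (halfSpaces ν a)) (hr : IsRationalPolyhedron (halfSpaces ν a)) :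
    {F | IsFacet (halfSpaces ν a) F}.Finite := by
  refine Set.Finite.subset (finite_isPinned (ν := ν) (a := a) |>.biUnion (t := fun v =>
    {F | IsFacet (halfSpaces ν a) F ∧ v ∈ F}) fun v hv => ?_) fun F hF => ?_
  · obtain ⟨g, η, h⟩ := IsPinned.exists_isFrame hv hs hr
    refine Set.Finite.subset (Set.finite_range fun k => IsFrame.facetThrough ν a v (intVec (η k))) ?_
    rintro F ⟨hF, hvF⟩
    obtain ⟨k, rfl⟩ := h.eq_facetThrough hF hvF
    exact ⟨k, rfl⟩
  · obtain ⟨v, hvF, hv⟩ := exists_isPinned_mem_facet hν hF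
    exact Set.mem_biUnion (show v ∈ {v | IsPinned ν a v} from hv) ⟨hF, hvF⟩

/-- A polyhedron without lines is the intersection of its cones at pinned points. Going from a point
`x₀` of the polyhedron towards `x`, the constraint met on exit is active at some pinned point, so
`x` satisfies it; hence the exit is not before `x`. -/
theorem mem_of_forall_isPinned (hν : ¬ ContainsLine (halfSpaces ν 0))
    (hne : (halfSpaces ν a).Nonempty) {x : LieDual n}
    (hx : ∀ v, IsPinned ν a v → ∀ j, pair v (ν j) + a j = 0 → 0 ≤ pair x (ν j) + a j) :
    x ∈ halfSpaces ν a := by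
  obtain ⟨x₀, hx₀⟩ := hne
  by_cases hneg : ∃ j, pair (x - x₀) (ν j) < 0
  · obtain ⟨t, ht, htm, j, hj, hj0⟩ := exists_exit_point hx₀ hneg
    obtain ⟨v, hv, hv'⟩ := exists_isPinned_of_mem hν htm
    have h1 := hx v hv j (hv' j hj0)
    have ht1 : 1 ≤ t := by
      by_contra! hlt
      rw [pair_add_left, pair_smul_left] at hj0
      have h2 := pair_sub_left x x₀ (ν j)
      have : (1 - t) * pair (x - x₀) (ν j) < 0 := mul_neg_of_pos_of_neg (by linarith) hj
      linarith
    intro i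
    have h2 := htm i
    have h3 := hx₀ i
    rw [pair_add_left, pair_smul_left, pair_sub_left] at h2
    have h4 : pair x (ν i) + a i = t⁻¹ * (pair x₀ (ν i) + t * (pair x (ν i) - pair x₀ (ν i)) + a i)
        + (1 - t⁻¹) * (pair x₀ (ν i) + a i) := by
      field_simp; ring
    rw [h4]
    have h5 : t⁻¹ ≤ 1 := inv_le_one_of_one_le₀ ht1
    exact add_nonneg (mul_nonneg (by positivity) h2) (mul_nonneg (by linarith) h3)
  · push Not at hneg
    intro j
    have := hneg j
    rw [pair_sub_left] at this
    linarith [hx₀ j]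

/-- At a pinned point the cone is cut out by facet normals, and any supporting function of a facet
is proportional to its normal there. So one inequality for each facet suffices. -/
theorem mem_of_forall_facet (hν : ¬ ContainsLine (halfSpaces ν 0))
    (hs : IsSimplePolyhedron (halfSpaces ν a)) (hr : IsRationalPolyhedron (halfSpaces ν a))
    (hne : (halfSpaces ν a).Nonempty) {x : LieDual n}
    (hx : ∀ F, IsFacet (halfSpaces ν a) F → ∃ (ξ : LieAlg n) (c : ℝ),
      (∀ x ∈ halfSpaces ν a, 0 ≤ pair x ξ + c) ∧
      F = {x ∈ halfSpaces ν a | pair x ξ + c = 0} ∧ 0 ≤ pair x ξ + c) :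
    x ∈ halfSpaces ν a := by
  refine mem_of_forall_isPinned hν hne fun v hv => ?_
  obtain ⟨g, η, h⟩ := hv.exists_isFrame hs hr
  suffices hc : ∀ k, 0 ≤ pair (x - v) (intVec (η k)) by
    intro j hj
    have := (h.cone _).2 hc j hj
    rw [pair_sub_left] at this; linarith
  intro k
  obtain ⟨ξ, c, hξ, hF, hxξ⟩ := hx _ (h.isFacet_facetThrough k)
  obtain ⟨hk, hk'⟩ := h.pair_of_facetThrough hξ hF.symm
  have hv0 : pair v ξ + c = 0 := by
    have := h.mem_facetThrough (intVec (η k)); rw [hF] at this; exact this.2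
  have h1 : 0 ≤ pair (x - v) ξ := by rw [pair_sub_left]; linarith
  rw [h.expand (x - v), pair_sum_left, Finset.sum_eq_single k
    (fun k' _ h' => by rw [pair_smul_left, hk' k' h', mul_zero]) (by simp), pair_smul_left] at h1
  have h2 := nonneg_of_mul_nonneg_left h1 hk
  have h3 := mul_nonneg h2 (h.pos k).le
  rwa [div_mul_cancel₀ _ (h.pos k).ne'] at h3

end Frame

/-! ### Facet presentations and their vertices -/

/-- Choose a primitive normal for each of the finitely many facets and scale by the label, which
changes neither the half space nor the facet. -/
theorem exists_facetPresentation {n : ℕ} (P : LabeledPolyhedron n) : Nonempty (FacetPresentation P) := by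
  obtain ⟨m, ν, a, hP, hν⟩ := P.proper
  have hs := P.simple
  have hr := P.rational
  have hne := P.nonempty
  rw [hP] at hs hr hne
  have hfin : Finite {F // IsFacet P.carrier F} := by
    rw [hP]; exact (finite_isFacet hν hs hr).to_subtype
  have hnorm : ∀ F : {F // IsFacet P.carrier F}, ∃ (μ : Fin n → ℤ) (c : ℝ), IsPrimitive μ ∧
      (∀ x ∈ P.carrier, 0 ≤ pair x (intVec μ) + c) ∧
      (F : Set (LieDual n)) = {x ∈ P.carrier | pair x (intVec μ) + c = 0} := by
    rintro ⟨F, hF⟩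
    change ∃ (μ : Fin n → ℤ) (c : ℝ), IsPrimitive μ ∧
      (∀ x ∈ P.carrier, 0 ≤ pair x (intVec μ) + c) ∧ F = {x ∈ P.carrier | pair x (intVec μ) + c = 0}
    rw [hP] at hF ⊢
    exact exists_primitive_normal hν hs hr hF
  choose μ c hprim hnn hF using hnorm
  let e := (Finite.equivFin {F // IsFacet P.carrier F}).symm
  have hval : ∀ i x, pair x (fun j => ((P.label (e i) : ℕ) : ℝ) * (μ (e i) j : ℝ)) +
      ((P.label (e i) : ℕ) : ℝ) * c (e i) =
      ((P.label (e i) : ℕ) : ℝ) * (pair x (intVec (μ (e i))) + c (e i)) := by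
    intro i x
    have : (fun j => ((P.label (e i) : ℕ) : ℝ) * (μ (e i) j : ℝ)) =
      ((P.label (e i) : ℕ) : ℝ) • intVec (μ (e i)) := rfl
    rw [this, pair_smul_right]; ring
  have hlab : ∀ i, (0 : ℝ) < ((P.label (e i) : ℕ) : ℝ) := fun i => by exact_mod_cast (P.label (e i)).pos
  refine ⟨⟨_, e, fun i => μ (e i), fun i => ((P.label (e i) : ℕ) : ℝ) * c (e i),
    fun i => hprim (e i), ?_, fun i => ?_⟩⟩
  · ext x
    constructor
    · intro hx i
      rw [hval]
      exact mul_nonneg (hlab i).le (hnn _ x hx)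
    · intro hx
      rw [hP]
      refine mem_of_forall_facet hν hs hr hne fun F hFf => ?_
      rw [← hP] at hFf ⊢
      obtain ⟨i, hi⟩ := e.surjective ⟨F, hFf⟩
      refine ⟨intVec (μ (e i)), c (e i), hnn _, ?_, ?_⟩
      · rw [← hF, hi]
      · have := hx i
        rw [hval] at this
        exact nonneg_of_mul_nonneg_right this (hlab i)
  · rw [hF]
    ext x
    refine and_congr_right fun _ => ?_
    rw [hval, mul_eq_zero, or_iff_right (hlab i).ne']

namespace FacetPresentation

variable {n : ℕ} {P : LabeledPolyhedron n} (D : FacetPresentation P)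

/-- The affine function `⟨x, mᵢ nᵢ⟩ + aᵢ`. -/
def slack (i : Fin D.N) (x : LieDual n) : ℝ := pair x (intVec (D.weight i)) + D.offset i

/-- A vertex of the polyhedron: the indices of the `n` facets through it, and lattice vectors along
its edges. -/
structure Vertex where
  idx : Fin n → Fin D.N
  point : LieDual n
  slack_idx : ∀ k, D.slack (idx k) point = 0
  slack_pos : ∀ i, i ∉ Set.range idx → 0 < D.slack i point
  edge : Fin n → Fin n → ℤ
  pos : ∀ k, 0 < ∑ j, edge k j * D.weight (idx k) j
  orth : ∀ k k', k ≠ k' → ∑ j, edge k j * D.weight (idx k') j = 0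

theorem intVec_weight (i : Fin D.N) : intVec (D.weight i) =
    fun j => ((P.label (D.facet i) : ℕ) : ℝ) * (D.normal i j : ℝ) := by
  ext j; simp [intVec, weight]

theorem mem_carrier_iff (x : LieDual n) : x ∈ P.carrier ↔ ∀ i, 0 ≤ D.slack i x := by
  rw [D.carrier_eq]
  simp only [slack, intVec_weight]
  rfl

theorem facet_eq_slack (i : Fin D.N) :
    (D.facet i : Set (LieDual n)) = {x ∈ P.carrier | D.slack i x = 0} := by
  rw [D.facet_eq i]; simp only [slack, intVec_weight]

/-- A pinned point on all faces through `x` is used. Its frame facets are all the facets through it,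
which gives the indices `idx`. -/
theorem exists_vertex {x : LieDual n} (hx : x ∈ P.carrier) :
    ∃ V : D.Vertex, ∀ i, D.slack i x = 0 → i ∈ Set.range V.idx := by
  obtain ⟨m, ν, a, hP, hν⟩ := P.proper
  have hs := P.simple
  have hr := P.rational
  rw [hP] at hs hr hx
  obtain ⟨v, hv, hxv⟩ := exists_isPinned_of_mem hν hx
  obtain ⟨g, η, h⟩ := hv.exists_isFrame hs hr
  have hfac : ∀ k, IsFacet P.carrier (IsFrame.facetThrough ν a v (intVec (η k))) := fun k => by
    rw [hP]; exact h.isFacet_facetThrough k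
  have hnn : ∀ i, ∀ x ∈ halfSpaces ν a, 0 ≤ D.slack i x := fun i x hx =>
    (D.mem_carrier_iff x).1 (hP ▸ hx) i
  let idx : Fin n → Fin D.N := fun k => D.facet.symm ⟨_, hfac k⟩
  have hidx : ∀ k, {x ∈ halfSpaces ν a | D.slack (idx k) x = 0} =
      IsFrame.facetThrough ν a v (intVec (η k)) := fun k => by
    have := D.facet_eq_slack (idx k)
    rw [← hP, ← this]; simp [idx]
  have hrange : ∀ i, D.slack i v = 0 → i ∈ Set.range idx := by
    intro i hi
    have h1 : IsFacet (halfSpaces ν a) (D.facet i : Set (LieDual n)) := hP ▸ (D.facet i).2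
    have h2 : v ∈ (D.facet i : Set (LieDual n)) := by
      rw [D.facet_eq_slack]; exact ⟨hP ▸ hv.1, hi⟩
    obtain ⟨k, hk⟩ := h.eq_facetThrough h1 h2
    refine ⟨k, ?_⟩
    rw [Equiv.symm_apply_eq]
    exact Subtype.ext hk.symm
  have hpair := fun k => h.pair_of_facetThrough (hnn (idx k)) (hidx k)
  refine ⟨⟨idx, v, fun k => ?_, fun i hi => ?_, g, fun k => ?_, fun k k' hk => ?_⟩, fun i hi =>
    hrange i (face_vanishes hx hv.1 hxv (hnn i) hi)⟩
  · have := h.mem_facetThrough (intVec (η k))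
    rw [← hidx] at this
    exact this.2
  · exact lt_of_le_of_ne (hnn i v hv.1) fun h0 => hi (hrange i h0.symm)
  · have := (hpair k).1
    rw [pair_intVec] at this
    exact_mod_cast this
  · have := (hpair k').2 k hk
    rw [pair_intVec] at this
    exact_mod_cast this

end FacetPresentation

namespace FacetPresentation

variable {n : ℕ} {P : LabeledPolyhedron n} (D : FacetPresentation P)

/-! ### Coordinates at a vertex -/

theorem slack_add_smul (i : Fin D.N) (x y : LieDual n) (t : ℝ) :
    D.slack i (x + t • y) = D.slack i x + t * pair y (intVec (D.weight i)) := by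
  rw [slack, slack, pair_add_left, pair_smul_left]; ring

theorem continuous_slack (i : Fin D.N) : Continuous (D.slack i) :=
  (continuous_pair_left _).add continuous_const

variable {D}

namespace Vertex

variable (V : D.Vertex)

/-- The pairing of the edge vector with the normal of the facet opposite to it. -/
def deg (k : Fin n) : ℝ := pair (intVec (V.edge k)) (intVec (D.weight (V.idx k)))

theorem deg_pos (k : Fin n) : 0 < V.deg k := by
  rw [deg, pair_intVec]; exact_mod_cast V.pos k

theorem pair_edge {k k' : Fin n} (h : k ≠ k') :
    pair (intVec (V.edge k)) (intVec (D.weight (V.idx k'))) = 0 := by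
  rw [pair_intVec]; exact_mod_cast V.orth k k' h

theorem idx_injective : Function.Injective V.idx := by
  intro k k' h
  by_contra hk
  have h1 := V.pair_edge hk
  rw [← h] at h1
  exact (V.deg_pos k).ne' h1

theorem expand (y : LieDual n) :
    y = ∑ k, (pair y (intVec (D.weight (V.idx k))) / V.deg k) • intVec (V.edge k) :=
  eq_sum_of_biorthogonal (G := fun k => intVec (V.edge k))
    (H := fun k => intVec (D.weight (V.idx k))) (fun k => (V.deg_pos k).ne')
    (fun _ _ h => V.pair_edge h) y

/-- The coordinates of `ξ` in the basis of the normals of the facets through the vertex. -/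
def coeff (ξ : LieAlg n) (k : Fin n) : ℝ := pair (intVec (V.edge k)) ξ / V.deg k

theorem expand_dual (ξ : LieAlg n) : ξ = ∑ k, V.coeff ξ k • intVec (D.weight (V.idx k)) := by
  have h := eq_sum_of_biorthogonal (G := fun k => intVec (D.weight (V.idx k)))
    (H := fun k => intVec (V.edge k))
    (fun k => by rw [pair_comm]; exact (V.deg_pos k).ne')
    (fun k k' h => by rw [pair_comm]; exact V.pair_edge h.symm) ξ
  conv_lhs => rw [h]
  refine Finset.sum_congr rfl fun k _ => ?_
  rw [coeff, deg, pair_comm ξ, pair_comm (intVec (D.weight (V.idx k)))]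

/-- The point at which the slack of the `k`-th facet through the vertex is `r k`. -/
def coord (r : Fin n → ℝ) : LieDual n := V.point + ∑ k, (r k / V.deg k) • intVec (V.edge k)

theorem slack_coord (r : Fin n → ℝ) (i : Fin D.N) :
    D.slack i (V.coord r) = D.slack i V.point + ∑ k, r k * V.coeff (intVec (D.weight i)) k := by
  have := D.slack_add_smul i V.point (∑ k, (r k / V.deg k) • intVec (V.edge k)) 1
  rw [one_smul, one_mul] at this
  rw [coord, this, pair_sum_left]
  congr 1
  refine Finset.sum_congr rfl fun k _ => ?_
  rw [pair_smul_left, coeff]; ring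

theorem coeff_weight_idx (k k' : Fin n) :
    V.coeff (intVec (D.weight (V.idx k'))) k = if k = k' then 1 else 0 := by
  rw [coeff]
  split_ifs with h
  · subst h; exact div_self (V.deg_pos k).ne'
  · rw [V.pair_edge h, zero_div]

@[simp] theorem slack_coord_idx (r : Fin n → ℝ) (k : Fin n) : D.slack (V.idx k) (V.coord r) = r k := by
  rw [slack_coord, V.slack_idx]
  simp [coeff_weight_idx]

theorem ext_slack {x y : LieDual n} (h : ∀ k, D.slack (V.idx k) x = D.slack (V.idx k) y) : x = y := by
  rw [← sub_eq_zero, V.expand (x - y)]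
  refine Finset.sum_eq_zero fun k _ => ?_
  have := h k
  simp only [slack, add_left_inj] at this
  rw [pair_sub_left, this, sub_self, zero_div, zero_smul]

theorem eq_coord {x : LieDual n} {r : Fin n → ℝ} (h : ∀ k, D.slack (V.idx k) x = r k) :
    x = V.coord r :=
  V.ext_slack fun k => by rw [h, slack_coord_idx]

theorem continuous_coord : Continuous V.coord := by
  unfold coord; fun_prop

end Vertex

variable (D)

theorem nonempty_vertex : Nonempty D.Vertex := by
  obtain ⟨x, hx⟩ := P.nonempty
  exact ⟨(D.exists_vertex hx).choose⟩

theorem ext_slack {x y : LieDual n} (h : ∀ i, D.slack i x = D.slack i y) : x = y :=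
  D.nonempty_vertex.some.ext_slack fun _ => h _

/-- In the relative interior of a facet all other facets are inactive. -/
theorem slack_of_mem_intrinsicInterior {i : Fin D.N} {x : LieDual n}
    (hx : x ∈ intrinsicInterior ℝ (D.facet i : Set (LieDual n))) :
    D.slack i x = 0 ∧ ∀ j, j ≠ i → 0 < D.slack j x := by
  have hxF := intrinsicInterior_subset hx
  have hxF' := hxF
  rw [D.facet_eq_slack] at hxF'
  refine ⟨hxF'.2, fun j hj => lt_of_le_of_ne ((D.mem_carrier_iff x).1 hxF'.1 j) fun h0 => ?_⟩
  obtain ⟨V, hV⟩ := D.exists_vertex hxF'.1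
  obtain ⟨k, hk⟩ := hV i hxF'.2
  obtain ⟨k', hk'⟩ := hV j h0.symm
  have hkk' : k' ≠ k := by rintro rfl; exact hj (hk'.symm.trans hk)
  -- If facet `j` also contained `x`, one could start at a vertex on both facets and follow the edge
  -- that leaves only facet `j`. This gives `y` in facet `i` with positive `j`-th slack.
  obtain ⟨t, ht, htm⟩ := exists_pos_smul_mem (ν := fun i => intVec (D.weight i)) (a := D.offset)
    (v := V.point) (y := intVec (V.edge k'))
    (fun i => by
      by_cases hi : i ∈ Set.range V.idx
      · obtain ⟨k, rfl⟩ := hi; exact (V.slack_idx k).ge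
      · exact (V.slack_pos i hi).le)
    (fun i hi => by
      by_cases hi' : i ∈ Set.range V.idx
      · obtain ⟨l, rfl⟩ := hi'
        by_cases hl : k' = l
        · subst hl; exact (V.deg_pos _).le
        · exact (V.pair_edge hl).ge
      · exact absurd hi (V.slack_pos i hi').ne')
  set y := V.point + t • intVec (V.edge k') with hy
  have hyF : y ∈ (D.facet i : Set (LieDual n)) := by
    rw [D.facet_eq_slack]
    refine ⟨(D.mem_carrier_iff y).2 htm, ?_⟩
    rw [hy, slack_add_smul, ← hk, V.slack_idx, V.pair_edge hkk']; ring
  have hyj : 0 < D.slack j y := by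
    rw [hy, slack_add_smul, ← hk', V.slack_idx, zero_add]
    exact mul_pos ht (V.deg_pos k')
  obtain ⟨x', hx', hxx'⟩ := hx
  -- The line through `x` and `y` stays in the affine span of the facet. Slightly beyond `x`, at
  -- negative `s`, the `j`-th slack is negative, which contradicts interiority.
  let f : ℝ → affineSpan ℝ (D.facet i : Set (LieDual n)) := fun s =>
    ⟨AffineMap.lineMap x y s, AffineMap.lineMap_mem s (mem_affineSpan ℝ hxF) (mem_affineSpan ℝ hyF)⟩
  have hf : Continuous f := Continuous.subtype_mk AffineMap.lineMap_continuous _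
  have hf0 : f 0 = x' := Subtype.ext (by simp [f, hxx'])
  have hev : ∀ᶠ s in nhds (0 : ℝ), f s ∈ interior (Subtype.val ⁻¹' (D.facet i : Set (LieDual n))) :=
    hf.continuousAt.eventually (isOpen_interior.mem_nhds (by rw [hf0]; exact hx'))
  have hev' : ∀ᶠ s in nhdsWithin (0 : ℝ) (Set.Iio 0),
      f s ∈ interior (Subtype.val ⁻¹' (D.facet i : Set (LieDual n))) := hev.filter_mono nhdsWithin_le_nhds
  obtain ⟨s, hs, hs0⟩ := (hev'.and self_mem_nhdsWithin).exists
  have hsF : AffineMap.lineMap x y s ∈ (D.facet i : Set (LieDual n)) := interior_subset (s := Subtype.val ⁻¹' (D.facet i : Set (LieDual n))) hs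
  rw [D.facet_eq_slack] at hsF
  have h1 := (D.mem_carrier_iff _).1 hsF.1 j
  rw [AffineMap.lineMap_apply, vsub_eq_sub, vadd_eq_add, add_comm, slack_add_smul, ← h0, pair_sub_left] at h1
  have h2 : pair y (intVec (D.weight j)) - pair x (intVec (D.weight j)) = D.slack j y := by
    have h3 : D.slack j y = D.slack j y - D.slack j x := by rw [← h0, sub_zero]
    rw [h3]; simp only [slack]; ring
  rw [h2] at h1
  have := mul_neg_of_neg_of_pos (Set.mem_Iio.1 hs0) hyj
  linarith

/-! ### The torus homomorphism -/

/-- The map `torusMap` as a homomorphism. -/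
def torusHom : Torus D.N →* Torus n where
  toFun := D.torusMap
  map_one' := by ext j; simp [torusMap]
  map_mul' s t := by ext j; simp [torusMap, mul_zpow, Finset.prod_mul_distrib]

theorem torusMap_mul (s t : Torus D.N) : D.torusMap (s * t) = D.torusMap s * D.torusMap t :=
  map_mul D.torusHom s t

@[simp] theorem torusMap_one : D.torusMap 1 = 1 := map_one D.torusHom

@[simp] theorem torusMap_inv (t : Torus D.N) : D.torusMap t⁻¹ = (D.torusMap t)⁻¹ :=
  map_inv D.torusHom t

theorem continuous_torusMap : Continuous D.torusMap := by
  unfold torusMap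
  refine continuous_pi fun j => continuous_finsetProd _ fun i _ => ?_
  exact (continuous_apply i).zpow _

theorem torusExp_add {m : ℕ} (ξ η : LieAlg m) : torusExp (ξ + η) = torusExp ξ * torusExp η := by
  ext j; simp [torusExp]

@[simp] theorem torusExp_zero {m : ℕ} : torusExp (0 : LieAlg m) = 1 := by
  ext j; simp [torusExp]

theorem torusExp_surjective {m : ℕ} : Function.Surjective (torusExp (n := m)) := fun t =>
  ⟨fun j => (t j : ℂ).arg, funext fun j => Circle.exp_arg (t j)⟩

theorem circle_exp_sum {ι : Type*} (s : Finset ι) (f : ι → ℝ) :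
    Circle.exp (∑ i ∈ s, f i) = ∏ i ∈ s, Circle.exp (f i) := by
  classical
  induction s using Finset.induction_on with
  | empty => simp
  | insert a s ha ih => rw [Finset.sum_insert ha, Finset.prod_insert ha, Circle.exp_add, ih]

theorem torusMap_torusExp (κ : Fin D.N → ℝ) : D.torusMap (torusExp κ) = torusExp (D.varpi κ) := by
  funext j
  simp only [torusMap, torusExp, varpi, circle_exp_sum]
  refine Finset.prod_congr rfl fun i _ => ?_
  rw [mul_comm, Circle.exp_intCast_mul]

theorem varpi_eq_sum (κ : Fin D.N → ℝ) : D.varpi κ = ∑ i, κ i • intVec (D.weight i) := by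
  ext j; simp [varpi, intVec]

theorem pair_varpi (x : LieDual n) (κ : Fin D.N → ℝ) :
    pair x (D.varpi κ) + ∑ i, D.offset i * κ i = ∑ i, D.slack i x * κ i := by
  rw [varpi_eq_sum, pair_sum_right, ← Finset.sum_add_distrib]
  refine Finset.sum_congr rfl fun i _ => ?_
  rw [pair_smul_right, slack]; ring

variable {D} in
/-- The lift of `ξ ∈ 𝔱` to `ℝᴺ` supported on the facets through the vertex. -/
def Vertex.lift (V : D.Vertex) (ξ : LieAlg n) : Fin D.N → ℝ :=
  ∑ k, V.coeff ξ k • Pi.single (V.idx k) 1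

variable {D} in
@[simp] theorem Vertex.lift_idx (V : D.Vertex) (ξ : LieAlg n) (k : Fin n) :
    V.lift ξ (V.idx k) = V.coeff ξ k := by
  simp [Vertex.lift, Pi.single_apply, V.idx_injective.eq_iff]

variable {D} in
theorem Vertex.lift_of_notMem (V : D.Vertex) (ξ : LieAlg n) {i : Fin D.N} (hi : i ∉ Set.range V.idx) :
    V.lift ξ i = 0 := by
  simp only [Vertex.lift, Finset.sum_apply, Pi.smul_apply, smul_eq_mul]
  refine Finset.sum_eq_zero fun k _ => ?_
  rw [Pi.single_eq_of_ne (fun h => hi ⟨k, h.symm⟩), mul_zero]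

variable {D} in
theorem Vertex.sum_lift (V : D.Vertex) (ξ : LieAlg n) (f : Fin D.N → ℝ) :
    ∑ i, f i * V.lift ξ i = ∑ k, f (V.idx k) * V.coeff ξ k := by
  simp only [Vertex.lift, Finset.sum_apply, Pi.smul_apply, smul_eq_mul, Finset.mul_sum]
  rw [Finset.sum_comm]
  refine Finset.sum_congr rfl fun k _ => ?_
  rw [Finset.sum_eq_single (V.idx k)] <;> simp +contextual

variable {D} in
@[simp] theorem Vertex.varpi_lift (V : D.Vertex) (ξ : LieAlg n) : D.varpi (V.lift ξ) = ξ := by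
  conv_rhs => rw [V.expand_dual ξ]
  ext j
  simp only [varpi, Finset.sum_apply, Pi.smul_apply, smul_eq_mul, intVec]
  have := V.sum_lift ξ (fun i => (D.weight i j : ℝ))
  simp only [mul_comm] at this ⊢
  exact this

theorem varpi_surjective : Function.Surjective D.varpi := fun ξ =>
  ⟨_, D.nonempty_vertex.some.varpi_lift ξ⟩

/-- Both exponential maps are onto and intertwine `torusMap` with the surjection `ϖ`. -/
theorem torusMap_surjective : Function.Surjective D.torusMap := fun t => by
  obtain ⟨ξ, rfl⟩ := torusExp_surjective t
  obtain ⟨κ, rfl⟩ := D.varpi_surjective ξ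
  exact ⟨_, D.torusMap_torusExp κ⟩

/-! ### The level set -/

/-- The level condition says that `(|zᵢ|² / 2 - aᵢ)` annihilates `ker ϖ`, hence lies in the image of
the transpose of `ϖ`, which is `x ↦ (⟨x, mᵢ nᵢ⟩)`. -/
theorem mem_levelSet_iff (z : Fin D.N → ℂ) :
    z ∈ D.levelSet ↔ ∃ x, ∀ i, ‖z i‖ ^ 2 / 2 = D.slack i x := by
  constructor
  · intro hz
    obtain ⟨V⟩ := D.nonempty_vertex
    refine ⟨V.coord fun k => ‖z (V.idx k)‖ ^ 2 / 2, fun i => ?_⟩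
    set x := V.coord fun k => ‖z (V.idx k)‖ ^ 2 / 2 with hx
    -- The relation that expresses the `i`-th normal through the normals at the vertex. Testing the
    -- level condition on it transfers the identity from the facets at the vertex to facet `i`.
    set κ : Fin D.N → ℝ := Pi.single i 1 - V.lift (intVec (D.weight i)) with hκ
    have hsplit : ∀ f : Fin D.N → ℝ,
        ∑ j, f j * κ j = f i - ∑ k, f (V.idx k) * V.coeff (intVec (D.weight i)) k := by
      intro f
      rw [← V.sum_lift]
      simp [hκ, mul_sub, Finset.sum_sub_distrib, Pi.single_apply]
    have hvar : D.varpi κ = 0 := by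
      ext j
      have h1 := hsplit fun i => (D.weight i j : ℝ)
      have h2 := congrFun (V.expand_dual (intVec (D.weight i))) j
      simp only [Finset.sum_apply, Pi.smul_apply, smul_eq_mul, intVec] at h2
      simp only [varpi, Pi.zero_apply]
      simp only [mul_comm] at h1 h2 ⊢
      rw [h1, sub_eq_zero]
      exact h2
    have h1 := hz κ hvar
    have h2 := D.pair_varpi x κ
    rw [hvar, pair_zero_right, zero_add] at h2
    rw [h2, hsplit, hsplit fun i => D.slack i x] at h1
    simpa [hx] using h1
  · rintro ⟨x, hx⟩ κ hκ
    have h2 := D.pair_varpi x κ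
    rw [hκ, pair_zero_right, zero_add] at h2
    simp only [hx, h2]

@[simp] theorem norm_rotate (t : Torus D.N) (z : Fin D.N → ℂ) (i : Fin D.N) :
    ‖D.rotate t z i‖ = ‖z i‖ := by simp [rotate, Circle.norm_coe]

theorem rotate_mem_levelSet_iff (t : Torus D.N) (z : Fin D.N → ℂ) :
    D.rotate t z ∈ D.levelSet ↔ z ∈ D.levelSet := by simp [mem_levelSet_iff]

@[simp] theorem rotate_one (z : Fin D.N → ℂ) : D.rotate 1 z = z := by ext i; simp [rotate]

theorem rotate_mul (s t : Torus D.N) (z : Fin D.N → ℂ) :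
    D.rotate (s * t) z = D.rotate s (D.rotate t z) := by ext i; simp [rotate, mul_assoc]

/-- The action of the torus on the level set. -/
def rot (t : Torus D.N) (z : D.levelSet) : D.levelSet :=
  ⟨D.rotate t z, (D.rotate_mem_levelSet_iff t z).2 z.2⟩

@[simp] theorem rot_one (z : D.levelSet) : D.rot 1 z = z := Subtype.ext (D.rotate_one z)

theorem rot_mul (s t : Torus D.N) (z : D.levelSet) : D.rot (s * t) z = D.rot s (D.rot t z) :=
  Subtype.ext (D.rotate_mul s t z)

theorem continuous_rot : Continuous fun p : Torus D.N × D.levelSet => D.rot p.1 p.2 := by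
  refine Continuous.subtype_mk (continuous_pi fun i => ?_) _
  exact (continuous_subtype_val.comp ((continuous_apply i).comp continuous_fst)).mul
    ((continuous_apply i).comp (continuous_subtype_val.comp continuous_snd))

/-- The moment map of the torus on the level set. -/
def levelMoment (z : D.levelSet) : LieDual n := ((D.mem_levelSet_iff z).1 z.2).choose

theorem norm_sq_eq (z : D.levelSet) (i : Fin D.N) :
    ‖(z : Fin D.N → ℂ) i‖ ^ 2 / 2 = D.slack i (D.levelMoment z) :=
  ((D.mem_levelSet_iff z).1 z.2).choose_spec i

theorem levelMoment_eq {z : D.levelSet} {x : LieDual n}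
    (h : ∀ i, ‖(z : Fin D.N → ℂ) i‖ ^ 2 / 2 = D.slack i x) : D.levelMoment z = x :=
  D.ext_slack fun i => by rw [← norm_sq_eq, h]

@[simp] theorem levelMoment_rot (t : Torus D.N) (z : D.levelSet) :
    D.levelMoment (D.rot t z) = D.levelMoment z :=
  D.levelMoment_eq fun i => by rw [← norm_sq_eq]; simp [rot]

variable {D} in
theorem Vertex.levelMoment_eq_coord (V : D.Vertex) (z : D.levelSet) :
    D.levelMoment z = V.coord fun k => ‖(z : Fin D.N → ℂ) (V.idx k)‖ ^ 2 / 2 :=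
  V.eq_coord fun _ => (D.norm_sq_eq z _).symm

theorem continuous_levelMoment : Continuous D.levelMoment := by
  obtain ⟨V⟩ := D.nonempty_vertex
  rw [funext V.levelMoment_eq_coord]
  refine V.continuous_coord.comp (continuous_pi fun k => ?_)
  exact ((((continuous_apply _).comp continuous_subtype_val).norm).pow 2).div_const 2

theorem levelMoment_mem (z : D.levelSet) : D.levelMoment z ∈ P.carrier :=
  (D.mem_carrier_iff _).2 fun i => by rw [← norm_sq_eq]; positivity

theorem isClosed_levelSet : IsClosed D.levelSet := by
  have : D.levelSet = ⋂ (κ : Fin D.N → ℝ) (_ : D.varpi κ = 0),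
      {z | ∑ i, ‖z i‖ ^ 2 / 2 * κ i = ∑ i, D.offset i * κ i} := by
    ext z; simp [levelSet]
  rw [this]
  refine isClosed_iInter fun κ => isClosed_iInter fun _ => isClosed_eq ?_ continuous_const
  fun_prop

/-- The point of the level set with nonnegative real coordinates above a point of the
polyhedron. -/
def realPoint (x : P.carrier) : D.levelSet :=
  ⟨fun i => (Real.sqrt (2 * D.slack i x) : ℂ), (D.mem_levelSet_iff _).2 ⟨x, fun i => by
    have := (D.mem_carrier_iff x).1 x.2 i
    simp only [Complex.norm_real, Real.norm_eq_abs, sq_abs]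
    rw [Real.sq_sqrt (by positivity)]; ring⟩⟩

theorem levelMoment_realPoint (x : P.carrier) : D.levelMoment (D.realPoint x) = x :=
  D.levelMoment_eq fun i => by
    have := (D.mem_carrier_iff x).1 x.2 i
    simp only [realPoint, Complex.norm_real, Real.norm_eq_abs, sq_abs]
    rw [Real.sq_sqrt (by positivity)]; ring

theorem continuous_realPoint : Continuous D.realPoint := by
  refine Continuous.subtype_mk (continuous_pi fun i => ?_) _
  exact Complex.continuous_ofReal.comp (Real.continuous_sqrt.comp
    (continuous_const.mul ((D.continuous_slack i).comp continuous_subtype_val)))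

theorem exists_circle_mul_eq {a b : ℂ} (h : ‖a‖ = ‖b‖) : ∃ t : Circle, b = t * a := by
  by_cases ha : a = 0
  · refine ⟨1, ?_⟩
    subst ha
    rw [norm_zero] at h
    simp [norm_eq_zero.1 h.symm]
  · refine ⟨⟨b / a, mem_sphere_zero_iff_norm.2 ?_⟩, ?_⟩
    · rw [norm_div, ← h, div_self (norm_ne_zero_iff.2 ha)]
    · exact (div_mul_cancel₀ b ha).symm

theorem norm_eq_of_sq_div {a b : ℝ} (ha : 0 ≤ a) (hb : 0 ≤ b) (h : a ^ 2 / 2 = b ^ 2 / 2) : a = b := by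
  have : a ^ 2 = b ^ 2 := by linarith
  exact (pow_left_inj₀ ha hb two_ne_zero).1 this

/-- The moment fixes the absolute values of all coordinates, so only the phases can differ. -/
theorem exists_rot_eq {z w : D.levelSet} (h : D.levelMoment z = D.levelMoment w) :
    ∃ t, w = D.rot t z := by
  have : ∀ i, ∃ t : Circle, (w : Fin D.N → ℂ) i = t * (z : Fin D.N → ℂ) i := fun i =>
    exists_circle_mul_eq (norm_eq_of_sq_div (norm_nonneg _) (norm_nonneg _)
      (by rw [norm_sq_eq, norm_sq_eq, h]))
  choose t ht using this
  exact ⟨t, Subtype.ext (funext ht)⟩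

/-! ### The reduced space -/

/-- Two points of the level set in the same orbit of `K`. -/
def orbitSetoid : Setoid D.levelSet where
  r z w := ∃ t, D.torusMap t = 1 ∧ w = D.rot t z
  iseqv :=
    { refl := fun z => ⟨1, by simp, by simp⟩
      symm := by
        rintro z w ⟨t, ht, rfl⟩
        exact ⟨t⁻¹, by simp [ht], by rw [← rot_mul]; simp⟩
      trans := by
        rintro z w y ⟨t, ht, rfl⟩ ⟨s, hs, rfl⟩
        exact ⟨s * t, by rw [torusMap_mul, ht, hs, one_mul], by rw [rot_mul]⟩ }

/-- The reduced space `Φ_K⁻¹(i^* a) / K`. -/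
def Reduced : Type := Quotient D.orbitSetoid

instance : TopologicalSpace D.Reduced := inferInstanceAs (TopologicalSpace (Quotient D.orbitSetoid))

/-- The quotient map. -/
def quot (z : D.levelSet) : D.Reduced := Quotient.mk D.orbitSetoid z

theorem quot_eq_iff {z w : D.levelSet} : D.quot z = D.quot w ↔ ∃ t, D.torusMap t = 1 ∧ w = D.rot t z :=
  Quotient.eq (r := D.orbitSetoid)

theorem quot_surjective : Function.Surjective D.quot := Quotient.mk_surjective

theorem isOpenQuotientMap_quot : IsOpenQuotientMap D.quot := by
  refine .of_isOpenMap_isQuotientMap (fun U hU => ?_) isQuotientMap_quotient_mk'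
  apply isQuotientMap_quotient_mk'.isOpen_preimage.1
  have : D.quot ⁻¹' (D.quot '' U) = ⋃ (t : Torus D.N) (_ : D.torusMap t = 1), D.rot t ⁻¹' U := by
    ext z
    simp only [Set.mem_preimage, Set.mem_image, Set.mem_iUnion, exists_prop]
    constructor
    · rintro ⟨w, hw, h⟩
      obtain ⟨t, ht, rfl⟩ := D.quot_eq_iff.1 h.symm
      exact ⟨t, ht, hw⟩
    · rintro ⟨t, ht, h⟩
      exact ⟨_, h, (D.quot_eq_iff.2 ⟨t, ht, rfl⟩).symm⟩
  change IsOpen (D.quot ⁻¹' (D.quot '' U))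
  rw [this]
  exact isOpen_iUnion fun t => isOpen_iUnion fun _ =>
    hU.preimage (D.continuous_rot.comp (Continuous.prodMk_right t))

theorem continuous_quot : Continuous D.quot := D.isOpenQuotientMap_quot.continuous

/-- The orbit relation of `K` is the projection of a closed set along the compact torus, hence
closed. -/
instance : T2Space D.Reduced := by
  rw [t2Space_iff_of_isOpenQuotientMap D.isOpenQuotientMap_quot]
  have : {p : D.levelSet × D.levelSet | D.quot p.1 = D.quot p.2} = Prod.snd ''
      {p : Torus D.N × D.levelSet × D.levelSet | D.torusMap p.1 = 1 ∧ p.2.2 = D.rot p.1 p.2.1} := by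
    ext ⟨z, w⟩
    simp [quot_eq_iff]
  rw [this]
  apply isClosedMap_snd_of_compactSpace
  refine (isClosed_eq (D.continuous_torusMap.comp continuous_fst) continuous_const).inter
    (isClosed_eq (continuous_snd.comp continuous_snd) ?_)
  exact D.continuous_rot.comp (continuous_fst.prodMk (continuous_fst.comp continuous_snd))

/-- The residual action of the torus on the reduced space. -/
instance : MulAction (Torus n) D.Reduced where
  smul t := Quotient.map' (s₁ := D.orbitSetoid) (s₂ := D.orbitSetoid)
    (D.rot (D.torusMap_surjective t).choose) (by
      rintro z w ⟨s, hs, rfl⟩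
      exact ⟨s, hs, by rw [← rot_mul, ← rot_mul, mul_comm]⟩)
  one_smul p := by
    obtain ⟨z, rfl⟩ := D.quot_surjective p
    exact (D.quot_eq_iff.2 ⟨_, (D.torusMap_surjective 1).choose_spec, rfl⟩).symm
  mul_smul s t p := by
    obtain ⟨z, rfl⟩ := D.quot_surjective p
    change D.quot (D.rot _ z) = D.quot (D.rot _ (D.rot _ z))
    refine D.quot_eq_iff.2 ⟨(D.torusMap_surjective s).choose * (D.torusMap_surjective t).choose *
      (D.torusMap_surjective (s * t)).choose⁻¹, ?_, ?_⟩
    · rw [torusMap_mul, torusMap_mul, torusMap_inv, (D.torusMap_surjective s).choose_spec,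
        (D.torusMap_surjective t).choose_spec, (D.torusMap_surjective (s * t)).choose_spec,
        mul_inv_cancel]
    · rw [← rot_mul, ← rot_mul, inv_mul_cancel_right]

theorem torusMap_smul_quot (t : Torus D.N) (z : D.levelSet) :
    D.torusMap t • D.quot z = D.quot (D.rot t z) := by
  change D.quot (D.rot _ z) = _
  refine D.quot_eq_iff.2 ⟨t * (D.torusMap_surjective (D.torusMap t)).choose⁻¹, ?_, ?_⟩
  · rw [torusMap_mul, torusMap_inv, (D.torusMap_surjective (D.torusMap t)).choose_spec, mul_inv_cancel]
  · rw [← rot_mul, inv_mul_cancel_right]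

instance : ContinuousSMul (Torus n) D.Reduced where
  continuous_smul := by
    -- The open mapping theorem for topological groups. It allows continuity to be tested on `𝕋ᴺ`
    -- times the level set.
    have h1 : IsOpenQuotientMap D.torusHom :=
      ⟨D.torusMap_surjective, D.continuous_torusMap,
        D.torusHom.isOpenMap_of_sigmaCompact D.torusMap_surjective D.continuous_torusMap⟩
    rw [← (h1.prodMap D.isOpenQuotientMap_quot).continuous_comp_iff]
    have : (fun p : Torus n × D.Reduced => p.1 • p.2) ∘ Prod.map D.torusHom D.quot =
        fun p => D.quot (D.rot p.1 p.2) := by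
      ext p; exact D.torusMap_smul_quot p.1 p.2
    rw [this]
    exact D.continuous_quot.comp D.continuous_rot

/-- The moment map of the reduced space. -/
def moment : D.Reduced → LieDual n :=
  Quotient.lift (s := D.orbitSetoid) D.levelMoment (by rintro z w ⟨t, -, rfl⟩; simp)

@[simp] theorem moment_quot (z : D.levelSet) : D.moment (D.quot z) = D.levelMoment z := rfl

theorem continuous_moment : Continuous D.moment :=
  D.isOpenQuotientMap_quot.continuous_comp_iff.1 D.continuous_levelMoment

theorem moment_smul (t : Torus n) (p : D.Reduced) : D.moment (t • p) = D.moment p := by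
  obtain ⟨t, rfl⟩ := D.torusMap_surjective t
  obtain ⟨z, rfl⟩ := D.quot_surjective p
  rw [torusMap_smul_quot]; simp

theorem range_moment : Set.range D.moment = P.carrier := by
  apply Set.Subset.antisymm
  · rintro _ ⟨p, rfl⟩
    obtain ⟨z, rfl⟩ := D.quot_surjective p
    exact D.levelMoment_mem z
  · intro x hx
    exact ⟨D.quot (D.realPoint ⟨x, hx⟩), D.levelMoment_realPoint ⟨x, hx⟩⟩

theorem convex_halfSpaces {m : ℕ} (ν : Fin m → LieAlg n) (a : Fin m → ℝ) :
    Convex ℝ (halfSpaces ν a) := by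
  intro x hx y hy s t hs ht hst i
  have h1 := hx i
  have h2 := hy i
  rw [pair_add_left, pair_smul_left, pair_smul_left]
  have := add_nonneg (mul_nonneg hs h1) (mul_nonneg ht h2)
  have h3 : a i = s * a i + t * a i := by rw [← add_mul, hst, one_mul]
  linarith

/-- The space is swept out by the connected torus from the real points over the convex set `P`. -/
instance : ConnectedSpace D.Reduced := by
  have h1 : ConnectedSpace P.carrier :=
    isConnected_iff_connectedSpace.1 ⟨P.nonempty, (D.carrier_eq ▸ convex_halfSpaces _ _ : Convex ℝ P.carrier).isPreconnected⟩
  have h2 : Function.Surjective fun p : Torus D.N × P.carrier => D.quot (D.rot p.1 (D.realPoint p.2)) := by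
    intro p
    obtain ⟨z, rfl⟩ := D.quot_surjective p
    obtain ⟨t, ht⟩ := D.exists_rot_eq (z := D.realPoint ⟨_, D.levelMoment_mem z⟩) (w := z)
      (D.levelMoment_realPoint _)
    exact ⟨(t, ⟨_, D.levelMoment_mem z⟩), congrArg D.quot ht.symm⟩
  refine h2.connectedSpace (D.continuous_quot.comp (D.continuous_rot.comp
    (continuous_fst.prodMk (D.continuous_realPoint.comp continuous_snd))))

/-- The sum of the normals: the corresponding component of the moment map is proper. -/
def properDirection : LieAlg n := ∑ i, intVec (D.weight i)

theorem pair_properDirection (z : D.levelSet) :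
    pair (D.levelMoment z) D.properDirection + ∑ i, D.offset i =
      ∑ i, ‖(z : Fin D.N → ℂ) i‖ ^ 2 / 2 := by
  rw [properDirection, pair_sum_right, ← Finset.sum_add_distrib]
  exact Finset.sum_congr rfl fun i _ => (D.norm_sq_eq z i).symm

theorem bddBelow_moment : BddBelow (Set.range fun p => pair (D.moment p) D.properDirection) := by
  refine ⟨-∑ i, D.offset i, ?_⟩
  rintro _ ⟨p, rfl⟩
  obtain ⟨z, rfl⟩ := D.quot_surjective p
  have h1 := D.pair_properDirection z
  have h2 : 0 ≤ ∑ i, ‖(z : Fin D.N → ℂ) i‖ ^ 2 / 2 := Finset.sum_nonneg fun i _ => by positivity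
  simp only [moment_quot]
  linarith

/-- Up to a constant this component is `∑ ‖zᵢ‖² / 2`, so its preimages of compact sets are closed
subsets of images of closed bounded pieces of the level set. -/
theorem isProperMap_moment : IsProperMap fun p => pair (D.moment p) D.properDirection := by
  have hc : Continuous fun p => pair (D.moment p) D.properDirection :=
    (continuous_pair_left _).comp D.continuous_moment
  refine isProperMap_iff_isCompact_preimage.2 ⟨hc, fun K hK => ?_⟩
  obtain ⟨C, hC⟩ := hK.bddAbove
  have hcpt : IsCompact {z : D.levelSet | ∑ i, ‖(z : Fin D.N → ℂ) i‖ ^ 2 / 2 ≤ C + ∑ i, D.offset i} := by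
    rw [Subtype.isCompact_iff]
    have hcl : IsClosed (D.levelSet ∩ {z | ∑ i, ‖z i‖ ^ 2 / 2 ≤ C + ∑ i, D.offset i}) :=
      D.isClosed_levelSet.inter (isClosed_le (by fun_prop) continuous_const)
    have heq : Subtype.val '' {z : D.levelSet | ∑ i, ‖(z : Fin D.N → ℂ) i‖ ^ 2 / 2 ≤
        C + ∑ i, D.offset i} = D.levelSet ∩ {z | ∑ i, ‖z i‖ ^ 2 / 2 ≤ C + ∑ i, D.offset i} := by
      ext z; simp [and_comm]
    rw [heq]
    refine Metric.isCompact_of_isClosed_isBounded hcl ?_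
    refine (Metric.isBounded_closedBall (x := 0) (r := 1 + 2 * (C + ∑ i, D.offset i))).subset ?_
    rintro z ⟨-, hz⟩
    have hz' : ∑ i, ‖z i‖ ^ 2 / 2 ≤ C + ∑ i, D.offset i := hz
    have hnn : 0 ≤ ∑ i, ‖z i‖ ^ 2 / 2 := Finset.sum_nonneg fun i _ => by positivity
    rw [mem_closedBall_zero_iff, pi_norm_le_iff_of_nonneg (by linarith)]
    intro i
    have h1 : ‖z i‖ ^ 2 / 2 ≤ ∑ i, ‖z i‖ ^ 2 / 2 :=
      Finset.single_le_sum (f := fun i => ‖z i‖ ^ 2 / 2) (fun i _ => by positivity) (Finset.mem_univ i)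
    -- From `(‖z i‖ - 1)² ≥ 0` one gets `‖z i‖ ≤ 1 / 2 + ‖z i‖² / 2`.
    nlinarith [sq_nonneg (‖z i‖ - 1)]
  refine (hcpt.image D.continuous_quot).of_isClosed_subset (hK.isClosed.preimage hc) fun p hp => ?_
  obtain ⟨z, rfl⟩ := D.quot_surjective p
  refine ⟨z, ?_, rfl⟩
  have h1 := D.pair_properDirection z
  have h2 := hC hp
  simp only [moment_quot] at h2
  change ∑ i, ‖(z : Fin D.N → ℂ) i‖ ^ 2 / 2 ≤ C + ∑ i, D.offset i
  linarith

instance : ParacompactSpace D.Reduced := by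
  have h := D.isProperMap_moment
  have : WeaklyLocallyCompactSpace D.Reduced := ⟨fun p => ⟨_, h.isCompact_preimage
    (isCompact_Icc (a := pair (D.moment p) D.properDirection - 1)
      (b := pair (D.moment p) D.properDirection + 1)), h.continuous.continuousAt.preimage_mem_nhds
        (Icc_mem_nhds (by linarith) (by linarith))⟩⟩
  have : SigmaCompactSpace D.Reduced := by
    refine ⟨⟨fun k : ℕ => (fun p => pair (D.moment p) D.properDirection) ⁻¹' Set.Icc (-k : ℝ) k,
      fun k => h.isCompact_preimage isCompact_Icc, ?_⟩⟩
    rw [← Set.preimage_iUnion, Set.eq_univ_iff_forall]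
    intro p
    obtain ⟨k, hk⟩ := exists_nat_ge |pair (D.moment p) D.properDirection|
    exact Set.mem_iUnion.2 ⟨k, abs_le.1 hk⟩
  infer_instance

end FacetPresentation

/-! ### Calculus -/

section Calculus

variable {E F : Type*} [NormedAddCommGroup E] [NormedSpace ℝ E] [NormedAddCommGroup F]
  [NormedSpace ℝ F]

/-- The pullback is quadratic in `L`. It is exhibited as the alternatization of the bilinear map
`(v, w) ↦ Ω (L v, L w)`, which is built from compositions. Alternatizing counts each value twice,
whence the factor `1 / 2`. -/
theorem contDiff_compContinuousLinearMap (Ω : F [⋀^Fin 2]→L[ℝ] ℝ) :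
    ContDiff ℝ ∞ fun L : E →L[ℝ] F => Ω.compContinuousLinearMap L := by
  let ι := (ContinuousAlternatingMap.ofSubsingletonLIE (0 : Fin 1) : (F →L[ℝ] ℝ) ≃ₗᵢ[ℝ] (F [⋀^Fin 1]→L[ℝ] ℝ))
  let ι' := (ContinuousAlternatingMap.ofSubsingletonLIE (0 : Fin 1) : (E →L[ℝ] ℝ) ≃ₗᵢ[ℝ] (E [⋀^Fin 1]→L[ℝ] ℝ))
  let B : F →L[ℝ] F →L[ℝ] ℝ := (ι.symm : (F [⋀^Fin 1]→L[ℝ] ℝ) →L[ℝ] F →L[ℝ] ℝ) ∘L Ω.curryLeft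
  have hB : ∀ v w, B v w = Ω ![v, w] := by
    intro v w
    change (ι.symm (Ω.curryLeft v)) w = _
    have h1 : Ω.curryLeft v = ι (ι.symm (Ω.curryLeft v)) := (ι.apply_symm_apply _).symm
    have h2 : Ω.curryLeft v ![w] = Ω ![v, w] := by
      simp [ContinuousAlternatingMap.curryLeft_apply_apply]
    rw [← h2]
    conv_rhs => rw [h1]
    rfl
  have hf : (fun L : E →L[ℝ] F => Ω.compContinuousLinearMap L) = fun L =>
      (1 / 2 : ℝ) • ContinuousAlternatingMap.alternatizeUncurryFinCLM ℝ E ℝ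
        ((ι' : (E →L[ℝ] ℝ) →L[ℝ] E [⋀^Fin 1]→L[ℝ] ℝ) ∘L
          (((ContinuousLinearMap.compL ℝ E F ℝ).flip L) ∘L (B ∘L L))) := by
    ext L v
    have h01 : Ω ![L (v 1), L (v 0)] = -Ω ![L (v 0), L (v 1)] := by
      have := Ω.toAlternatingMap.map_swap ![L (v 0), L (v 1)] (i := 0) (j := 1) (by decide)
      have he : ![L (v 0), L (v 1)] ∘ Equiv.swap (0 : Fin 2) 1 = ![L (v 1), L (v 0)] := by
        funext i; fin_cases i <;> simp
      rw [he] at this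
      exact this
    have key : ∀ i j : Fin 2, (ι' ((B (L (v i))).comp L)) (fun _ : Fin 1 => v j) =
        Ω ![L (v i), L (v j)] := by
      intro i j
      rw [← hB]; rfl
    have hv : Ω (fun i => L (v i)) = Ω ![L (v 0), L (v 1)] := by
      congr 1; ext i; fin_cases i <;> rfl
    have e0 : (Fin.removeNth (0 : Fin 2) v) = fun _ : Fin 1 => v 1 := by
      ext i; fin_cases i; rfl
    have e1 : (Fin.removeNth (1 : Fin 2) v) = fun _ : Fin 1 => v 0 := by
      ext i; fin_cases i; rfl
    have hsum := Fin.sum_univ_two fun i : Fin 2 => (-1 : ℤ) ^ (i : ℕ) •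
      (ι' ((B (L (v i))).comp L)) (Fin.removeNth i v)
    rw [e0, e1] at hsum
    simp only [ContinuousAlternatingMap.alternatizeUncurryFinCLM_apply,
      ContinuousAlternatingMap.smul_apply, ContinuousAlternatingMap.alternatizeUncurryFin_apply]
    refine Eq.trans ?_ (congrArg (fun x : ℝ => (1 / 2 : ℝ) • x) hsum.symm)
    change Ω (fun i => L (v i)) = _
    rw [key, key, h01, hv]
    simp
    ring
  rw [hf]
  refine contDiff_const.fun_smul (ContDiff.comp
    (g := ContinuousAlternatingMap.alternatizeUncurryFinCLM ℝ E ℝ) (ContinuousLinearMap.contDiff _) ?_)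
  refine contDiff_const.clm_comp ?_
  refine ((ContinuousLinearMap.contDiff _).clm_comp (contDiff_const.clm_comp contDiff_id))

theorem extDeriv_pullback_const (Ω : F [⋀^Fin 2]→L[ℝ] ℝ) {f : E → F} {u : E}
    (hf : ContDiffAt ℝ ∞ f u) :
    extDeriv (fun x => Ω.compContinuousLinearMap (fderiv ℝ f x)) u = 0 := by
  refine (extDeriv_pullback (differentiableAt_const Ω : DifferentiableAt ℝ (fun _ : F => Ω) (f u)) hf
    (by rw [minSmoothness_of_isRCLikeNormedField]; exact WithTop.coe_le_coe.2 le_top)).trans ?_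
  have : extDeriv (fun _ : F => Ω) (f u) = 0 := by
    ext v
    rw [extDeriv_apply (differentiableAt_const Ω)]
    simp
  rw [this]
  ext v
  simp

variable [FiniteDimensional ℝ E]

theorem exists_hasStrictFDerivAt_equiv {φ : E → E} {u : E} (hφ : ContDiffAt ℝ ∞ φ u)
    (hinj : Function.Injective (fderiv ℝ φ u)) :
    ∃ e : E ≃L[ℝ] E, HasStrictFDerivAt φ (e : E →L[ℝ] E) u ∧ HasFDerivAt φ (e : E →L[ℝ] E) u := by
  let e : E ≃L[ℝ] E :=
    (LinearEquiv.ofInjectiveEndo (fderiv ℝ φ u).toLinearMap hinj).toContinuousLinearEquiv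
  have he : (e : E →L[ℝ] E) = fderiv ℝ φ u := by ext v; rfl
  have h1 := (hφ.differentiableAt (by simp)).hasFDerivAt
  refine ⟨e, ?_, ?_⟩ <;> rw [he]
  · exact hφ.hasStrictFDerivAt (by simp)
  · exact h1

/-- Source and target have the same finite dimension, so injective derivatives are invertible and
the inverse function theorem applies. -/
theorem isOpen_image_of_immersion {φ : E → E} {S : Set E} (hS : IsOpen S)
    (hφ : ContDiffOn ℝ ∞ φ S) (himm : ∀ u ∈ S, Function.Injective (fderiv ℝ φ u)) :
    IsOpen (φ '' S) := by
  rw [isOpen_iff_mem_nhds]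
  rintro _ ⟨u, hu, rfl⟩
  obtain ⟨e, he, -⟩ := exists_hasStrictFDerivAt_equiv (hφ.contDiffAt (hS.mem_nhds hu)) (himm u hu)
  rw [← he.map_nhds_eq_of_equiv]
  exact Filter.image_mem_map (hS.mem_nhds hu)

theorem exists_smooth_inverse {φ : E → E} {S : Set E} (hS : IsOpen S) (hφ : ContDiffOn ℝ ∞ φ S)
    (hinj : Set.InjOn φ S) (himm : ∀ u ∈ S, Function.Injective (fderiv ℝ φ u)) :
    ∃ ρ : E → E, ContDiffOn ℝ ∞ ρ (φ '' S) ∧ ∀ u ∈ S, ρ (φ u) = u := by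
  classical
  have hρ := hinj.leftInvOn_invFunOn
  refine ⟨Function.invFunOn φ S, ?_, hρ⟩
  rintro _ ⟨u, hu, rfl⟩
  have hφu := hφ.contDiffAt (hS.mem_nhds hu)
  obtain ⟨e, he, he'⟩ := exists_hasStrictFDerivAt_equiv hφu (himm u hu)
  refine ContDiffAt.contDiffWithinAt ?_
  refine (hφu.to_localInverse he' (by simp)).congr_of_eventuallyEq ?_
  have h1 : ∀ᶠ y in nhds (φ u), φ (he.localInverse φ e u y) = y := he.eventually_right_inverse
  have h2 : ∀ᶠ y in nhds (φ u), he.localInverse φ e u y ∈ S := by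
    refine he.localInverse_continuousAt.eventually ?_
    rw [he.localInverse_apply_image]
    exact hS.mem_nhds hu
  filter_upwards [h1, h2] with y hy1 hy2
  change Function.invFunOn φ S y = he.localInverse φ e u y
  conv_lhs => rw [← hy1]
  exact hρ hy2

end Calculus

namespace FacetPresentation

variable {n : ℕ} {P : LabeledPolyhedron n} (D : FacetPresentation P)

/-! ### The standard form and smooth lifts to the level set -/

theorem stdForm_add_left (v v' w : Fin D.N → ℂ) :
    D.stdForm (v + v') w = D.stdForm v w + D.stdForm v' w := by
  rw [stdForm, stdForm, stdForm, ← Finset.sum_add_distrib]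
  exact Finset.sum_congr rfl fun i _ => by simp; ring

theorem stdForm_smul_left (c : ℝ) (v w : Fin D.N → ℂ) :
    D.stdForm (c • v) w = c * D.stdForm v w := by
  rw [stdForm, stdForm, Finset.mul_sum]
  exact Finset.sum_congr rfl fun i _ => by simp; ring

theorem stdForm_swap (v w : Fin D.N → ℂ) : D.stdForm v w = -D.stdForm w v := by
  rw [stdForm, stdForm, ← Finset.sum_neg_distrib]
  exact Finset.sum_congr rfl fun i _ => by ring

/-- The standard symplectic form as a continuous alternating map. -/
def stdTwoForm : (Fin D.N → ℂ) [⋀^Fin 2]→L[ℝ] ℝ where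
  toFun v := D.stdForm (v 0) (v 1)
  map_update_add' v i x y := by
    fin_cases i
    · simp [stdForm_add_left]
    · simp [D.stdForm_swap (v 0), stdForm_add_left, add_comm]
  map_update_smul' v i c x := by
    fin_cases i
    · simp [stdForm_smul_left]
    · simp [D.stdForm_swap (v 0), stdForm_smul_left]
  map_eq_zero_of_eq' v i j h hij := by
    have : v 0 = v 1 := by
      fin_cases i <;> fin_cases j <;> simp_all
    rw [this]; simp [stdForm, mul_comm]
  cont := by
    simp only [stdForm]
    fun_prop

theorem stdForm_rotate (t : Torus D.N) (v w : Fin D.N → ℂ) :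
    D.stdForm (D.rotate t v) (D.rotate t w) = D.stdForm v w := by
  refine Finset.sum_congr rfl fun i _ => ?_
  have h : (t i : ℂ).re * (t i : ℂ).re + (t i : ℂ).im * (t i : ℂ).im = 1 := by
    rw [← Complex.normSq_apply]; exact Circle.normSq_coe (t i)
  simp only [rotate, Complex.mul_re, Complex.mul_im]
  linear_combination ((v i).re * (w i).im - (v i).im * (w i).re) * h

variable {E : Type*} [NormedAddCommGroup E] [NormedSpace ℝ E]

/-- The pullback of the standard form. -/
def pull (s : E → Fin D.N → ℂ) (u : E) : E [⋀^Fin 2]→L[ℝ] ℝ :=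
  D.stdTwoForm.compContinuousLinearMap (fderiv ℝ s u)

theorem pull_apply (s : E → Fin D.N → ℂ) (u v w : E) :
    D.pull s u ![v, w] = D.stdForm (fderiv ℝ s u v) (fderiv ℝ s u w) := rfl

theorem pull_ext {s : E → Fin D.N → ℂ} {u : E} {σ : E [⋀^Fin 2]→L[ℝ] ℝ}
    (h : ∀ v w, D.stdForm (fderiv ℝ s u v) (fderiv ℝ s u w) = σ ![v, w]) : D.pull s u = σ := by
  ext v
  have hv : v = ![v 0, v 1] := by ext i; fin_cases i <;> rfl
  rw [hv, pull_apply, h]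

theorem contDiffOn_pull {s : E → Fin D.N → ℂ} {W : Set E} (hW : IsOpen W)
    (hs : ContDiffOn ℝ ∞ s W) : ContDiffOn ℝ ∞ (D.pull s) W :=
  (contDiff_compContinuousLinearMap D.stdTwoForm).comp_contDiffOn
    (hs.fderiv_of_isOpen hW (by simp))

/-- `s` is a smooth lift of `π` on the open set `W` to the level set. -/
structure IsLift (W : Set E) (s : E → Fin D.N → ℂ) (π : E → D.Reduced) : Prop where
  isOpen : IsOpen W
  smooth : ContDiffOn ℝ ∞ s W
  spec : ∀ u ∈ W, ∃ h : s u ∈ D.levelSet, D.quot ⟨s u, h⟩ = π u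

/-- A point of the reduced space over the interior of the polyhedron. -/
def IsPrincipal (p : D.Reduced) : Prop := ∀ i, 0 < D.slack i (D.moment p)

variable {D} {W : Set E} {s s' : E → Fin D.N → ℂ} {π : E → D.Reduced}

theorem IsLift.mono (hs : D.IsLift W s π) {W' : Set E} (hW' : IsOpen W') (h : W' ⊆ W) :
    D.IsLift W' s π := ⟨hW', hs.smooth.mono h, fun u hu => hs.spec u (h hu)⟩

theorem IsLift.mem (hs : D.IsLift W s π) {u : E} (hu : u ∈ W) : s u ∈ D.levelSet :=
  (hs.spec u hu).1

theorem IsLift.norm_sq (hs : D.IsLift W s π) {u : E} (hu : u ∈ W) (i : Fin D.N) :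
    ‖s u i‖ ^ 2 / 2 = D.slack i (D.moment (π u)) := by
  obtain ⟨h, hq⟩ := hs.spec u hu
  rw [← hq, moment_quot, ← norm_sq_eq]

theorem IsLift.ne_zero (hs : D.IsLift W s π) {u : E} (hu : u ∈ W) (hp : D.IsPrincipal (π u))
    (i : Fin D.N) : s u i ≠ 0 := by
  intro h
  have := hp i
  rw [← hs.norm_sq hu, h] at this
  simp at this

theorem IsLift.differentiableAt (hs : D.IsLift W s π) {u : E} (hu : u ∈ W) :
    DifferentiableAt ℝ s u :=
  (hs.smooth.contDiffAt (hs.isOpen.mem_nhds hu)).differentiableAt (by simp)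

theorem IsLift.exists_rotate (hs : D.IsLift W s π) (hs' : D.IsLift W s' π) {u : E} (hu : u ∈ W) :
    ∃ t, D.torusMap t = 1 ∧ s' u = D.rotate t (s u) := by
  obtain ⟨h, hq⟩ := hs.spec u hu
  obtain ⟨h', hq'⟩ := hs'.spec u hu
  obtain ⟨t, ht, he⟩ := D.quot_eq_iff.1 (hq.trans hq'.symm)
  exact ⟨t, ht, congrArg Subtype.val he⟩

/-- The derivative of a lift is orthogonal to the orbits of `K`. -/
theorem IsLift.sum_fderiv_eq_zero (hs : D.IsLift W s π) {u : E} (hu : u ∈ W) {κ : Fin D.N → ℝ}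
    (hκ : D.varpi κ = 0) (v : E) :
    ∑ i, κ i * ((s u i).re * (fderiv ℝ s u v i).re + (s u i).im * (fderiv ℝ s u v i).im) = 0 := by
  have hd := (hs.differentiableAt hu).hasFDerivAt
  have hre : ∀ i, HasFDerivAt (fun u => (s u i).re)
      (Complex.reCLM ∘L (ContinuousLinearMap.proj i ∘L fderiv ℝ s u)) u := fun i =>
    (Complex.reCLM.hasFDerivAt).comp u (hasFDerivAt_pi'.1 hd i)
  have him : ∀ i, HasFDerivAt (fun u => (s u i).im)
      (Complex.imCLM ∘L (ContinuousLinearMap.proj i ∘L fderiv ℝ s u)) u := fun i =>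
    (Complex.imCLM.hasFDerivAt).comp u (hasFDerivAt_pi'.1 hd i)
  have hsum : HasFDerivAt (fun u => ∑ i, κ i * ((s u i).re * (s u i).re + (s u i).im * (s u i).im)) _ u :=
    HasFDerivAt.fun_sum fun i _ => (((hre i).mul (hre i)).add ((him i).mul (him i))).const_mul (κ i)
  have hconst : (fun u => ∑ i, κ i * ((s u i).re * (s u i).re + (s u i).im * (s u i).im)) =ᶠ[nhds u]
      fun _ => 2 * ∑ i, D.offset i * κ i := by
    filter_upwards [hs.isOpen.mem_nhds hu] with u' hu'
    rw [← hs.mem hu' κ hκ, Finset.mul_sum]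
    refine Finset.sum_congr rfl fun i _ => ?_
    rw [← Complex.normSq_apply, Complex.normSq_eq_norm_sq]; ring
  have h0 := hsum.unique (hconst.symm.hasFDerivAt_iff.1 (hasFDerivAt_const _ u))
  have h1 := congrArg (fun L : E →L[ℝ] ℝ => L v) h0
  simp only [sum_apply, smul_apply,
    add_apply, ContinuousLinearMap.comp_apply, zero_apply,
    smul_eq_mul] at h1
  have h2 : (2 : ℝ) * ∑ i, κ i * ((s u i).re * (fderiv ℝ s u v i).re +
      (s u i).im * (fderiv ℝ s u v i).im) = 0 := by
    rw [← h1, Finset.mul_sum]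
    refine Finset.sum_congr rfl fun i _ => ?_
    simp
    ring
  exact (mul_eq_zero.1 h2).resolve_left two_ne_zero

/-- At a principal point no coordinate vanishes, so the element of `K` relating the two lifts is
determined and varies differentiably. Differentiating `s' = t · exp (i θ) · s` with `θ` in `ker ϖ`
adds only vectors tangent to `K`-orbits, and these pair to zero with the derivative of a lift. -/
theorem IsLift.pull_eq_of_isPrincipal (hs : D.IsLift W s π) (hs' : D.IsLift W s' π) {u : E}
    (hu : u ∈ W) (hp : D.IsPrincipal (π u)) : D.pull s u = D.pull s' u := by
  obtain ⟨t, ht, hst⟩ := hs.exists_rotate hs' hu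
  have hsu := hs.ne_zero hu hp
  set r : Fin D.N → E → ℂ := fun i u' => s' u' i / (t i * s u' i) with hr
  have hru : ∀ i, r i u = 1 := fun i => by
    simp only [hr, hst, rotate]
    exact div_self (mul_ne_zero (Circle.coe_ne_zero _) (hsu i))
  set θ : E → Fin D.N → ℝ := fun u' i => (Complex.log (r i u')).im with hθ
  have hθu : θ u = 0 := by ext i; simp [hθ, hru]
  have hsd := hs.differentiableAt hu
  have hsd' := hs'.differentiableAt hu
  have hrd : ∀ i, DifferentiableAt ℝ (r i) u := fun i => by
    simp only [hr, div_eq_mul_inv]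
    exact (differentiableAt_pi.1 hsd' i).fun_mul (((differentiableAt_const _).fun_mul
      (differentiableAt_pi.1 hsd i)).fun_inv (mul_ne_zero (Circle.coe_ne_zero _) (hsu i)))
  have hθd : DifferentiableAt ℝ θ u := by
    refine differentiableAt_pi.2 fun i => ?_
    refine DifferentiableAt.comp (g := Complex.imCLM) (f := fun u' => Complex.log (r i u')) u
      Complex.imCLM.differentiableAt ?_
    exact (((Complex.contDiffAt_log (n := 1) (by rw [hru]; exact Complex.one_mem_slitPlane)).restrict_scalars
      ℝ).differentiableAt one_ne_zero).comp u (hrd i)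
  have hθc : ContinuousAt θ u := hθd.continuousAt
  have hvarpi : Continuous D.varpi := by unfold varpi; fun_prop
  -- `ϖ (θ u')` has entries in `2πℤ`, and this bound forces them to be `0`. So `θ` takes values in
  -- `ker ϖ` near `u`, not merely in the logarithms of `K`.
  have hsmall : ∀ᶠ u' in nhds u, ∀ j, |D.varpi (θ u') j| < 2 * Real.pi := by
    refine Filter.eventually_all.2 fun j => ?_
    have hc : ContinuousAt (fun u' => |D.varpi (θ u') j|) u :=
      (continuous_abs.comp ((continuous_apply j).comp hvarpi)).continuousAt.comp hθc
    refine hc.eventually (gt_mem_nhds ?_)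
    simp only [hθu, varpi, Pi.zero_apply, zero_mul, Finset.sum_const_zero, abs_zero]
    positivity
  have hne : ∀ᶠ u' in nhds u, ∀ i, s u' i ≠ 0 :=
    Filter.eventually_all.2 fun i =>
      (differentiableAt_pi.1 hsd i).continuousAt.eventually_ne (hsu i)
  have hloc : ∀ᶠ u' in nhds u, D.varpi (θ u') = 0 ∧
      s' u' = D.rotate t (D.rotate (torusExp (θ u')) (s u')) := by
    filter_upwards [hsmall, hne, hs.isOpen.mem_nhds hu] with u' h1 h2 h3
    obtain ⟨t', ht', hst'⟩ := hs.exists_rotate hs' h3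
    have hr' : ∀ i, r i u' = ((t⁻¹ * t') i : Circle) := fun i => by
      simp only [hr, hst', rotate, Pi.mul_apply, Pi.inv_apply, Circle.coe_mul, Circle.coe_inv]
      have := h2 i
      have h4 := Circle.coe_ne_zero (t i)
      field_simp
    have hexp : torusExp (θ u') = t⁻¹ * t' := by
      funext i
      simp only [torusExp, hθ, Complex.log_im, hr']
      exact Circle.exp_arg _
    have hker : torusExp (D.varpi (θ u')) = 1 := by
      rw [← torusMap_torusExp, hexp, torusMap_mul, torusMap_inv, ht, ht']; simp
    refine ⟨?_, ?_⟩
    · ext j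
      obtain ⟨m, hm⟩ := Circle.exp_eq_one.1 (congrFun hker j)
      have h5 := h1 j
      rw [hm, abs_mul, abs_of_pos Real.two_pi_pos] at h5
      have h6 : |(m : ℝ)| < 1 := by
        by_contra! h7
        have := mul_le_mul_of_nonneg_right h7 Real.two_pi_pos.le
        linarith
      have h7 : m = 0 := by
        rw [← Int.cast_abs] at h6
        have : |m| < 1 := by exact_mod_cast h6
        exact Int.abs_lt_one_iff.1 this
      rw [hm, h7]; simp
    · rw [hst', hexp, ← rotate_mul, mul_inv_cancel_left]
  -- differentiate at `u`
  have hθ' := hθd.hasFDerivAt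
  have hker : ∀ v, D.varpi (fderiv ℝ θ u v) = 0 := by
    intro v
    let L : (Fin D.N → ℝ) →L[ℝ] LieAlg n := LinearMap.toContinuousLinearMap
      { toFun := D.varpi
        map_add' := fun x y => by
          ext j; simp [varpi, add_mul, Finset.sum_add_distrib]
        map_smul' := fun c x => by
          ext j; simp [varpi, Finset.mul_sum, mul_assoc] }
    have h1 : HasFDerivAt (fun u' => L (θ u')) (L ∘L fderiv ℝ θ u) u := L.hasFDerivAt.comp u hθ'
    have h2 : (fun u' => L (θ u')) =ᶠ[nhds u] fun _ => 0 := hloc.mono fun u' h => h.1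
    have h3 := h1.unique (h2.symm.hasFDerivAt_iff.1 (hasFDerivAt_const _ u))
    exact congrArg (fun L : E →L[ℝ] LieAlg n => L v) h3
  have hds : ∀ v, fderiv ℝ s' u v = D.rotate t fun i =>
      Complex.I * (fderiv ℝ θ u v i : ℂ) * s u i + fderiv ℝ s u v i := by
    intro v
    have hev : s' =ᶠ[nhds u] fun u' => D.rotate t (D.rotate (torusExp (θ u')) (s u')) :=
      hloc.mono fun u' h => h.2
    rw [hev.fderiv_eq]
    have hi : ∀ i, HasFDerivAt (fun u' => (t i : ℂ) * (Complex.exp ((θ u' i : ℂ) * Complex.I) * s u' i))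
        ((t i : ℂ) • (Complex.exp ((θ u i : ℂ) * Complex.I) • (ContinuousLinearMap.proj i ∘L fderiv ℝ s u) +
          s u i • (Complex.exp ((θ u i : ℂ) * Complex.I) • (Complex.I • (Complex.ofRealCLM ∘L
            (ContinuousLinearMap.proj i ∘L fderiv ℝ θ u)))))) u := by
      intro i
      have hθi : HasFDerivAt (fun u' => (θ u' i : ℂ)) (Complex.ofRealCLM ∘L
          (ContinuousLinearMap.proj i ∘L fderiv ℝ θ u)) u :=
        Complex.ofRealCLM.hasFDerivAt.comp u (hasFDerivAt_pi'.1 hθ' i)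
      have hsi : HasFDerivAt (fun u' => s u' i) (ContinuousLinearMap.proj i ∘L fderiv ℝ s u) u :=
        hasFDerivAt_pi'.1 hsd.hasFDerivAt i
      exact (((hθi.mul_const Complex.I).cexp).mul hsi).const_mul _
    have hall : HasFDerivAt (fun u' => D.rotate t (D.rotate (torusExp (θ u')) (s u'))) _ u :=
      hasFDerivAt_pi.2 hi
    rw [hall.fderiv]
    ext i
    simp only [ContinuousLinearMap.coe_pi', smul_apply,
      add_apply, ContinuousLinearMap.comp_apply, ContinuousLinearMap.proj_apply,
      smul_eq_mul, hθu, rotate, Complex.ofRealCLM_apply]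
    simp
    ring
  refine D.pull_ext fun v w => ?_
  rw [pull_apply, hds, hds, stdForm_rotate]
  -- These are the two cross terms; the term quadratic in `dθ` vanishes coordinatewise.
  have h1 := hs.sum_fderiv_eq_zero hu (hker v) w
  have h2 := hs.sum_fderiv_eq_zero hu (hker w) v
  rw [← sub_eq_zero, ← sub_eq_zero.2 (h1.trans h2.symm), stdForm, stdForm, ← Finset.sum_sub_distrib,
    ← Finset.sum_sub_distrib]
  refine Finset.sum_congr rfl fun i _ => ?_
  simp only [Complex.add_re, Complex.add_im, Complex.mul_re, Complex.mul_im, Complex.I_re,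
    Complex.I_im, Complex.ofReal_re, Complex.ofReal_im]
  ring

/-- Both pullbacks are continuous, and they agree at the principal points, which accumulate at `u`.
-/
theorem IsLift.pull_eq (hs : D.IsLift W s π) (hs' : D.IsLift W s' π) {u : E} (hu : u ∈ W)
    (hd : u ∈ closure {u | D.IsPrincipal (π u)}) : D.pull s u = D.pull s' u := by
  have h1 : ContinuousAt (D.pull s) u :=
    (D.contDiffOn_pull hs.isOpen hs.smooth).continuousOn.continuousAt (hs.isOpen.mem_nhds hu)
  have h2 : ContinuousAt (D.pull s') u :=
    (D.contDiffOn_pull hs.isOpen hs'.smooth).continuousOn.continuousAt (hs.isOpen.mem_nhds hu)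
  have hd' : u ∈ closure ({u | D.IsPrincipal (π u)} ∩ W) :=
    mem_closure_iff_nhds.2 fun T hT => by
      obtain ⟨y, hy, hyp⟩ := mem_closure_iff_nhds.1 hd (T ∩ W) (Filter.inter_mem hT (hs.isOpen.mem_nhds hu))
      exact ⟨y, hy.1, hyp, hy.2⟩
  have hne : (nhdsWithin u ({u | D.IsPrincipal (π u)} ∩ W)).NeBot := mem_closure_iff_nhdsWithin_neBot.1 hd'
  have h1' := h1.tendsto.mono_left (nhdsWithin_le_nhds (s := {u | D.IsPrincipal (π u)} ∩ W))
  refine tendsto_nhds_unique h1' ((h2.tendsto.mono_left nhdsWithin_le_nhds).congr' ?_)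
  filter_upwards [self_mem_nhdsWithin] with y hy
  exact (hs.pull_eq_of_isPrincipal hs' hy.2 hy.1).symm

end FacetPresentation

namespace FacetPresentation

variable {n : ℕ} {P : LabeledPolyhedron n} {D : FacetPresentation P}

namespace Vertex

variable (V : D.Vertex)

/-! ### The section of the level set at a vertex -/

/-- The moment of a point in the coordinates at the vertex. -/
def pt (z : Fin n → ℂ) : LieDual n := V.coord fun k => ‖z k‖ ^ 2 / 2

/-- The domain of the coordinates at the vertex. -/
def dom : Set (Fin n → ℂ) := {z | ∀ i, i ∉ Set.range V.idx → 0 < D.slack i (V.pt z)}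

open Classical in
/-- The section of the quotient map that is real and positive in the coordinates of the facets
away from the vertex. -/
def sec (z : Fin n → ℂ) : Fin D.N → ℂ := fun i =>
  if h : ∃ k, V.idx k = i then z h.choose else (Real.sqrt (2 * D.slack i (V.pt z)) : ℂ)

@[simp] theorem sec_idx (z : Fin n → ℂ) (k : Fin n) : V.sec z (V.idx k) = z k := by
  have h : ∃ k', V.idx k' = V.idx k := ⟨k, rfl⟩
  rw [sec, dif_pos h, V.idx_injective h.choose_spec]

theorem sec_of_notMem (z : Fin n → ℂ) {i : Fin D.N} (hi : i ∉ Set.range V.idx) :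
    V.sec z i = (Real.sqrt (2 * D.slack i (V.pt z)) : ℂ) := dif_neg hi

theorem slack_pt (z : Fin n → ℂ) (i : Fin D.N) : D.slack i (V.pt z) =
    D.slack i V.point + ∑ k, ‖z k‖ ^ 2 / 2 * V.coeff (intVec (D.weight i)) k := V.slack_coord _ i

theorem contDiff_slack_pt (i : Fin D.N) : ContDiff ℝ ∞ fun z => D.slack i (V.pt z) := by
  simp only [slack_pt]
  refine contDiff_const.add (ContDiff.sum fun k _ => ?_)
  exact (((contDiff_norm_sq ℝ).comp (contDiff_apply ℝ ℂ k)).div_const 2).mul contDiff_const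

theorem isOpen_dom : IsOpen V.dom := by
  have : V.dom = ⋂ (i : Fin D.N) (_ : i ∉ Set.range V.idx), {z | 0 < D.slack i (V.pt z)} := by
    ext z; simp [dom]
  rw [this]
  exact isOpen_iInter_of_finite fun i => isOpen_iInter_of_finite fun _ =>
    isOpen_lt continuous_const (V.contDiff_slack_pt i).continuous

/-- Each slack at `b z` is the convex combination, with weights `1 - b²` and `b²`, of its values at
the vertex and at `z`. -/
theorem starConvex_dom : StarConvex ℝ 0 V.dom := by
  intro z hz a b ha hb hab i hi
  have h1 := hz i hi
  have h2 := V.slack_pos i hi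
  rw [slack_pt] at h1 ⊢
  have hb1 : b ≤ 1 := by linarith
  have h3 : ∀ k, ‖(a • (0 : Fin n → ℂ) + b • z) k‖ ^ 2 = b ^ 2 * ‖z k‖ ^ 2 := fun k => by
    simp [mul_pow]
  simp only [h3]
  have h4 : ∑ k, b ^ 2 * ‖z k‖ ^ 2 / 2 * V.coeff (intVec (D.weight i)) k =
      b ^ 2 * ∑ k, ‖z k‖ ^ 2 / 2 * V.coeff (intVec (D.weight i)) k := by
    rw [Finset.mul_sum]; exact Finset.sum_congr rfl fun k _ => by ring
  rw [h4]
  have hb2 : b ^ 2 ≤ 1 := pow_le_one₀ hb hb1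
  rcases hb.eq_or_lt with h | h
  · rw [← h]; simpa using h2
  · have : 0 < b ^ 2 := by positivity
    nlinarith

theorem zero_mem_dom : (0 : Fin n → ℂ) ∈ V.dom := by
  intro i hi
  rw [slack_pt]
  simpa using V.slack_pos i hi

theorem isConnected_dom : IsConnected V.dom :=
  (StarConvex.isPathConnected V.starConvex_dom V.zero_mem_dom).isConnected

theorem norm_sq_sec {z : Fin n → ℂ} (hz : z ∈ V.dom) (i : Fin D.N) :
    ‖V.sec z i‖ ^ 2 / 2 = D.slack i (V.pt z) := by
  by_cases hi : i ∈ Set.range V.idx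
  · obtain ⟨k, rfl⟩ := hi
    rw [sec_idx, pt, slack_coord_idx]
  · have := hz i hi
    rw [V.sec_of_notMem z hi, Complex.norm_real, Real.norm_eq_abs, sq_abs, Real.sq_sqrt (by positivity)]
    ring

theorem sec_mem {z : Fin n → ℂ} (hz : z ∈ V.dom) : V.sec z ∈ D.levelSet :=
  (D.mem_levelSet_iff _).2 ⟨_, V.norm_sq_sec hz⟩

open Classical in
/-- The projection to the reduced space in the coordinates at the vertex. -/
def proj (z : Fin n → ℂ) : D.Reduced :=
  if h : z ∈ V.dom then D.quot ⟨V.sec z, V.sec_mem h⟩ else Classical.arbitrary _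

theorem proj_eq {z : Fin n → ℂ} (hz : z ∈ V.dom) : V.proj z = D.quot ⟨V.sec z, V.sec_mem hz⟩ :=
  dif_pos hz

theorem moment_proj {z : Fin n → ℂ} (hz : z ∈ V.dom) : D.moment (V.proj z) = V.pt z := by
  rw [V.proj_eq hz, moment_quot]
  exact D.levelMoment_eq fun i => V.norm_sq_sec hz i

theorem contDiffOn_sec : ContDiffOn ℝ ∞ V.sec V.dom := by
  refine contDiffOn_pi.2 fun i => ?_
  by_cases hi : i ∈ Set.range V.idx
  · obtain ⟨k, rfl⟩ := hi
    simp only [sec_idx]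
    exact (contDiff_apply ℝ ℂ k).contDiffOn
  · simp only [V.sec_of_notMem _ hi]
    refine Complex.ofRealCLM.contDiff.comp_contDiffOn ?_
    intro z hz
    refine ContDiffAt.contDiffWithinAt (ContDiffAt.sqrt ?_ ?_)
    · exact (contDiff_const.mul (V.contDiff_slack_pt i)).contDiffAt
    · have := hz i hi
      positivity

theorem isLift_sec : D.IsLift V.dom V.sec V.proj :=
  ⟨V.isOpen_dom, V.contDiffOn_sec, fun _ hz => ⟨V.sec_mem hz, (V.proj_eq hz).symm⟩⟩

theorem continuousOn_proj : ContinuousOn V.proj V.dom := by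
  rw [continuousOn_iff_continuous_domRestrict]
  have : V.dom.domRestrict V.proj = D.quot ∘ fun z : V.dom => ⟨V.sec z, V.sec_mem z.2⟩ := by
    ext z; exact V.proj_eq z.2
  rw [this]
  refine D.continuous_quot.comp (Continuous.subtype_mk ?_ _)
  exact continuousOn_iff_continuous_domRestrict.1 V.contDiffOn_sec.continuousOn

theorem isPrincipal_proj {z : Fin n → ℂ} (hz : z ∈ V.dom) (h : ∀ k, z k ≠ 0) :
    D.IsPrincipal (V.proj z) := by
  intro i
  rw [V.moment_proj hz]
  by_cases hi : i ∈ Set.range V.idx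
  · obtain ⟨k, rfl⟩ := hi
    have := norm_pos_iff.2 (h k)
    rw [pt, slack_coord_idx]; positivity
  · exact hz i hi

theorem dense_ne_zero : Dense {z : Fin n → ℂ | ∀ k, z k ≠ 0} := by
  have := dense_pi (Set.univ : Set (Fin n)) (s := fun _ => ({0}ᶜ : Set ℂ))
    fun k _ => dense_compl_singleton 0
  convert this using 1
  ext z; simp

theorem mem_closure_isPrincipal {z : Fin n → ℂ} (hz : z ∈ V.dom) :
    z ∈ closure {z | D.IsPrincipal (V.proj z)} := by
  refine closure_mono (s := V.dom ∩ {z | ∀ k, z k ≠ 0}) (fun w hw => V.isPrincipal_proj hw.1 hw.2) ?_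
  exact dense_ne_zero.open_subset_closure_inter V.isOpen_dom hz

/-! ### The pullback of the standard form -/

theorem fderiv_sec_idx {z : Fin n → ℂ} (hz : z ∈ V.dom) (v : Fin n → ℂ) (k : Fin n) :
    fderiv ℝ V.sec z v (V.idx k) = v k := by
  have h := hasFDerivAt_pi'.1 (V.isLift_sec.differentiableAt hz).hasFDerivAt (V.idx k)
  simp only [sec_idx] at h
  have h2 : HasFDerivAt (fun z : Fin n → ℂ => z k) (ContinuousLinearMap.proj (R := ℝ) k) z :=
    hasFDerivAt_apply k z
  exact congrArg (fun L : (Fin n → ℂ) →L[ℝ] ℂ => L v) (h.unique h2)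

theorem fderiv_sec_im {z : Fin n → ℂ} (hz : z ∈ V.dom) (v : Fin n → ℂ) {i : Fin D.N}
    (hi : i ∉ Set.range V.idx) : (fderiv ℝ V.sec z v i).im = 0 := by
  have h := hasFDerivAt_pi'.1 (V.isLift_sec.differentiableAt hz).hasFDerivAt i
  have h1 := Complex.imCLM.hasFDerivAt.comp z h
  have h2 : (Complex.imCLM ∘ fun z => V.sec z i) = fun _ => 0 := by
    funext z; simp [V.sec_of_notMem _ hi]
  rw [h2] at h1
  exact congrArg (fun L : (Fin n → ℂ) →L[ℝ] ℝ => L v) (h1.unique (hasFDerivAt_const _ z))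

/-- Away from the vertex the section has real coordinates, so those summands of the standard form
vanish and `z` are Darboux coordinates. -/
theorem pull_sec {z : Fin n → ℂ} (hz : z ∈ V.dom) (v w : Fin n → ℂ) :
    D.pull V.sec z ![v, w] = ∑ k, ((v k).re * (w k).im - (v k).im * (w k).re) := by
  rw [pull_apply, stdForm]
  refine (Fintype.sum_of_injective V.idx V.idx_injective _ _ (fun i hi => ?_) fun k => ?_).symm
  · rw [V.fderiv_sec_im hz v hi, V.fderiv_sec_im hz w hi]; ring
  · rw [V.fderiv_sec_idx hz, V.fderiv_sec_idx hz]

theorem pull_sec_nondegenerate {z : Fin n → ℂ} (hz : z ∈ V.dom) {v : Fin n → ℂ}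
    (hv : ∀ w, D.pull V.sec z ![v, w] = 0) : v = 0 := by
  have h := hv (Complex.I • v)
  rw [V.pull_sec hz] at h
  have h1 : ∀ k, (v k).re * ((Complex.I • v) k).im - (v k).im * ((Complex.I • v) k).re =
      (v k).re * (v k).re + (v k).im * (v k).im := fun k => by simp
  simp only [h1] at h
  rw [Finset.sum_eq_zero_iff_of_nonneg fun k _ =>
    add_nonneg (mul_self_nonneg _) (mul_self_nonneg _)] at h
  ext k
  have h2 := h k (Finset.mem_univ k)
  rw [← Complex.normSq_apply, Complex.normSq_eq_zero] at h2
  exact h2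

/-! ### The local group -/

/-- The group of the chart at the vertex. -/
def group : Subgroup (Torus D.N) where
  carrier := {t | D.torusMap t = 1 ∧ ∀ i, i ∉ Set.range V.idx → t i = 1}
  one_mem' := ⟨D.torusMap_one, fun _ _ => rfl⟩
  mul_mem' := fun {s t} hs ht => ⟨by rw [torusMap_mul, hs.1, ht.1, one_mul], fun i hi => by
    rw [Pi.mul_apply, hs.2 i hi, ht.2 i hi, one_mul]⟩
  inv_mem' := fun {t} ht => ⟨by rw [torusMap_inv, ht.1, inv_one], fun i hi => by
    rw [Pi.inv_apply, ht.2 i hi, inv_one]⟩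

/-- The action of the torus in the coordinates at the vertex. -/
def act (t : Torus D.N) (z : Fin n → ℂ) : Fin n → ℂ := fun k => t (V.idx k) * z k

@[simp] theorem act_one (z : Fin n → ℂ) : V.act 1 z = z := by ext k; simp [act]

theorem act_mul (s t : Torus D.N) (z : Fin n → ℂ) : V.act (s * t) z = V.act s (V.act t z) := by
  ext k; simp [act, mul_assoc]

@[simp] theorem pt_act (t : Torus D.N) (z : Fin n → ℂ) : V.pt (V.act t z) = V.pt z := by
  simp [pt, act, Circle.norm_coe]

@[simp] theorem act_mem_dom_iff (t : Torus D.N) {z : Fin n → ℂ} : V.act t z ∈ V.dom ↔ z ∈ V.dom := by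
  simp [dom]

theorem sec_act {t : Torus D.N} (ht : ∀ i, i ∉ Set.range V.idx → t i = 1) (z : Fin n → ℂ) :
    V.sec (V.act t z) = D.rotate t (V.sec z) := by
  ext i
  by_cases hi : i ∈ Set.range V.idx
  · obtain ⟨k, rfl⟩ := hi
    simp [rotate, act]
  · rw [V.sec_of_notMem _ hi, rotate, V.sec_of_notMem _ hi, ht i hi, pt_act]; simp

theorem proj_act {t : Torus D.N} (ht : ∀ i, i ∉ Set.range V.idx → t i = 1) {z : Fin n → ℂ}
    (hz : z ∈ V.dom) : V.proj (V.act t z) = D.torusMap t • V.proj z := by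
  rw [V.proj_eq hz, torusMap_smul_quot, V.proj_eq ((V.act_mem_dom_iff t).2 hz)]
  congr 1
  exact Subtype.ext (V.sec_act ht z)

theorem dist_act (t : Torus D.N) (z w : Fin n → ℂ) : dist (V.act t z) (V.act t w) = dist z w := by
  have h : ∀ k, nndist (V.act t z k) (V.act t w k) = nndist (z k) (w k) := fun k => by
    ext
    simp [act, dist_eq_norm, ← mul_sub, Circle.norm_coe]
  simp only [dist_pi_def, h]

theorem sec_pos {z : Fin n → ℂ} (hz : z ∈ V.dom) {i : Fin D.N} (hi : i ∉ Set.range V.idx) :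
    0 < Real.sqrt (2 * D.slack i (V.pt z)) := by
  have := hz i hi
  positivity

/-- An element of `K` that relates two values of the section sends positive reals to positive reals
away from the vertex, so it is `1` there. -/
theorem proj_eq_iff {z w : Fin n → ℂ} (hz : z ∈ V.dom) (hw : w ∈ V.dom) :
    V.proj z = V.proj w ↔ ∃ γ ∈ V.group, V.act γ z = w := by
  constructor
  · intro h
    rw [V.proj_eq hz, V.proj_eq hw, quot_eq_iff] at h
    obtain ⟨t, ht, he⟩ := h
    have he' : V.sec w = D.rotate t (V.sec z) := congrArg Subtype.val he
    refine ⟨t, ⟨ht, fun i hi => ?_⟩, ?_⟩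
    · have h1 := congrFun he' i
      rw [rotate, V.sec_of_notMem _ hi, V.sec_of_notMem _ hi] at h1
      have hz' := V.sec_pos hz hi
      have hw' := V.sec_pos hw hi
      have h2 := congrArg norm h1
      rw [norm_mul, Circle.norm_coe, one_mul, Complex.norm_real, Complex.norm_real,
        Real.norm_of_nonneg hz'.le, Real.norm_of_nonneg hw'.le] at h2
      rw [h2] at h1
      have h3 : (Real.sqrt (2 * D.slack i (V.pt z)) : ℂ) ≠ 0 := by exact_mod_cast hz'.ne'
      exact Circle.ext (by rw [Circle.coe_one]; exact (mul_left_eq_self₀.1 h1.symm).resolve_right h3)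
    · ext k
      have := congrFun he' (V.idx k)
      rw [sec_idx, rotate, sec_idx] at this
      exact this.symm
  · rintro ⟨γ, hγ, rfl⟩
    rw [V.proj_act hγ.2 hz, hγ.1, one_smul]

variable (D) in
theorem prod_torusMap_zpow (t : Torus D.N) (y : Fin n → ℤ) :
    ∏ j, D.torusMap t j ^ y j = ∏ i, t i ^ ∑ j, y j * D.weight i j := by
  simp only [torusMap, ← Finset.prod_zpow]
  rw [Finset.prod_comm]
  refine Finset.prod_congr rfl fun i _ => ?_
  have : ∀ s : Finset (Fin n), ∏ j ∈ s, (t i ^ D.weight i j) ^ y j =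
      t i ^ ∑ j ∈ s, y j * D.weight i j := by
    intro s
    induction s using Finset.induction_on with
    | empty => simp
    | insert a s ha ih =>
      rw [Finset.prod_insert ha, Finset.sum_insert ha, ih, ← zpow_mul, zpow_add, mul_comm (y a)]
  exact this _

/-- Pairing with the `k`-th edge vector kills all other normals at the vertex and isolates the
`k`-th circle factor. The local group therefore embeds in a product of finite groups of roots of
unity. -/
theorem zpow_eq_one_of_mem_group {t : Torus D.N} (ht : t ∈ V.group) (k : Fin n) :
    t (V.idx k) ^ ∑ j, V.edge k j * D.weight (V.idx k) j = 1 := by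
  have h := prod_torusMap_zpow D t (V.edge k)
  rw [ht.1] at h
  simp only [Pi.one_apply, one_zpow, Finset.prod_const_one] at h
  rw [Finset.prod_eq_single (V.idx k)] at h
  · exact h.symm
  · intro i _ hi
    by_cases hr : i ∈ Set.range V.idx
    · obtain ⟨k', rfl⟩ := hr
      rw [V.orth k k' (fun h => hi (by rw [h])), zpow_zero]
    · rw [ht.2 i hr, one_zpow]
  · simp

theorem finite_circle_zpow_eq_one {d : ℤ} (hd : 0 < d) : {t : Circle | t ^ d = 1}.Finite := by
  have h1 : {x : ℂ | x ^ d.toNat = 1}.Finite := by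
    refine (Multiset.finite_toSet (Polynomial.nthRoots d.toNat (1 : ℂ))).subset fun x hx => ?_
    exact (Polynomial.mem_nthRoots (by omega)).2 hx
  refine (h1.preimage Circle.coe_injective.injOn).subset fun (t : Circle) ht => ?_
  have h2 : t ^ d = 1 := ht
  have h3 : d = (d.toNat : ℤ) := by omega
  rw [h3, zpow_natCast] at h2
  change (t : ℂ) ^ d.toNat = 1
  rw [← Circle.coe_pow, h2, Circle.coe_one]

instance : Finite V.group := by
  have h1 : (Set.pi Set.univ fun k => {t : Circle | t ^ ∑ j, V.edge k j * D.weight (V.idx k) j = 1}).Finite :=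
    Set.Finite.pi fun k => finite_circle_zpow_eq_one (V.pos k)
  have h2 := h1.to_subtype
  refine Finite.of_injective (β := (Set.pi Set.univ fun k =>
    {t : Circle | t ^ ∑ j, V.edge k j * D.weight (V.idx k) j = 1}))
    (fun γ => ⟨fun k => γ.1 (V.idx k), fun k _ => V.zpow_eq_one_of_mem_group γ.2 k⟩) ?_
  intro γ δ h
  refine Subtype.ext (funext fun i => ?_)
  by_cases hi : i ∈ Set.range V.idx
  · obtain ⟨k, rfl⟩ := hi
    exact congrFun (congrArg Subtype.val h) k
  · rw [γ.2.2 i hi, δ.2.2 i hi]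

theorem eq_one_of_act_eq {γ : Torus D.N} (hγ : γ ∈ V.group) {z : Fin n → ℂ} (hz : ∀ k, z k ≠ 0)
    (h : V.act γ z = z) : γ = 1 := by
  funext i
  by_cases hi : i ∈ Set.range V.idx
  · obtain ⟨k, rfl⟩ := hi
    have := congrFun h k
    exact Circle.ext (by rw [Pi.one_apply, Circle.coe_one]; exact (mul_left_eq_self₀.1 this).resolve_right (hz k))
  · exact hγ.2 i hi

/-! ### Slices -/

open Classical in
/-- The arguments of the coordinates of the facets away from the vertex. -/
def phase (z : Fin D.N → ℂ) : Fin D.N → ℝ := fun i =>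
  if i ∈ Set.range V.idx then 0 else (z i).arg

/-- The infinitesimal gauge transformation in `ker ϖ` that makes the coordinates of the facets away
from the vertex real and positive. -/
def gauge (z : Fin D.N → ℂ) : Fin D.N → ℝ := V.lift (D.varpi (V.phase z)) - V.phase z

theorem varpi_sub (x y : Fin D.N → ℝ) : D.varpi (x - y) = D.varpi x - D.varpi y := by
  ext j; simp [varpi, sub_mul, Finset.sum_sub_distrib]

@[simp] theorem varpi_gauge (z : Fin D.N → ℂ) : D.varpi (V.gauge z) = 0 := by
  rw [gauge, varpi_sub, varpi_lift, sub_self]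

theorem gauge_of_notMem (z : Fin D.N → ℂ) {i : Fin D.N} (hi : i ∉ Set.range V.idx) :
    V.gauge z i = -(z i).arg := by
  rw [gauge, Pi.sub_apply, V.lift_of_notMem _ hi, phase, if_neg hi, zero_sub]

/-- The coordinates at the vertex of a point of the level set. -/
def slice (z : Fin D.N → ℂ) : Fin n → ℂ := fun k =>
  D.rotate (torusExp (V.gauge z)) z (V.idx k)

theorem torusMap_gauge (z : Fin D.N → ℂ) : D.torusMap (torusExp (V.gauge z)) = 1 := by
  rw [torusMap_torusExp, varpi_gauge, torusExp_zero]

theorem rotate_gauge_of_notMem (z : Fin D.N → ℂ) {i : Fin D.N} (hi : i ∉ Set.range V.idx) :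
    D.rotate (torusExp (V.gauge z)) z i = (‖z i‖ : ℂ) := by
  rw [rotate, torusExp, V.gauge_of_notMem z hi]
  conv_lhs => rw [← Complex.norm_mul_exp_arg_mul_I (z i)]
  rw [Circle.coe_exp, mul_left_comm, ← Complex.exp_add]
  simp

theorem pt_slice {z : Fin D.N → ℂ} (hz : z ∈ D.levelSet) :
    V.pt (V.slice z) = D.levelMoment ⟨z, hz⟩ := by
  rw [V.levelMoment_eq_coord]
  simp [pt, slice]

theorem slice_mem_dom {z : Fin D.N → ℂ} (hz : z ∈ D.levelSet)
    (h : ∀ i, i ∉ Set.range V.idx → z i ≠ 0) : V.slice z ∈ V.dom := by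
  intro i hi
  rw [V.pt_slice hz, ← norm_sq_eq]
  have := norm_pos_iff.2 (h i hi)
  positivity

theorem sec_slice {z : Fin D.N → ℂ} (hz : z ∈ D.levelSet) :
    V.sec (V.slice z) = D.rotate (torusExp (V.gauge z)) z := by
  ext i
  by_cases hi : i ∈ Set.range V.idx
  · obtain ⟨k, rfl⟩ := hi
    rw [sec_idx, slice]
  · rw [V.sec_of_notMem _ hi, V.pt_slice hz, ← norm_sq_eq, V.rotate_gauge_of_notMem z hi]
    rw [mul_div_cancel₀ _ two_ne_zero, Real.sqrt_sq (norm_nonneg _)]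

theorem proj_slice {z : Fin D.N → ℂ} (hz : z ∈ D.levelSet)
    (h : ∀ i, i ∉ Set.range V.idx → z i ≠ 0) : V.proj (V.slice z) = D.quot ⟨z, hz⟩ := by
  rw [V.proj_eq (V.slice_mem_dom hz h), eq_comm, quot_eq_iff]
  exact ⟨_, V.torusMap_gauge z, Subtype.ext (V.sec_slice hz)⟩

theorem phase_sec (w : Fin n → ℂ) : V.phase (V.sec w) = 0 := by
  ext i
  by_cases hi : i ∈ Set.range V.idx
  · exact if_pos hi
  · rw [phase, if_neg hi, V.sec_of_notMem _ hi]
    exact Complex.arg_ofReal_of_nonneg (Real.sqrt_nonneg _)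

theorem gauge_sec (w : Fin n → ℂ) : V.gauge (V.sec w) = 0 := by
  rw [gauge, phase_sec]
  ext i
  simp [lift, coeff, varpi, pair]

theorem slice_sec (w : Fin n → ℂ) : V.slice (V.sec w) = w := by
  ext k; simp [slice, gauge_sec]

/-- The points at which the slice is smooth. -/
def sliceDom : Set (Fin D.N → ℂ) := {z | ∀ i, i ∉ Set.range V.idx → z i ∈ Complex.slitPlane}

theorem isOpen_sliceDom : IsOpen V.sliceDom := by
  have : V.sliceDom = ⋂ (i : Fin D.N) (_ : i ∉ Set.range V.idx),
      (fun z : Fin D.N → ℂ => z i) ⁻¹' Complex.slitPlane := by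
    ext z; simp [sliceDom]
  rw [this]
  exact isOpen_iInter_of_finite fun i => isOpen_iInter_of_finite fun _ =>
    Complex.isOpen_slitPlane.preimage (continuous_apply i)

theorem sec_mem_sliceDom {w : Fin n → ℂ} (hw : w ∈ V.dom) : V.sec w ∈ V.sliceDom := by
  intro i hi
  rw [V.sec_of_notMem _ hi]
  exact Complex.ofReal_mem_slitPlane.2 (V.sec_pos hw hi)

theorem contDiffOn_phase : ContDiffOn ℝ ∞ V.phase V.sliceDom := by
  refine contDiffOn_pi.2 fun i => ?_
  by_cases hi : i ∈ Set.range V.idx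
  · simp only [phase, if_pos hi]
    exact contDiffOn_const
  · simp only [phase, if_neg hi]
    intro z hz
    refine ContDiffAt.contDiffWithinAt ?_
    have h1 : ContDiffAt ℝ ∞ (fun z : Fin D.N → ℂ => Complex.log (z i)) z :=
      ((Complex.contDiffAt_log (hz i hi)).restrict_scalars ℝ).comp z (contDiff_apply ℝ ℂ i).contDiffAt
    have h2 : (fun z : Fin D.N → ℂ => (z i).arg) = Complex.imCLM ∘ fun z => Complex.log (z i) := by
      funext z; simp [Complex.log_im]
    rw [h2]
    exact Complex.imCLM.contDiff.contDiffAt.comp z h1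

theorem contDiffOn_gauge : ContDiffOn ℝ ∞ V.gauge V.sliceDom := by
  have h : ContDiff ℝ ∞ fun θ : Fin D.N → ℝ => V.lift (D.varpi θ) - θ := by
    unfold lift varpi coeff pair
    fun_prop
  exact h.comp_contDiffOn V.contDiffOn_phase

theorem contDiffOn_slice : ContDiffOn ℝ ∞ V.slice V.sliceDom := by
  refine contDiffOn_pi.2 fun k => ?_
  have h1 : ContDiffOn ℝ ∞ (fun z => (V.gauge z (V.idx k) : ℂ) * Complex.I) V.sliceDom :=
    (Complex.ofRealCLM.contDiff.comp_contDiffOn (contDiffOn_pi.1 V.contDiffOn_gauge (V.idx k))).mul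
      contDiffOn_const
  exact h1.cexp.mul (contDiff_apply ℝ ℂ (V.idx k)).contDiffOn

end Vertex

end FacetPresentation

namespace FacetPresentation

variable {n : ℕ} {P : LabeledPolyhedron n} {D : FacetPresentation P}

theorem quot_rot {t : Torus D.N} (ht : D.torusMap t = 1) (z : D.levelSet) :
    D.quot (D.rot t z) = D.quot z := (D.quot_eq_iff.2 ⟨t, ht, rfl⟩).symm

theorem continuous_rotate (t : Torus D.N) : Continuous (D.rotate t) :=
  continuous_pi fun i => continuous_const.mul (continuous_apply i)

theorem contDiff_rotate (t : Torus D.N) : ContDiff ℝ ∞ (D.rotate t) :=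
  contDiff_pi.2 fun i => contDiff_const.mul (contDiff_apply ℝ ℂ i)

namespace Vertex

variable (V : D.Vertex)

theorem ne_zero_of_mem_sliceDom {z : Fin D.N → ℂ} (hz : z ∈ V.sliceDom) {i : Fin D.N}
    (hi : i ∉ Set.range V.idx) : z i ≠ 0 := Complex.slitPlane_ne_zero (hz i hi)

/-- Near a point of the level set over the image, an element of `K` followed by the slice is a
continuous local inverse of the section, up to the action of `K`. -/
theorem isOpen_image_proj {B : Set (Fin n → ℂ)} (hB : IsOpen B) (hBd : B ⊆ V.dom) :
    IsOpen (V.proj '' B) := by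
  rw [← D.isOpenQuotientMap_quot.isQuotientMap.isOpen_preimage, isOpen_iff_mem_nhds]
  rintro z ⟨w, hw, hwz⟩
  rw [V.proj_eq (hBd hw), eq_comm, quot_eq_iff] at hwz
  obtain ⟨k, hk, he⟩ := hwz
  have hz : D.rotate k z = V.sec w := (congrArg Subtype.val he).symm
  have hmem : D.rotate k z ∈ V.sliceDom := hz ▸ V.sec_mem_sliceDom (hBd hw)
  have hc : Continuous fun z' : D.levelSet => D.rotate k z' :=
    (continuous_rotate k).comp continuous_subtype_val
  have h1 : ∀ᶠ z' : D.levelSet in nhds z, D.rotate k z' ∈ V.sliceDom :=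
    hc.continuousAt.eventually (V.isOpen_sliceDom.mem_nhds hmem)
  have h2 : ∀ᶠ z' : D.levelSet in nhds z, V.slice (D.rotate k z') ∈ B := by
    have hs : ContinuousAt V.slice (D.rotate k z) :=
      V.contDiffOn_slice.continuousOn.continuousAt (V.isOpen_sliceDom.mem_nhds hmem)
    have : ContinuousAt (fun z' : D.levelSet => V.slice (D.rotate k z')) z :=
      ContinuousAt.comp (g := V.slice) hs hc.continuousAt
    refine this.eventually (hB.mem_nhds ?_)
    simp only [hz, slice_sec]
    exact hw
  filter_upwards [h1, h2] with z' h1 h2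
  refine ⟨_, h2, ?_⟩
  rw [V.proj_slice ((D.rotate_mem_levelSet_iff k z').2 z'.2) fun i hi => V.ne_zero_of_mem_sliceDom h1 hi]
  exact quot_rot hk z'

theorem contDiff_act (t : Torus D.N) : ContDiff ℝ ∞ (V.act t) :=
  contDiff_pi.2 fun k => contDiff_const.mul (contDiff_apply ℝ ℂ k)

theorem slice_rotate {γ : Torus D.N} (hγ : ∀ i, i ∉ Set.range V.idx → γ i = 1) (z : Fin D.N → ℂ) :
    V.slice (D.rotate γ z) = V.act γ (V.slice z) := by
  have h : V.gauge (D.rotate γ z) = V.gauge z := by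
    have : V.phase (D.rotate γ z) = V.phase z := by
      ext i
      by_cases hi : i ∈ Set.range V.idx
      · rw [phase, phase, if_pos hi, if_pos hi]
      · rw [phase, phase, if_neg hi, if_neg hi, rotate, hγ i hi]; simp
    rw [gauge, gauge, this]
  ext k
  simp only [slice, h, act, rotate]
  ring

/-! ### Charts at a vertex -/

/-- A connected open set in the coordinates at the vertex, invariant under a subgroup of the local
group and disjoint from its translates by the other elements. -/
structure Patch where
  B : Set (Fin n → ℂ)
  isOpen : IsOpen B
  isConnected : IsConnected B
  subset : B ⊆ V.dom
  H : Subgroup (Torus D.N)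
  le : H ≤ V.group
  mapsTo : ∀ γ ∈ H, Set.MapsTo (V.act γ) B B
  sep : ∀ γ ∈ V.group, ∀ z ∈ B, V.act γ z ∈ B → γ ∈ H

end Vertex

/-- An identification of `ℝ²ⁿ` with `ℂⁿ`. -/
def euclid (n : ℕ) : EuclideanSpace ℝ (Fin (2 * n)) ≃L[ℝ] (Fin n → ℂ) :=
  ContinuousLinearEquiv.ofFinrankEq (by simp [Module.finrank_pi_fintype, mul_comm])

namespace Vertex

variable {V : D.Vertex}

/-- The chart given by a patch. -/
def Patch.chart (Q : V.Patch) : LocalChart (2 * n) D.Reduced where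
  U := (fun u => V.proj (euclid n u)) '' (euclid n ⁻¹' Q.B)
  isOpen_U := by
    rw [← Set.image_image V.proj, Set.image_preimage_eq _ (euclid n).surjective]
    exact V.isOpen_image_proj Q.isOpen Q.subset
  dom := euclid n ⁻¹' Q.B
  isOpen_dom := Q.isOpen.preimage (euclid n).continuous
  isConnected_dom := (euclid n).toHomeomorph.isConnected_preimage.2 Q.isConnected
  Γ := Q.H
  finite := Finite.of_injective _ (Subgroup.inclusion_injective Q.le)
  act γ u := (euclid n).symm (V.act γ (euclid n u))
  act_mapsTo γ _ hu := by
    simp only [Set.mem_preimage, ContinuousLinearEquiv.apply_symm_apply]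
    exact Q.mapsTo γ γ.2 hu
  act_one u _ := by simp
  act_mul γ δ u _ := by simp [V.act_mul]
  act_smooth γ := ((euclid n).symm.contDiff.comp
    ((V.contDiff_act γ).comp (euclid n).contDiff)).contDiffOn
  act_effective γ h := by
    obtain ⟨z, hz, hz0⟩ := dense_ne_zero.inter_open_nonempty Q.B Q.isOpen Q.isConnected.nonempty
    have h1 := h ((euclid n).symm z) (by simpa using hz)
    simp only [ContinuousLinearEquiv.apply_symm_apply, EmbeddingLike.apply_eq_iff_eq] at h1
    exact Subtype.ext (V.eq_one_of_act_eq (Q.le γ.2) hz0 h1)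
  proj u := V.proj (euclid n u)
  proj_image := rfl
  proj_continuousOn := (V.continuousOn_proj.mono Q.subset).comp (euclid n).continuous.continuousOn
    fun _ hu => hu
  proj_isOpen W hW hWo := by
    rw [← Set.image_image V.proj]
    refine V.isOpen_image_proj ((euclid n).toHomeomorph.isOpenMap W hWo) ?_
    rintro _ ⟨u, hu, rfl⟩
    exact Q.subset (hW hu)
  proj_eq_iff u hu v hv := by
    rw [V.proj_eq_iff (Q.subset hu) (Q.subset hv)]
    constructor
    · rintro ⟨γ, hγ, he⟩
      refine ⟨⟨γ, Q.sep γ hγ _ hu (he ▸ hv)⟩, ?_⟩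
      rw [he]; simp
    · rintro ⟨γ, rfl⟩
      exact ⟨γ, Q.le γ.2, by simp⟩

variable (V) in
/-- The patch given by all of the domain at the vertex. -/
def fullPatch : V.Patch where
  B := V.dom
  isOpen := V.isOpen_dom
  isConnected := V.isConnected_dom
  subset := subset_rfl
  H := V.group
  le := le_rfl
  mapsTo γ _ _ hz := (V.act_mem_dom_iff γ).2 hz
  sep _ hγ _ _ _ := hγ

variable (V) in
/-- The elements of the local group that fix `w`. -/
def stab (w : Fin n → ℂ) : Subgroup (Torus D.N) where
  carrier := {γ | γ ∈ V.group ∧ V.act γ w = w}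
  one_mem' := ⟨V.group.one_mem, V.act_one w⟩
  mul_mem' := fun {s t} hs ht => ⟨V.group.mul_mem hs.1 ht.1, by rw [act_mul, ht.2, hs.2]⟩
  inv_mem' := fun {t} ht => ⟨V.group.inv_mem ht.1, by
    conv_lhs => rw [← ht.2]
    rw [← act_mul, inv_mul_cancel, act_one]⟩

/-- The patch is a ball around `w`. The torus acts by isometries, so the stabilizer preserves it; a
small radius separates it from its other translates. -/
theorem exists_small_patch {w : Fin n → ℂ} (hw : w ∈ V.dom) {O : Set (Fin n → ℂ)} (hO : IsOpen O)
    (hwO : w ∈ O) : ∃ Q : V.Patch, Q.B ⊆ O ∧ w ∈ Q.B ∧ Q.H = V.stab w := by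
  obtain ⟨ε, hε, hball⟩ := Metric.isOpen_iff.1 (hO.inter V.isOpen_dom) w ⟨hwO, hw⟩
  have h1 : ∀ γ : V.group, ∀ᶠ r : ℝ in nhdsWithin 0 (Set.Ioi 0),
      V.act γ w ≠ w → 2 * r < dist (V.act γ w) w := by
    intro γ
    by_cases h : V.act γ w = w
    · exact Filter.Eventually.of_forall fun r h' => absurd h h'
    · have hd := dist_pos.2 h
      filter_upwards [nhdsWithin_le_nhds (Iio_mem_nhds (half_pos hd))] with r hr _
      have : r < dist (V.act γ w) w / 2 := hr
      linarith
  have h2 : ∀ᶠ r : ℝ in nhdsWithin 0 (Set.Ioi 0), r < ε := nhdsWithin_le_nhds (Iio_mem_nhds hε)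
  have h3 : ∀ᶠ r : ℝ in nhdsWithin 0 (Set.Ioi 0), 0 < r := self_mem_nhdsWithin
  obtain ⟨r, hr, hrε, hr0⟩ := ((Filter.eventually_all.2 h1).and (h2.and h3)).exists
  have hsub : Metric.ball w r ⊆ O ∩ V.dom := (Metric.ball_subset_ball hrε.le).trans hball
  refine ⟨⟨Metric.ball w r, Metric.isOpen_ball, ?_, fun z hz => (hsub hz).2, V.stab w,
    fun γ hγ => hγ.1, fun γ hγ z hz => ?_, fun γ hγ z hz hz' => ⟨hγ, ?_⟩⟩, fun z hz => (hsub hz).1,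
    Metric.mem_ball_self hr0, rfl⟩
  · exact ⟨⟨w, Metric.mem_ball_self hr0⟩, (convex_ball w r).isPreconnected⟩
  · rw [Metric.mem_ball] at hz ⊢
    conv_lhs => rw [← hγ.2]
    rwa [dist_act]
  · by_contra hne
    have h2 := hr ⟨γ, hγ⟩ hne
    rw [Metric.mem_ball] at hz hz'
    have h3 := dist_triangle_left (V.act γ w) w (V.act γ z)
    rw [dist_act] at h3
    linarith

/-! ### Transition maps -/

/-- Fixing a point is expressed through the vanishing coordinates of its lift, which do not depend
on the vertex. This carries stabilizers from one vertex to another. -/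
theorem act_eq_self_iff {γ : Torus D.N} (hγ : ∀ i, i ∉ Set.range V.idx → γ i = 1) (w : Fin n → ℂ) :
    V.act γ w = w ↔ ∀ i, V.sec w i ≠ 0 → γ i = 1 := by
  constructor
  · intro h i hi
    by_cases hr : i ∈ Set.range V.idx
    · obtain ⟨k, rfl⟩ := hr
      rw [sec_idx] at hi
      have := congrFun h k
      exact Circle.ext (by rw [Circle.coe_one]; exact (mul_left_eq_self₀.1 this).resolve_right hi)
    · exact hγ i hr
  · intro h
    ext k
    by_cases hk : w k = 0
    · simp [act, hk]
    · rw [act, h (V.idx k) (by rwa [sec_idx])]; simp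

/-- The transition map `ψ` is section, then a fixed element of `K`, then slice at the other vertex.
Stabilizer elements act on both sides as the same elements of `𝕋ᴺ`, so the group homomorphism is an
inclusion. -/
theorem exists_embedding {V' : D.Vertex} (Q' : V'.Patch) {w w' : Fin n → ℂ} (hw : w ∈ V.dom)
    (hw' : w' ∈ Q'.B) (hww' : V.proj w = V'.proj w') :
    ∃ O, IsOpen O ∧ w ∈ O ∧ ∀ Q : V.Patch, Q.B ⊆ O → Q.H = V.stab w →
      Nonempty (ChartEmbedding Q.chart Q'.chart) := by
  rw [V.proj_eq hw, V'.proj_eq (Q'.subset hw'), quot_eq_iff] at hww'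
  obtain ⟨k, hk, he⟩ := hww'
  replace he : V'.sec w' = D.rotate k (V.sec w) := congrArg Subtype.val he
  set f : (Fin n → ℂ) → Fin D.N → ℂ := fun z => D.rotate k (V.sec z) with hf
  have hfs : ContDiffOn ℝ ∞ f V.dom := (contDiff_rotate k).comp_contDiffOn V.contDiffOn_sec
  set ψ : (Fin n → ℂ) → Fin n → ℂ := fun z => V'.slice (f z) with hψ
  have hO₁ : IsOpen (V.dom ∩ f ⁻¹' V'.sliceDom) :=
    hfs.continuousOn.isOpen_inter_preimage V.isOpen_dom V'.isOpen_sliceDom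
  have hψs : ContDiffOn ℝ ∞ ψ (V.dom ∩ f ⁻¹' V'.sliceDom) :=
    V'.contDiffOn_slice.comp (hfs.mono Set.inter_subset_left) fun _ hz => hz.2
  have hO : IsOpen ((V.dom ∩ f ⁻¹' V'.sliceDom) ∩ ψ ⁻¹' Q'.B) :=
    hψs.continuousOn.isOpen_inter_preimage hO₁ Q'.isOpen
  set O := (V.dom ∩ f ⁻¹' V'.sliceDom) ∩ ψ ⁻¹' Q'.B with hOdef
  have hfw : f w = V'.sec w' := he.symm
  have hψw : ψ w = w' := by rw [hψ]; simp only [hfw, slice_sec]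
  have hwO : w ∈ O := ⟨⟨hw, by
    rw [Set.mem_preimage, hfw]; exact V'.sec_mem_sliceDom (Q'.subset hw')⟩, by
    rw [Set.mem_preimage, hψw]; exact hw'⟩
  have hfl : ∀ z ∈ O, f z ∈ D.levelSet := fun z hz =>
    (D.rotate_mem_levelSet_iff k _).2 (V.sec_mem hz.1.1)
  have hproj : ∀ z ∈ O, V'.proj (ψ z) = V.proj z := by
    intro z hz
    rw [V'.proj_slice (hfl z hz) fun i hi => V'.ne_zero_of_mem_sliceDom hz.1.2 hi, V.proj_eq hz.1.1]
    exact quot_rot hk ⟨V.sec z, V.sec_mem hz.1.1⟩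
  have hzero : ∀ z ∈ O, ∀ i, V'.sec (ψ z) i = 0 ↔ V.sec z i = 0 := by
    intro z hz i
    rw [V'.sec_slice (hfl z hz), hf]
    simp [rotate]
  have hlift : D.IsLift O V.sec V.proj := V.isLift_sec.mono hO fun z hz => hz.1.1
  have hlift' : D.IsLift O (fun z => V'.sec (ψ z)) V.proj :=
    ⟨hO, V'.contDiffOn_sec.comp (hψs.mono Set.inter_subset_left) fun z hz => Q'.subset hz.2,
      fun z hz => ⟨V'.sec_mem (Q'.subset hz.2), by
        rw [← hproj z hz, V'.proj_eq (Q'.subset hz.2)]⟩⟩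
  -- `sec` and `sec' ∘ ψ` lift the same map and so pull back the same form. A vector in the kernel
  -- of `dψ` would be in the kernel of that form, which is nondegenerate.
  have himm : ∀ z ∈ O, Function.Injective (fderiv ℝ ψ z) := by
    intro z hz
    rw [injective_iff_map_eq_zero]
    intro v hv
    refine V.pull_sec_nondegenerate hz.1.1 fun v' => ?_
    rw [hlift.pull_eq hlift' hz (V.mem_closure_isPrincipal hz.1.1), pull_apply]
    have hd : DifferentiableAt ℝ ψ z :=
      (hψs.contDiffAt (hO₁.mem_nhds hz.1)).differentiableAt (by simp)
    have hd' := V'.isLift_sec.differentiableAt (Q'.subset hz.2)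
    have : fderiv ℝ (fun z => V'.sec (ψ z)) z v = 0 := by
      rw [fderiv_fun_comp z hd' hd, ContinuousLinearMap.comp_apply, hv, map_zero]
    rw [this]
    simp [stdForm]
  refine ⟨O, hO, hwO, fun Q hQO hQH => ?_⟩
  have hgrp : ∀ γ ∈ Q.H, γ ∈ V.group ∧ γ ∈ V'.group ∧ γ ∈ Q'.H := by
    intro γ hγ
    rw [hQH] at hγ
    obtain ⟨hγ1, hγ2⟩ := hγ
    have h1 := (act_eq_self_iff hγ1.2 w).1 hγ2
    have h2 : ∀ i, V'.sec w' i ≠ 0 → γ i = 1 := fun i hi => h1 i (by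
      rw [← hψw] at hi; exact fun h => hi ((hzero w hwO i).2 h))
    have h3 : γ ∈ V'.group := ⟨hγ1.1, fun i hi => h2 i (by
      rw [V'.sec_of_notMem _ hi]; exact_mod_cast (V'.sec_pos (Q'.subset hw') hi).ne')⟩
    refine ⟨hγ1, h3, Q'.sep γ h3 w' hw' ?_⟩
    rw [(act_eq_self_iff h3.2 w').2 h2]
    exact hw'
  have hequi : ∀ γ ∈ Q.H, ∀ z, ψ (V.act γ z) = V'.act γ (ψ z) := by
    intro γ hγ z
    obtain ⟨h1, h2, -⟩ := hgrp γ hγ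
    rw [hψ]
    simp only [hf]
    rw [V.sec_act h1.2, ← D.rotate_mul, mul_comm, D.rotate_mul, V'.slice_rotate h2.2]
  refine ⟨⟨fun u => (euclid n).symm (ψ (euclid n u)), Subgroup.inclusion fun γ hγ => (hgrp γ hγ).2.2,
    fun u hu => ?_, ?_, fun u hu u' hu' h => ?_, fun u hu => ?_, fun γ u hu => ?_, fun u hu => ?_⟩⟩
  · have := (hQO hu).2
    simpa [Patch.chart] using this
  · exact (euclid n).symm.contDiff.comp_contDiffOn ((hψs.mono fun z hz => (hQO hz).1).comp
      (euclid n).contDiff.contDiffOn fun _ hu => hu)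
  · have h1 : ψ (euclid n u) = ψ (euclid n u') := (euclid n).symm.injective h
    have h2 : V.proj (euclid n u) = V.proj (euclid n u') := by
      rw [← hproj _ (hQO hu), h1, hproj _ (hQO hu')]
    obtain ⟨γ, hγ, hγu⟩ := (V.proj_eq_iff (Q.subset hu) (Q.subset hu')).1 h2
    -- Points with equal image under `ψ` differ by some `γ` in the patch group. By equivariance `γ`
    -- fixes the image, hence also the source, as the same coordinates vanish at both.
    have hγH : γ ∈ Q.H := Q.sep γ hγ _ hu (hγu ▸ hu')
    rw [← hγu, hequi γ hγH, eq_comm] at h1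
    have h3 := (act_eq_self_iff (hgrp γ hγH).2.1.2 _).1 h1
    have h4 : V.act γ (euclid n u) = euclid n u := (act_eq_self_iff hγ.2 _).2 fun i hi =>
      h3 i fun h => hi ((hzero _ (hQO hu) i).1 h)
    exact (euclid n).injective (h4.symm.trans hγu)
  · have hd : DifferentiableAt ℝ ψ (euclid n u) :=
      (hψs.contDiffAt (hO₁.mem_nhds (hQO hu).1)).differentiableAt (by simp)
    have hder : HasFDerivAt (fun u => (euclid n).symm (ψ (euclid n u)))
        (((euclid n).symm : (Fin n → ℂ) →L[ℝ] _) ∘L (fderiv ℝ ψ (euclid n u) ∘L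
          (euclid n : _ →L[ℝ] (Fin n → ℂ)))) u :=
      (euclid n).symm.hasFDerivAt.comp u (hd.hasFDerivAt.comp u (euclid n).hasFDerivAt)
    rw [hder.fderiv]
    exact (euclid n).symm.injective.comp ((himm _ (hQO hu)).comp (euclid n).injective)
  · simp only [Patch.chart, ContinuousLinearEquiv.apply_symm_apply]
    obtain ⟨γ, hγ⟩ := γ
    rw [hequi γ hγ]
    rfl
  · simp only [Patch.chart, ContinuousLinearEquiv.apply_symm_apply]
    exact hproj _ (hQO hu)

end Vertex

variable (D) in
/-- The charts at the vertices. -/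
def stdAtlas : Set (LocalChart (2 * n) D.Reduced) := {c | ∃ (V : D.Vertex) (Q : V.Patch), c = Q.chart}

theorem exists_mem_dom (p : D.Reduced) : ∃ (V : D.Vertex) (w : Fin n → ℂ), w ∈ V.dom ∧ V.proj w = p ∧
    ∀ i, D.slack i (D.moment p) = 0 → i ∈ Set.range V.idx := by
  obtain ⟨z, rfl⟩ := D.quot_surjective p
  obtain ⟨V, hV⟩ := D.exists_vertex (D.levelMoment_mem z)
  have hz : ∀ i, i ∉ Set.range V.idx → (z : Fin D.N → ℂ) i ≠ 0 := fun i hi h => hi (hV i (by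
    rw [← norm_sq_eq, h]; simp))
  exact ⟨V, V.slice z, V.slice_mem_dom z.2 hz, V.proj_slice z.2 hz, hV⟩

/-- A small patch around a common point, taken at the first vertex, embeds in both charts. -/
theorem isOrbifoldAtlas_stdAtlas : IsOrbifoldAtlas D.stdAtlas := by
  constructor
  · intro p
    obtain ⟨V, w, hw, rfl, -⟩ := exists_mem_dom p
    refine ⟨V.fullPatch.chart, ⟨V, _, rfl⟩, (euclid n).symm w, ?_, by simp⟩
    simpa [Vertex.fullPatch] using hw
  · rintro _ ⟨V₁, Q₁, rfl⟩ _ ⟨V₂, Q₂, rfl⟩ p ⟨⟨u₁, hu₁, rfl⟩, u₂, hu₂, h12⟩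
    obtain ⟨O₁, hO₁, hw₁, h₁⟩ := Vertex.exists_embedding (V := V₁) Q₁ (Q₁.subset hu₁) hu₁ rfl
    obtain ⟨O₂, hO₂, hw₂, h₂⟩ := Vertex.exists_embedding (V := V₁) Q₂ (Q₁.subset hu₁) hu₂ h12.symm
    obtain ⟨Q, hQO, hwQ, hQH⟩ := Vertex.exists_small_patch (Q₁.subset hu₁) (hO₁.inter hO₂) ⟨hw₁, hw₂⟩
    obtain ⟨φ₁⟩ := h₁ Q (fun z hz => (hQO hz).1) hQH
    obtain ⟨φ₂⟩ := h₂ Q (fun z hz => (hQO hz).2) hQH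
    refine ⟨Q.chart, ⟨V₁, Q, rfl⟩, ⟨u₁, hwQ, rfl⟩, ?_, ⟨φ₁⟩, ⟨φ₂⟩⟩
    rintro _ ⟨u, hu, rfl⟩
    refine ⟨?_, ?_⟩
    · rw [← Q₁.chart.proj_image]
      exact ⟨φ₁.toFun u, φ₁.mapsTo hu, φ₁.proj_comp u hu⟩
    · rw [← Q₂.chart.proj_image]
      exact ⟨φ₂.toFun u, φ₂.mapsTo hu, φ₂.proj_comp u hu⟩

end FacetPresentation

/-! ### Charts of orbifolds and their groups -/

theorem injective_fderiv_of_leftInverse {E F : Type*} [NormedAddCommGroup E] [NormedSpace ℝ E]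
    [NormedAddCommGroup F] [NormedSpace ℝ F] {f : E → F} {g : F → E} {u : E}
    (hf : DifferentiableAt ℝ f u) (hg : DifferentiableAt ℝ g (f u))
    (h : ∀ᶠ x in nhds u, g (f x) = x) : Function.Injective (fderiv ℝ f u) := by
  have h1 : HasFDerivAt (fun x => g (f x)) (fderiv ℝ g (f u) ∘L fderiv ℝ f u) u :=
    hg.hasFDerivAt.comp u hf.hasFDerivAt
  have h2 := (h1.congr_of_eventuallyEq (h.mono fun x hx => hx.symm)).unique (hasFDerivAt_id u)
  refine Function.LeftInverse.injective (g := fderiv ℝ g (f u)) fun v => ?_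
  exact congrArg (fun L : E →L[ℝ] E => L v) h2

variable {d : ℕ} {X : Type} [TopologicalSpace X]

namespace LocalChart

variable (c : LocalChart d X) {u : EuclideanSpace ℝ (Fin d)}

theorem act_inv_act (γ : c.Γ) (hu : u ∈ c.dom) : c.act γ⁻¹ (c.act γ u) = u := by
  rw [← c.act_mul _ _ u hu, inv_mul_cancel, c.act_one u hu]

theorem proj_act (γ : c.Γ) (hu : u ∈ c.dom) : c.proj (c.act γ u) = c.proj u :=
  ((c.proj_eq_iff u hu _ (c.act_mapsTo γ hu)).2 ⟨γ, rfl⟩).symm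

theorem contDiffAt_act (γ : c.Γ) (hu : u ∈ c.dom) : ContDiffAt ℝ ∞ (c.act γ) u :=
  (c.act_smooth γ).contDiffAt (c.isOpen_dom.mem_nhds hu)

theorem fderiv_act_injective (γ : c.Γ) (hu : u ∈ c.dom) :
    Function.Injective (fderiv ℝ (c.act γ) u) := by
  refine injective_fderiv_of_leftInverse (g := c.act γ⁻¹)
    ((c.contDiffAt_act γ hu).differentiableAt (by simp))
    ((c.contDiffAt_act γ⁻¹ (c.act_mapsTo γ hu)).differentiableAt (by simp)) ?_
  filter_upwards [c.isOpen_dom.mem_nhds hu] with x hx using c.act_inv_act γ hx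

/-- The elements of the group of a chart that fix all points of a set. -/
def fixing (O : Set (EuclideanSpace ℝ (Fin d))) (hO : O ⊆ c.dom) : Subgroup c.Γ where
  carrier := {γ | ∀ u ∈ O, c.act γ u = u}
  one_mem' := fun u hu => c.act_one u (hO hu)
  mul_mem' := fun {γ δ} hγ hδ u hu => by rw [c.act_mul _ _ u (hO hu), hδ u hu, hγ u hu]
  inv_mem' := fun {γ} hγ u hu => by
    conv_lhs => rw [← hγ u hu]
    exact c.act_inv_act γ (hO hu)

/-- An element of the group of a chart that fixes an open set is trivial. -/
theorem eq_one_of_fixes_open {O : Set (EuclideanSpace ℝ (Fin d))} (hO : IsOpen O) (hOd : O ⊆ c.dom)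
    (hne : O.Nonempty) {γ : c.Γ} (hγ : ∀ u ∈ O, c.act γ u = u) : γ = 1 := by
  classical
  let F := c.fixing O hOd
  have : Fintype F := Fintype.ofFinite F
  -- The plan is to show that `S` is relatively closed in the connected set `dom`; effectiveness
  -- then finishes.
  set S := interior {u | u ∈ c.dom ∧ ∀ δ : F, c.act δ u = u} with hS
  have hSd : S ⊆ c.dom := fun u hu => (interior_subset hu).1
  have hOS : O ⊆ S := interior_maximal (fun u hu => ⟨hOd hu, fun δ => δ.2 u hu⟩) hO
  have hcl : closure S ∩ c.dom ⊆ S := by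
    rintro u ⟨hu, hud⟩
    have hne' : (nhdsWithin u S).NeBot := mem_closure_iff_nhdsWithin_neBot.1 hu
    have hfix : ∀ δ : F, c.act δ u = u := fun δ => by
      have h1 := ((c.contDiffAt_act δ.1 hud).continuousAt.tendsto.mono_left
        (nhdsWithin_le_nhds (s := S)))
      refine tendsto_nhds_unique (h1.congr' ?_) (nhdsWithin_le_nhds (s := S))
      filter_upwards [self_mem_nhdsWithin] with x hx using (interior_subset hx).2 δ
    have hder : ∀ δ : F, fderiv ℝ (c.act δ) u = ContinuousLinearMap.id ℝ _ := fun δ => by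
      have h0 : ContinuousAt (fderiv ℝ (c.act δ)) u :=
        ((c.act_smooth δ).continuousOn_fderiv_of_isOpen c.isOpen_dom (by simp)).continuousAt
          (c.isOpen_dom.mem_nhds hud)
      have h1 := h0.tendsto.mono_left (nhdsWithin_le_nhds (s := S))
      refine tendsto_nhds_unique h1 (Filter.Tendsto.congr' ?_ tendsto_const_nhds)
      filter_upwards [self_mem_nhdsWithin] with x hx
      have h2 : c.act δ =ᶠ[nhds x] id := by
        filter_upwards [isOpen_interior.mem_nhds hx] with y hy using (interior_subset hy).2 δ
      rw [h2.fderiv_eq, fderiv_id]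
    -- At a boundary point every `δ` in `F` has derivative `1`, so this sum has an invertible
    -- derivative and is locally injective. It is invariant under `F`, so each `δ` is the identity
    -- nearby.
    let h : EuclideanSpace ℝ (Fin d) → EuclideanSpace ℝ (Fin d) := fun x => ∑ δ : F, c.act δ x
    have hh : ContDiffAt ℝ ∞ h u := ContDiffAt.sum fun δ _ => c.contDiffAt_act δ.1 hud
    have hhd : HasFDerivAt h (∑ δ : F, fderiv ℝ (c.act δ) u) u := HasFDerivAt.fun_sum fun δ _ =>
      ((c.contDiffAt_act δ.1 hud).differentiableAt (by simp)).hasFDerivAt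
    have hinj : Function.Injective (fderiv ℝ h u) := by
      rw [hhd.fderiv]
      simp only [hder, Finset.sum_const, Finset.card_univ]
      intro v w hvw
      have h1 : (Fintype.card F : ℝ) • v = (Fintype.card F : ℝ) • w := by
        simpa [← Nat.cast_smul_eq_nsmul ℝ] using hvw
      exact smul_right_injective _ (by exact_mod_cast Fintype.card_ne_zero) h1
    obtain ⟨e, he, -⟩ := exists_hasStrictFDerivAt_equiv hh hinj
    have hleft := he.eventually_left_inverse
    have hall : ∀ᶠ x in nhds u, ∀ δ : F, he.localInverse h e u (h (c.act δ x)) = c.act δ x := by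
      rw [Filter.eventually_all]
      intro δ
      have h1 := (c.contDiffAt_act δ.1 hud).continuousAt.tendsto
      rw [hfix δ] at h1
      exact h1.eventually hleft
    refine mem_interior_iff_mem_nhds.2 ?_
    filter_upwards [hleft, hall, c.isOpen_dom.mem_nhds hud] with x hx hxa hxd
    refine ⟨hxd, fun δ => ?_⟩
    have hinv : h (c.act δ x) = h x := by
      change ∑ ε : F, c.act ε (c.act δ x) = ∑ ε : F, c.act ε x
      refine Fintype.sum_equiv (Equiv.mulRight δ) _ _ fun ε => ?_
      rw [← c.act_mul _ _ x hxd]; rfl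
    rw [← hxa δ, hinv, hx]
  have hsub := c.isConnected_dom.isPreconnected.subset_of_closure_inter_subset isOpen_interior
    (by obtain ⟨u, hu⟩ := hne; exact ⟨u, hOd hu, hOS hu⟩) hcl
  exact c.act_effective γ fun u hu => (interior_subset (hsub hu)).2 ⟨γ, hγ⟩

end LocalChart

/-! ### Embeddings of charts and their group homomorphisms -/

namespace ChartEmbedding

variable {c c' : LocalChart d X} (φ : ChartEmbedding c c')

theorem isOpen_image : IsOpen (φ.toFun '' c.dom) :=
  isOpen_image_of_immersion c.isOpen_dom φ.smooth φ.immersion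

theorem contDiffAt {u : EuclideanSpace ℝ (Fin d)} (hu : u ∈ c.dom) : ContDiffAt ℝ ∞ φ.toFun u :=
  φ.smooth.contDiffAt (c.isOpen_dom.mem_nhds hu)

/-- The composition of an embedding with an element of the group of the target. -/
def translate (g : c'.Γ) : ChartEmbedding c c' where
  toFun u := c'.act g (φ.toFun u)
  hom := (MulAut.conj g).toMonoidHom.comp φ.hom
  mapsTo u hu := c'.act_mapsTo g (φ.mapsTo hu)
  smooth := (c'.act_smooth g).comp φ.smooth φ.mapsTo
  injOn u hu v hv h := by
    refine φ.injOn hu hv ?_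
    rw [← c'.act_inv_act g (φ.mapsTo hu), ← c'.act_inv_act g (φ.mapsTo hv)]
    exact congrArg _ h
  immersion u hu := by
    have h := ((c'.contDiffAt_act g (φ.mapsTo hu)).differentiableAt (by simp)).hasFDerivAt.comp u
      ((φ.contDiffAt hu).differentiableAt (by simp)).hasFDerivAt
    have h2 : fderiv ℝ (fun u => c'.act g (φ.toFun u)) u = _ := h.fderiv
    rw [h2]
    exact (c'.fderiv_act_injective g (φ.mapsTo hu)).comp (φ.immersion u hu)
  equivariant γ u hu := by
    have h1 := φ.mapsTo hu
    rw [φ.equivariant γ u hu, ← c'.act_mul _ _ _ h1, ← c'.act_mul _ _ _ h1]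
    simp
  proj_comp u hu := by rw [c'.proj_act g (φ.mapsTo hu), φ.proj_comp u hu]

theorem exists_through (φ : ChartEmbedding c c') {u₀ : EuclideanSpace ℝ (Fin d)} (hu₀ : u₀ ∈ c'.dom) (h : c'.proj u₀ ∈ c.U) :
    ∃ φ' : ChartEmbedding c c', ∃ u ∈ c.dom, φ'.toFun u = u₀ := by
  obtain ⟨u, hu, he⟩ := c.proj_image ▸ h
  rw [← φ.proj_comp u hu, c'.proj_eq_iff _ (φ.mapsTo hu) _ hu₀] at he
  obtain ⟨g, hg⟩ := he
  exact ⟨φ.translate g, u, hu, hg⟩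

theorem hom_injective : Function.Injective φ.hom := by
  rw [injective_iff_map_eq_one]
  intro γ hγ
  refine c.act_effective γ fun u hu => φ.injOn (c.act_mapsTo γ hu) hu ?_
  rw [φ.equivariant γ u hu, hγ, c'.act_one _ (φ.mapsTo hu)]

/-- An element `g` of the target group fixes the only point over `p`. Nearby, `g` agrees at each
point with the image of some `γ`; by Baire a single `γ` works on a nonempty open set, and elements
that agree on an open set are equal. -/
theorem hom_surjective {p : X} (hp : p ∈ c.U) (hgood : c'.IsGoodAt p) :
    Function.Surjective φ.hom := by
  intro g
  obtain ⟨u₀, hu₀⟩ := hgood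
  rw [← c.proj_image] at hp
  obtain ⟨u, hu, rfl⟩ := hp
  have huniq : ∀ v ∈ c'.dom, c'.proj v = c.proj u → v = u₀ := fun v hv h => by
    have : v ∈ {v ∈ c'.dom | c'.proj v = c.proj u} := ⟨hv, h⟩
    rwa [hu₀] at this
  have h0 : φ.toFun u = u₀ := huniq _ (φ.mapsTo hu) (φ.proj_comp u hu)
  have hg : c'.act g (φ.toFun u) = φ.toFun u := by
    rw [h0]
    refine huniq _ (c'.act_mapsTo g (h0 ▸ φ.mapsTo hu)) ?_
    rw [c'.proj_act g (h0 ▸ φ.mapsTo hu), ← h0, φ.proj_comp u hu]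
  have hsub : φ.toFun '' c.dom ⊆ c'.dom := Set.image_subset_iff.2 φ.mapsTo
  set O := φ.toFun '' c.dom ∩ c'.act g ⁻¹' (φ.toFun '' c.dom) with hO
  have hOo : IsOpen O :=
    ((c'.act_smooth g).continuousOn.mono hsub).isOpen_inter_preimage φ.isOpen_image φ.isOpen_image
  have hOd : O ⊆ c'.dom := fun x hx => hsub hx.1
  have hu₀O : φ.toFun u ∈ O := ⟨⟨u, hu, rfl⟩, by rw [Set.mem_preimage, hg]; exact ⟨u, hu, rfl⟩⟩
  have : Nonempty O := ⟨⟨_, hu₀O⟩⟩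
  have : BaireSpace O := hOo.baireSpace
  have hcont : ∀ δ : c'.Γ, Continuous fun x : O => c'.act δ x := fun δ =>
    continuousOn_iff_continuous_domRestrict.1 ((c'.act_smooth δ).continuousOn.mono hOd)
  -- `O` is a finite union of the closed sets on which `g` agrees with `φ.hom γ`.
  obtain ⟨γ, y, hy⟩ := nonempty_interior_of_iUnion_of_closed
    (f := fun γ : c.Γ => {x : O | c'.act g x = c'.act (φ.hom γ) x})
    (fun γ => isClosed_eq (hcont _) (hcont _)) (by
      rw [Set.eq_univ_iff_forall]
      rintro ⟨x, ⟨a, ha, rfl⟩, b, hb, hab⟩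
      have hab' : c.proj a = c.proj b := by
        rw [← φ.proj_comp a ha, ← φ.proj_comp b hb, hab, c'.proj_act g (φ.mapsTo ha)]
      obtain ⟨γ, hγ⟩ := (c.proj_eq_iff a ha b hb).1 hab'
      refine Set.mem_iUnion.2 ⟨γ, ?_⟩
      change c'.act g (φ.toFun a) = c'.act (φ.hom γ) (φ.toFun a)
      rw [← φ.equivariant γ a ha, hγ, hab])
  refine ⟨γ, ?_⟩
  set T : Set O := interior {x : O | c'.act g x = c'.act (φ.hom γ) x} with hT
  have hTo : IsOpen (Subtype.val '' T) := hOo.isOpenEmbedding_subtypeVal.isOpenMap _ isOpen_interior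
  have hone : g⁻¹ * φ.hom γ = 1 := by
    refine c'.eq_one_of_fixes_open hTo ?_ ⟨y, y, hy, rfl⟩ ?_
    · rintro _ ⟨x, -, rfl⟩; exact hOd x.2
    · rintro _ ⟨x, hx, rfl⟩
      have h1 : c'.act g x = c'.act (φ.hom γ) x :=
        interior_subset (s := {x : O | c'.act g x = c'.act (φ.hom γ) x}) hx
      rw [c'.act_mul _ _ _ (hOd x.2), ← h1, c'.act_inv_act g (hOd x.2)]
  rw [inv_mul_eq_one] at hone
  exact hone.symm

theorem nonempty_mulEquiv (φ : ChartEmbedding c c') {p : X} (hp : p ∈ c.U) (hgood : c'.IsGoodAt p) :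
    Nonempty (c.Γ ≃* c'.Γ) :=
  ⟨MulEquiv.ofBijective φ.hom ⟨φ.hom_injective, φ.hom_surjective hp hgood⟩⟩

end ChartEmbedding

theorem LocalChart.IsGoodAt.mem_U {c : LocalChart d X} {p : X} (h : c.IsGoodAt p) : p ∈ c.U := by
  obtain ⟨u, hu⟩ := h
  have h1 : u ∈ {v ∈ c.dom | c.proj v = p} := hu ▸ rfl
  rw [← c.proj_image]
  exact ⟨u, h1.1, h1.2⟩

/-- The groups of good charts around a point are isomorphic. -/
theorem IsOrbifoldAtlas.nonempty_mulEquiv {A : Set (LocalChart d X)} (hA : IsOrbifoldAtlas A)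
    {c c' : LocalChart d X} (hc : c ∈ A) (hc' : c' ∈ A) {p : X} (h : c.IsGoodAt p)
    (h' : c'.IsGoodAt p) : Nonempty (c.Γ ≃* c'.Γ) := by
  obtain ⟨c₃, -, hp, -, ⟨φ⟩, ⟨φ'⟩⟩ := hA.2 c hc c' hc' p ⟨h.mem_U, h'.mem_U⟩
  obtain ⟨e⟩ := φ.nonempty_mulEquiv hp h
  obtain ⟨e'⟩ := φ'.nonempty_mulEquiv hp h'
  exact ⟨e.symm.trans e'⟩

theorem SmoothOrbifold.hasStructureGroup_of_chart {M : SmoothOrbifold d} {c : LocalChart d M.carrier}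
    (hc : c ∈ M.charts) {p : M.carrier} (hp : c.IsGoodAt p) {G : Type} [Group G] (e : c.Γ ≃* G) :
    M.HasStructureGroup p G :=
  ⟨⟨c, hc, hp⟩, fun _ hc' hp' =>
    let ⟨e'⟩ := M.maximal.prop.nonempty_mulEquiv hc' hc hp' hp
    ⟨e'.trans e⟩⟩

/-- Every orbifold atlas is contained in a maximal one. -/
theorem IsOrbifoldAtlas.exists_maximal {A : Set (LocalChart d X)} (hA : IsOrbifoldAtlas A) :
    ∃ B, A ⊆ B ∧ Maximal IsOrbifoldAtlas B := by
  refine zorn_subset_nonempty {B | IsOrbifoldAtlas B} (fun C hC hchain hne => ?_) A hA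
  refine ⟨⋃₀ C, ⟨fun p => ?_, ?_⟩, fun s hs => Set.subset_sUnion_of_mem hs⟩
  · obtain ⟨B, hB⟩ := hne
    obtain ⟨c, hc, hp⟩ := (hC hB).1 p
    exact ⟨c, ⟨B, hB, hc⟩, hp⟩
  · rintro c₁ ⟨B₁, hB₁, hc₁⟩ c₂ ⟨B₂, hB₂, hc₂⟩ p hp
    have key : ∃ B ∈ C, c₁ ∈ B ∧ c₂ ∈ B := by
      rcases hchain.total hB₁ hB₂ with h | h
      · exact ⟨B₂, hB₂, h hc₁, hc₂⟩
      · exact ⟨B₁, hB₁, hc₁, h hc₂⟩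
    obtain ⟨B, hB, h₁, h₂⟩ := key
    obtain ⟨c₃, hc₃, h⟩ := (hC hB).2 c₁ h₁ c₂ h₂ p hp
    exact ⟨c₃, ⟨B, hB, hc₃⟩, h⟩

namespace FacetPresentation

variable {n : ℕ} {P : LabeledPolyhedron n} (D : FacetPresentation P)

/-! ### The reduced space as an orbifold -/

/-- A maximal atlas that contains the charts at the vertices. -/
def atlas : Set (LocalChart (2 * n) D.Reduced) :=
  (isOrbifoldAtlas_stdAtlas (D := D)).exists_maximal.choose

theorem stdAtlas_subset : D.stdAtlas ⊆ D.atlas :=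
  (isOrbifoldAtlas_stdAtlas (D := D)).exists_maximal.choose_spec.1

theorem maximal_atlas : Maximal IsOrbifoldAtlas D.atlas :=
  (isOrbifoldAtlas_stdAtlas (D := D)).exists_maximal.choose_spec.2

variable {D}

theorem Vertex.Patch.chart_mem {V : D.Vertex} (Q : V.Patch) : Q.chart ∈ D.atlas :=
  D.stdAtlas_subset ⟨V, Q, rfl⟩

/-- A diffeomorphism of a neighbourhood of `u₀` in a chart to an open set in the coordinates at a
vertex. -/
structure Coordinates (c : LocalChart (2 * n) D.Reduced) (u₀ : EuclideanSpace ℝ (Fin (2 * n))) where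
  V : D.Vertex
  W : Set (EuclideanSpace ℝ (Fin (2 * n)))
  toFun : EuclideanSpace ℝ (Fin (2 * n)) → Fin n → ℂ
  inv : (Fin n → ℂ) → EuclideanSpace ℝ (Fin (2 * n))
  isOpen : IsOpen W
  mem : u₀ ∈ W
  subset : W ⊆ c.dom
  isOpen_image : IsOpen (toFun '' W)
  smooth : ContDiffOn ℝ ∞ toFun W
  smooth_inv : ContDiffOn ℝ ∞ inv (toFun '' W)
  left_inv : ∀ u ∈ W, inv (toFun u) = u
  mapsTo : Set.MapsTo toFun W V.dom
  proj_toFun : ∀ u ∈ W, V.proj (toFun u) = c.proj u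

/-- A common refinement embeds in `c` and in a vertex chart. After a translation by the group of `c`
its image contains `u₀`, and one embedding is composed with the inverse of the other. -/
theorem nonempty_coordinates {c : LocalChart (2 * n) D.Reduced} (hc : c ∈ D.atlas)
    {u₀ : EuclideanSpace ℝ (Fin (2 * n))} (hu₀ : u₀ ∈ c.dom) : Nonempty (Coordinates c u₀) := by
  obtain ⟨V, w, hw, hp, -⟩ := exists_mem_dom (c.proj u₀)
  have hmem : c.proj u₀ ∈ c.U ∩ V.fullPatch.chart.U := by
    refine ⟨c.proj_image ▸ ⟨u₀, hu₀, rfl⟩, (euclid n).symm w, ?_, by simpa using hp⟩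
    simpa [Vertex.fullPatch] using hw
  obtain ⟨c₃, -, hp₃, -, ⟨φ₁⟩, ⟨φ₂⟩⟩ :=
    D.maximal_atlas.prop.2 c hc _ V.fullPatch.chart_mem _ hmem
  obtain ⟨θ, u₃, hu₃, hθ⟩ := φ₁.exists_through hu₀ hp₃
  obtain ⟨ρ₁, hρ₁, hρ₁'⟩ := exists_smooth_inverse c₃.isOpen_dom θ.smooth θ.injOn θ.immersion
  obtain ⟨ρ₂, hρ₂, hρ₂'⟩ := exists_smooth_inverse c₃.isOpen_dom φ₂.smooth φ₂.injOn φ₂.immersion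
  have himg : (fun u => euclid n (φ₂.toFun (ρ₁ u))) '' (θ.toFun '' c₃.dom) =
      euclid n '' (φ₂.toFun '' c₃.dom) := by
    rw [Set.image_image, Set.image_image]
    exact Set.image_congr fun u hu => by rw [hρ₁' u hu]
  refine ⟨⟨V, θ.toFun '' c₃.dom, fun u => euclid n (φ₂.toFun (ρ₁ u)),
    fun z => θ.toFun (ρ₂ ((euclid n).symm z)), θ.isOpen_image, ⟨u₃, hu₃, hθ⟩,
    Set.image_subset_iff.2 θ.mapsTo, ?_, ?_, ?_, ?_, ?_, ?_⟩⟩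
  · rw [himg]
    exact (euclid n).toHomeomorph.isOpenMap _ φ₂.isOpen_image
  · refine (euclid n).contDiff.comp_contDiffOn (φ₂.smooth.comp hρ₁ ?_)
    rintro _ ⟨u, hu, rfl⟩
    rwa [hρ₁' u hu]
  · rw [himg]
    refine θ.smooth.comp (hρ₂.comp (euclid n).symm.contDiff.contDiffOn ?_) ?_
    · rintro _ ⟨u, hu, rfl⟩
      simpa using hu
    · rintro _ ⟨_, ⟨u, hu, rfl⟩, rfl⟩
      simpa [hρ₂' u hu] using hu
  · rintro _ ⟨u, hu, rfl⟩
    simp [hρ₁' u hu, hρ₂' u hu]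
  · rintro _ ⟨u, hu, rfl⟩
    simp only [hρ₁' u hu]
    exact φ₂.mapsTo hu
  · rintro _ ⟨u, hu, rfl⟩
    simp only [hρ₁' u hu]
    rw [θ.proj_comp u hu]
    exact φ₂.proj_comp u hu

/-! ### Lifts and derivatives in the coordinates at a vertex -/

namespace Coordinates

variable {c : LocalChart (2 * n) D.Reduced} {u₀ : EuclideanSpace ℝ (Fin (2 * n))}
  (T : Coordinates c u₀)

theorem isLift : D.IsLift T.W (fun u => T.V.sec (T.toFun u)) c.proj where
  isOpen := T.isOpen
  smooth := T.V.contDiffOn_sec.comp T.smooth T.mapsTo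
  spec u hu := ⟨T.V.sec_mem (T.mapsTo hu), by
    rw [← T.V.proj_eq (T.mapsTo hu), T.proj_toFun u hu]⟩

theorem contDiffAt : ContDiffAt ℝ ∞ T.toFun u₀ := T.smooth.contDiffAt (T.isOpen.mem_nhds T.mem)

theorem hasFDerivAt : HasFDerivAt T.toFun (fderiv ℝ T.toFun u₀) u₀ :=
  (T.contDiffAt.differentiableAt (by simp)).hasFDerivAt

theorem contDiffAt_inv : ContDiffAt ℝ ∞ T.inv (T.toFun u₀) :=
  T.smooth_inv.contDiffAt (T.isOpen_image.mem_nhds ⟨u₀, T.mem, rfl⟩)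

theorem hasFDerivAt_inv : HasFDerivAt T.inv (fderiv ℝ T.inv (T.toFun u₀)) (T.toFun u₀) :=
  (T.contDiffAt_inv.differentiableAt (by simp)).hasFDerivAt

theorem inv_mem {z : Fin n → ℂ} (hz : z ∈ T.toFun '' T.W) : T.inv z ∈ T.W := by
  obtain ⟨u, hu, rfl⟩ := hz
  rwa [T.left_inv u hu]

theorem right_inv {z : Fin n → ℂ} (hz : z ∈ T.toFun '' T.W) : T.toFun (T.inv z) = z := by
  obtain ⟨u, hu, rfl⟩ := hz
  rw [T.left_inv u hu]

theorem fderiv_inv_apply (v : EuclideanSpace ℝ (Fin (2 * n))) :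
    fderiv ℝ T.inv (T.toFun u₀) (fderiv ℝ T.toFun u₀ v) = v := by
  have h1 := T.hasFDerivAt_inv.comp u₀ T.hasFDerivAt
  have h2 : T.inv ∘ T.toFun =ᶠ[nhds u₀] id := by
    filter_upwards [T.isOpen.mem_nhds T.mem] with u hu using T.left_inv u hu
  exact congrArg (fun L : EuclideanSpace ℝ (Fin (2 * n)) →L[ℝ] _ => L v)
    ((h1.congr_of_eventuallyEq h2.symm).unique (hasFDerivAt_id u₀))

theorem fderiv_apply_inv (v : Fin n → ℂ) :
    fderiv ℝ T.toFun u₀ (fderiv ℝ T.inv (T.toFun u₀) v) = v := by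
  have h0 : HasFDerivAt T.toFun (fderiv ℝ T.toFun u₀) (T.inv (T.toFun u₀)) := by
    rw [T.left_inv u₀ T.mem]; exact T.hasFDerivAt
  have h1 := h0.comp (T.toFun u₀) T.hasFDerivAt_inv
  have h2 : T.toFun ∘ T.inv =ᶠ[nhds (T.toFun u₀)] id := by
    filter_upwards [T.isOpen_image.mem_nhds ⟨u₀, T.mem, rfl⟩] with z hz using T.right_inv hz
  exact congrArg (fun L : (Fin n → ℂ) →L[ℝ] _ => L v)
    ((h1.congr_of_eventuallyEq h2.symm).unique (hasFDerivAt_id _))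

theorem fderiv_sec_comp (v : EuclideanSpace ℝ (Fin (2 * n))) :
    fderiv ℝ (fun u => T.V.sec (T.toFun u)) u₀ v =
      fderiv ℝ T.V.sec (T.toFun u₀) (fderiv ℝ T.toFun u₀ v) := by
  have h := (T.V.isLift_sec.differentiableAt (T.mapsTo T.mem)).hasFDerivAt.comp u₀ T.hasFDerivAt
  exact congrArg (fun L : EuclideanSpace ℝ (Fin (2 * n)) →L[ℝ] _ => L v) h.fderiv

theorem pull_eq (v w : EuclideanSpace ℝ (Fin (2 * n))) :
    D.pull (fun u => T.V.sec (T.toFun u)) u₀ ![v, w] =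
      D.pull T.V.sec (T.toFun u₀) ![fderiv ℝ T.toFun u₀ v, fderiv ℝ T.toFun u₀ w] := by
  rw [pull_apply, pull_apply, T.fderiv_sec_comp, T.fderiv_sec_comp]

end Coordinates

theorem mem_closure_isPrincipal {c : LocalChart (2 * n) D.Reduced} (hc : c ∈ D.atlas)
    {u : EuclideanSpace ℝ (Fin (2 * n))} (hu : u ∈ c.dom) :
    u ∈ closure {u | D.IsPrincipal (c.proj u)} := by
  obtain ⟨T⟩ := nonempty_coordinates hc hu
  have h1 := T.V.mem_closure_isPrincipal (T.mapsTo T.mem)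
  have h2 : T.toFun u ∈ closure (T.toFun '' T.W ∩ {z | D.IsPrincipal (T.V.proj z)}) :=
    T.isOpen_image.inter_closure ⟨⟨u, T.mem, rfl⟩, h1⟩
  have h3 := mem_closure_image T.contDiffAt_inv.continuousAt h2
  rw [T.left_inv u T.mem] at h3
  refine closure_mono ?_ h3
  rintro _ ⟨_, ⟨⟨x, hx, rfl⟩, hp⟩, rfl⟩
  rw [Set.mem_ofPred_eq, T.proj_toFun x hx] at hp
  rw [T.left_inv x hx]
  exact hp

/-! ### The symplectic form -/

open Classical in
variable (D) in
/-- The reduced symplectic form at a point of a chart. -/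
def formAt (c : LocalChart (2 * n) D.Reduced) (u : EuclideanSpace ℝ (Fin (2 * n))) :
    EuclideanSpace ℝ (Fin (2 * n)) [⋀^Fin 2]→L[ℝ] ℝ :=
  if h : ∃ (s : EuclideanSpace ℝ (Fin (2 * n)) → Fin D.N → ℂ)
      (W : Set (EuclideanSpace ℝ (Fin (2 * n)))), u ∈ W ∧ D.IsLift W s c.proj
  -- On charts of the atlas a lift always exists, so `0` is never used there.
  then D.pull h.choose u else 0

theorem formAt_eq {c : LocalChart (2 * n) D.Reduced} (hc : c ∈ D.atlas)
    {u : EuclideanSpace ℝ (Fin (2 * n))} (hu : u ∈ c.dom) {W : Set (EuclideanSpace ℝ (Fin (2 * n)))}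
    {s : EuclideanSpace ℝ (Fin (2 * n)) → Fin D.N → ℂ} (hs : D.IsLift W s c.proj) (huW : u ∈ W) :
    D.formAt c u = D.pull s u := by
  have h : ∃ (s : EuclideanSpace ℝ (Fin (2 * n)) → Fin D.N → ℂ)
      (W : Set (EuclideanSpace ℝ (Fin (2 * n)))), u ∈ W ∧ D.IsLift W s c.proj := ⟨s, W, huW, hs⟩
  rw [formAt, dif_pos h]
  obtain ⟨W', huW', hs'⟩ := h.choose_spec
  exact (hs'.mono (hs'.isOpen.inter hs.isOpen) Set.inter_subset_left).pull_eq
    (hs.mono (hs'.isOpen.inter hs.isOpen) Set.inter_subset_right) ⟨huW', huW⟩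
    (mem_closure_isPrincipal hc hu)

theorem Coordinates.formAt_eq {c : LocalChart (2 * n) D.Reduced} (hc : c ∈ D.atlas)
    {u₀ : EuclideanSpace ℝ (Fin (2 * n))} (T : Coordinates c u₀) {u : EuclideanSpace ℝ (Fin (2 * n))}
    (hu : u ∈ T.W) : D.formAt c u = D.pull (fun u => T.V.sec (T.toFun u)) u :=
  FacetPresentation.formAt_eq hc (T.subset hu) T.isLift hu

theorem formAt_eventuallyEq {c : LocalChart (2 * n) D.Reduced} (hc : c ∈ D.atlas)
    {u₀ : EuclideanSpace ℝ (Fin (2 * n))} (T : Coordinates c u₀) :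
    D.formAt c =ᶠ[nhds u₀] D.pull (fun u => T.V.sec (T.toFun u)) := by
  filter_upwards [T.isOpen.mem_nhds T.mem] with u hu using T.formAt_eq hc hu

theorem contDiffOn_formAt {c : LocalChart (2 * n) D.Reduced} (hc : c ∈ D.atlas) :
    ContDiffOn ℝ ∞ (D.formAt c) c.dom := by
  intro u hu
  obtain ⟨T⟩ := nonempty_coordinates hc hu
  refine ContDiffAt.contDiffWithinAt (ContDiffAt.congr_of_eventuallyEq ?_ (formAt_eventuallyEq hc T))
  exact (D.contDiffOn_pull T.isOpen T.isLift.smooth).contDiffAt (T.isOpen.mem_nhds T.mem)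

theorem extDeriv_formAt {c : LocalChart (2 * n) D.Reduced} (hc : c ∈ D.atlas)
    {u : EuclideanSpace ℝ (Fin (2 * n))} (hu : u ∈ c.dom) : extDeriv (D.formAt c) u = 0 := by
  obtain ⟨T⟩ := nonempty_coordinates hc hu
  rw [(formAt_eventuallyEq hc T).extDeriv_eq]
  exact extDeriv_pullback_const D.stdTwoForm (T.isLift.smooth.contDiffAt (T.isOpen.mem_nhds T.mem))

theorem formAt_nondegenerate {c : LocalChart (2 * n) D.Reduced} (hc : c ∈ D.atlas)
    {u : EuclideanSpace ℝ (Fin (2 * n))} (hu : u ∈ c.dom) {v : EuclideanSpace ℝ (Fin (2 * n))}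
    (hv : ∀ w, D.formAt c u ![v, w] = 0) : v = 0 := by
  obtain ⟨T⟩ := nonempty_coordinates hc hu
  have h : fderiv ℝ T.toFun u v = 0 := by
    refine T.V.pull_sec_nondegenerate (T.mapsTo T.mem) fun w => ?_
    rw [← hv (fderiv ℝ T.inv (T.toFun u) w), T.formAt_eq hc T.mem, T.pull_eq, T.fderiv_apply_inv]
  rw [← T.fderiv_inv_apply v, h, map_zero]

variable (D) in
/-- The rotation by an element of the torus as a continuous linear map. -/
def rotateCLM (t : Torus D.N) : (Fin D.N → ℂ) →L[ℝ] (Fin D.N → ℂ) :=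
  ContinuousLinearMap.pi fun i =>
    (ContinuousLinearMap.mul ℝ ℂ (t i : ℂ)) ∘L ContinuousLinearMap.proj i

/-- The form is preserved by all smooth local lifts of the action of an element of the torus. -/
theorem formAt_comp {c c' : LocalChart (2 * n) D.Reduced} (hc : c ∈ D.atlas) (hc' : c' ∈ D.atlas)
    (t : Torus n) {W : Set (EuclideanSpace ℝ (Fin (2 * n)))}
    {g : EuclideanSpace ℝ (Fin (2 * n)) → EuclideanSpace ℝ (Fin (2 * n))} (hW : IsOpen W)
    (hWd : W ⊆ c.dom) (hg : Set.MapsTo g W c'.dom) (hgs : ContDiffOn ℝ ∞ g W)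
    (hgp : ∀ u ∈ W, c'.proj (g u) = t • c.proj u) {u : EuclideanSpace ℝ (Fin (2 * n))} (hu : u ∈ W) :
    (D.formAt c' (g u)).compContinuousLinearMap (fderiv ℝ g u) = D.formAt c u := by
  obtain ⟨T⟩ := nonempty_coordinates hc' (hg hu)
  -- Rotating by a lift of `t⁻¹` undoes `t`: the rotated lift composed with `g` is again a lift of
  -- `c.proj`, so it computes the form on `c`. Rotations preserve the standard form.
  obtain ⟨τ, hτ⟩ := D.torusMap_surjective t⁻¹
  have hO : IsOpen (W ∩ g ⁻¹' T.W) := hgs.continuousOn.isOpen_inter_preimage hW T.isOpen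
  have hl : D.IsLift (W ∩ g ⁻¹' T.W) (fun u => D.rotate τ (T.V.sec (T.toFun (g u)))) c.proj := by
    refine ⟨hO, (contDiff_rotate τ).comp_contDiffOn
      (T.isLift.smooth.comp (hgs.mono Set.inter_subset_left) fun x hx => hx.2), fun x hx => ?_⟩
    obtain ⟨h, hq⟩ := T.isLift.spec (g x) hx.2
    refine ⟨(D.rotate_mem_levelSet_iff τ _).2 h, ?_⟩
    change D.quot (D.rot τ ⟨_, h⟩) = _
    rw [← torusMap_smul_quot, hq, hτ, hgp x hx.1, inv_smul_smul]
  rw [FacetPresentation.formAt_eq hc (hWd hu) hl ⟨hu, T.mem⟩, T.formAt_eq hc' T.mem]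
  symm
  refine D.pull_ext fun v w => ?_
  have h1 := (T.isLift.differentiableAt T.mem).hasFDerivAt.comp u
    ((hgs.contDiffAt (hW.mem_nhds hu)).differentiableAt (by simp)).hasFDerivAt
  have h2 : HasFDerivAt (D.rotate τ) (D.rotateCLM τ) (T.V.sec (T.toFun (g u))) :=
    (D.rotateCLM τ).hasFDerivAt
  have h3 : HasFDerivAt (fun u => D.rotate τ (T.V.sec (T.toFun (g u)))) (D.rotateCLM τ ∘L
      (fderiv ℝ (fun u => T.V.sec (T.toFun u)) (g u) ∘L fderiv ℝ g u)) u :=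
    HasFDerivAt.comp (g := D.rotate τ) u h2 h1
  rw [h3.fderiv]
  exact D.stdForm_rotate τ _ _

end FacetPresentation

namespace FacetPresentation

variable {n : ℕ} {P : LabeledPolyhedron n} {D : FacetPresentation P}

namespace Vertex

variable (V : D.Vertex)

/-! ### The torus action in the coordinates at a vertex -/

/-- The action of `exp ξ` in the coordinates at the vertex. -/
def flow (ξ : LieAlg n) (z : Fin n → ℂ) : Fin n → ℂ := V.act (torusExp (V.lift ξ)) z

theorem flow_apply (ξ : LieAlg n) (z : Fin n → ℂ) (k : Fin n) :
    V.flow ξ z k = Complex.exp (V.coeff ξ k * Complex.I) * z k := by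
  rw [flow, act, torusExp, lift_idx, Circle.coe_exp]

@[simp] theorem flow_mem_dom_iff (ξ : LieAlg n) {z : Fin n → ℂ} : V.flow ξ z ∈ V.dom ↔ z ∈ V.dom :=
  V.act_mem_dom_iff _

theorem proj_flow (ξ : LieAlg n) {z : Fin n → ℂ} (hz : z ∈ V.dom) :
    V.proj (V.flow ξ z) = torusExp ξ • V.proj z := by
  rw [flow, V.proj_act (fun i hi => ?_) hz, torusMap_torusExp, varpi_lift]
  rw [torusExp, V.lift_of_notMem ξ hi, Circle.exp_zero]

theorem coeff_smul (s : ℝ) (ξ : LieAlg n) (k : Fin n) : V.coeff (s • ξ) k = s * V.coeff ξ k := by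
  rw [coeff, coeff, pair_smul_right]; ring

theorem contDiff_coeff (k : Fin n) : ContDiff ℝ ∞ fun ξ => V.coeff ξ k := by
  unfold coeff pair
  fun_prop

theorem contDiffOn_flow {E : Type*} [NormedAddCommGroup E] [NormedSpace ℝ E] {S : Set E}
    {f : E → LieAlg n} {g : E → Fin n → ℂ} (hf : ContDiffOn ℝ ∞ f S) (hg : ContDiffOn ℝ ∞ g S) :
    ContDiffOn ℝ ∞ (fun x => V.flow (f x) (g x)) S := by
  refine contDiffOn_pi.2 fun k => ?_
  simp only [flow_apply]
  refine ContDiffOn.mul (ContDiffOn.cexp (ContDiffOn.mul ?_ contDiffOn_const)) (contDiffOn_pi.1 hg k)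
  exact Complex.ofRealCLM.contDiff.comp_contDiffOn ((V.contDiff_coeff k).comp_contDiffOn hf)

@[simp] theorem flow_zero (z : Fin n → ℂ) : V.flow 0 z = z := by
  ext k; simp [flow_apply, coeff]

/-- The fundamental vector field of `ξ` in the coordinates at the vertex. -/
def field (ξ : LieAlg n) (z : Fin n → ℂ) : Fin n → ℂ := fun k => V.coeff ξ k * Complex.I * z k

theorem hasDerivAt_flow (ξ : LieAlg n) (z : Fin n → ℂ) :
    HasDerivAt (fun s : ℝ => V.flow (s • ξ) z) (V.field ξ z) 0 := by
  refine hasDerivAt_pi.2 fun k => ?_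
  simp only [flow_apply, coeff_smul]
  have h1 : HasDerivAt (fun s : ℝ => ((s * V.coeff ξ k : ℝ) : ℂ)) (V.coeff ξ k : ℂ) 0 := by
    simpa using ((hasDerivAt_id (0 : ℝ)).mul_const (V.coeff ξ k)).ofReal_comp
  simpa [field] using ((h1.mul_const Complex.I).cexp).mul_const (z k)

theorem pair_pt (z : Fin n → ℂ) (ξ : LieAlg n) :
    pair (V.pt z) ξ = pair V.point ξ + ∑ k, ‖z k‖ ^ 2 / 2 * V.coeff ξ k := by
  rw [pt, coord, pair_add_left, pair_sum_left]
  congr 1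
  refine Finset.sum_congr rfl fun k _ => ?_
  rw [pair_smul_left, coeff]; ring

theorem contDiff_pt : ContDiff ℝ ∞ V.pt := by
  unfold pt coord
  refine contDiff_const.add (ContDiff.sum fun k _ => ContDiff.fun_smul ?_ contDiff_const)
  exact (((contDiff_norm_sq ℝ).comp (contDiff_apply ℝ ℂ k)).div_const 2).div_const _

theorem hasFDerivAt_pair_pt (ξ : LieAlg n) (z : Fin n → ℂ) :
    ∃ L : (Fin n → ℂ) →L[ℝ] ℝ, HasFDerivAt (fun z => pair (V.pt z) ξ) L z ∧
      ∀ w, L w = ∑ k, V.coeff ξ k * ((z k).re * (w k).re + (z k).im * (w k).im) := by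
  have hre : ∀ k : Fin n, HasFDerivAt (fun z : Fin n → ℂ => (z k).re)
      (Complex.reCLM ∘L ContinuousLinearMap.proj (R := ℝ) k) z := fun k =>
    Complex.reCLM.hasFDerivAt.comp z (hasFDerivAt_apply k z)
  have him : ∀ k : Fin n, HasFDerivAt (fun z : Fin n → ℂ => (z k).im)
      (Complex.imCLM ∘L ContinuousLinearMap.proj (R := ℝ) k) z := fun k =>
    Complex.imCLM.hasFDerivAt.comp z (hasFDerivAt_apply k z)
  have hf : (fun z => pair (V.pt z) ξ) = fun z => pair V.point ξ +
      ∑ k, ((z k).re * (z k).re + (z k).im * (z k).im) * (V.coeff ξ k / 2) := by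
    funext z
    rw [pair_pt]
    congr 1
    refine Finset.sum_congr rfl fun k _ => ?_
    rw [Complex.sq_norm, Complex.normSq_apply]; ring
  rw [hf]
  refine ⟨_, (HasFDerivAt.fun_sum fun k _ => (((hre k).mul (hre k)).add
    ((him k).mul (him k))).mul_const (V.coeff ξ k / 2)).const_add _, fun w => ?_⟩
  simp only [sum_apply]
  refine Finset.sum_congr rfl fun k _ => ?_
  simp
  ring

theorem pull_field {z : Fin n → ℂ} (hz : z ∈ V.dom) (ξ : LieAlg n) (w : Fin n → ℂ) :
    -(D.pull V.sec z ![V.field ξ z, w]) =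
      ∑ k, V.coeff ξ k * ((z k).re * (w k).re + (z k).im * (w k).im) := by
  rw [V.pull_sec hz, ← Finset.sum_neg_distrib]
  refine Finset.sum_congr rfl fun k _ => ?_
  simp [field]
  ring

end Vertex

/-! ### The torus action on the reduced space -/

variable (D) in
/-- The reduced space as an orbifold. -/
abbrev orbifold : SmoothOrbifold (2 * n) where
  carrier := D.Reduced
  charts := D.atlas
  maximal := D.maximal_atlas

variable (D) in
theorem isSmoothAction : IsSmoothAction n D.orbifold := by
  refine ⟨inferInstanceAs (ContinuousSMul (Torus n) D.Reduced), fun t₀ x₀ => ?_⟩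
  obtain ⟨V, w, hw, hp, -⟩ := exists_mem_dom x₀
  -- With `t₀ = exp ξ₀`, the action near `t₀` is given by rotations defined on the whole vertex
  -- chart, which commute with its group.
  obtain ⟨ξ₀, rfl⟩ := torusExp_surjective t₀
  refine ⟨V.fullPatch.chart, V.fullPatch.chart_mem, V.fullPatch.chart, V.fullPatch.chart_mem,
    ⟨(euclid n).symm w, ?_, ?_⟩, ⟨(euclid n).symm (V.flow ξ₀ w), ?_, ?_⟩, Set.univ,
    fun p => (euclid n).symm (V.flow (ξ₀ + p.1) (euclid n p.2)), MonoidHom.id _, isOpen_univ,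
    Set.mem_univ _, ?_, fun ξ _ u hu => ⟨?_, ?_, fun γ => ?_⟩⟩
  · simpa [Vertex.fullPatch] using hw
  · simpa using hp
  · simpa [Vertex.fullPatch] using hw
  · simp only [ContinuousLinearEquiv.apply_symm_apply]
    rw [V.proj_flow ξ₀ hw, hp]
  · exact (euclid n).symm.contDiff.comp_contDiffOn (V.contDiffOn_flow
      (contDiff_const.add contDiff_fst).contDiffOn
      ((euclid n).contDiff.comp contDiff_snd).contDiffOn)
  · have hu' : euclid n u ∈ V.dom := hu
    simpa [Vertex.fullPatch, Vertex.Patch.chart] using hu'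
  · change V.proj (euclid n ((euclid n).symm _)) = _ • V.proj (euclid n u)
    rw [ContinuousLinearEquiv.apply_symm_apply, V.proj_flow _ hu, torusExp_add]
  · obtain ⟨γ, hγ⟩ := γ
    simp only [Vertex.Patch.chart, ContinuousLinearEquiv.apply_symm_apply]
    simp only [Vertex.flow, ← V.act_mul]
    rw [mul_comm (torusExp _) γ]
    rfl

open Classical in
variable (D) in
/-- The fundamental vector field of `ξ` in the charts. -/
def fundamentalField (ξ : LieAlg n) (c : LocalChart (2 * n) D.Reduced)
    (u : EuclideanSpace ℝ (Fin (2 * n))) : EuclideanSpace ℝ (Fin (2 * n)) :=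
  if h : Nonempty (Coordinates c u) then
    fderiv ℝ h.some.inv (h.some.toFun u) (h.some.V.field ξ (h.some.toFun u)) else 0

theorem exists_fundamentalField_eq (ξ : LieAlg n) {c : LocalChart (2 * n) D.Reduced}
    (hc : c ∈ D.atlas) {u : EuclideanSpace ℝ (Fin (2 * n))} (hu : u ∈ c.dom) :
    ∃ T : Coordinates c u, D.fundamentalField ξ c u =
      fderiv ℝ T.inv (T.toFun u) (T.V.field ξ (T.toFun u)) :=
  ⟨(nonempty_coordinates hc hu).some, dif_pos _⟩

variable (D) in
theorem isFundamentalField (ξ : LieAlg n) :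
    IsFundamentalField D.orbifold ξ (D.fundamentalField ξ) := by
  intro c hc u₀ hu₀
  obtain ⟨T, hT⟩ := exists_fundamentalField_eq ξ hc hu₀
  -- The flow is carried out in vertex coordinates. It is transported back only on a box around `(0,
  -- u₀)` where it stays in the range of the coordinates.
  set G : ℝ × EuclideanSpace ℝ (Fin (2 * n)) → Fin n → ℂ := fun p =>
    T.V.flow (p.1 • ξ) (T.toFun p.2) with hG
  have hGs : ContDiffOn ℝ ∞ G (Set.univ ×ˢ T.W) := by
    exact T.V.contDiffOn_flow (contDiff_fst.fun_smul contDiff_const).contDiffOn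
      (T.smooth.comp contDiff_snd.contDiffOn fun p hp => hp.2)
  have hO : IsOpen ((Set.univ ×ˢ T.W) ∩ G ⁻¹' (T.toFun '' T.W)) :=
    hGs.continuousOn.isOpen_inter_preimage (isOpen_univ.prod T.isOpen) T.isOpen_image
  have hmem : ((0 : ℝ), u₀) ∈ (Set.univ ×ˢ T.W) ∩ G ⁻¹' (T.toFun '' T.W) :=
    ⟨⟨Set.mem_univ _, T.mem⟩, u₀, T.mem, by simp [hG]⟩
  obtain ⟨S, hS, W, hW, hSW⟩ := mem_nhds_prod_iff.1 (hO.mem_nhds hmem)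
  obtain ⟨ε, hε, hεS⟩ := Metric.mem_nhds_iff.1 hS
  rw [Real.ball_eq_Ioo, zero_sub, zero_add] at hεS
  obtain ⟨W', hW'W, hW'o, hu₀W'⟩ := mem_nhds_iff.1 hW
  have hsub : Set.Ioo (-ε) ε ×ˢ W' ⊆ (Set.univ ×ˢ T.W) ∩ G ⁻¹' (T.toFun '' T.W) :=
    (Set.prod_mono hεS hW'W).trans hSW
  have h0 : (0 : ℝ) ∈ Set.Ioo (-ε) ε := ⟨by linarith, hε⟩
  have hW'T : W' ⊆ T.W := fun u hu => (hsub ⟨h0, hu⟩ : ((0 : ℝ), u) ∈ _).1.2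
  refine ⟨ε, W', fun p => T.inv (G p), hε, hW'o, hu₀W', hW'T.trans T.subset, ?_, fun u hu => ?_,
    fun s hs u hu => ?_, ?_⟩
  · exact T.smooth_inv.comp (hGs.mono fun p hp => (hsub hp).1) fun p hp => (hsub hp).2
  · simp [hG, T.left_inv u (hW'T hu)]
  · have h1 : G (s, u) ∈ T.toFun '' T.W := (hsub ⟨hs, hu⟩ : (s, u) ∈ _).2
    have h2 := T.inv_mem h1
    refine ⟨T.subset h2, ?_⟩
    rw [← T.proj_toFun _ h2, T.right_inv h1, ← T.proj_toFun u (hW'T hu)]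
    exact T.V.proj_flow _ (T.mapsTo (hW'T hu))
  · rw [hT]
    have h1 : T.toFun u₀ = T.V.flow ((0 : ℝ) • ξ) (T.toFun u₀) := by rw [zero_smul, T.V.flow_zero]
    exact T.hasFDerivAt_inv.comp_hasDerivAt_of_eq 0 (T.V.hasDerivAt_flow ξ (T.toFun u₀)) h1

theorem Coordinates.moment_proj {c : LocalChart (2 * n) D.Reduced}
    {u₀ u : EuclideanSpace ℝ (Fin (2 * n))} (T : Coordinates c u₀) (hu : u ∈ T.W) :
    D.moment (c.proj u) = T.V.pt (T.toFun u) := by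
  rw [← T.proj_toFun u hu, T.V.moment_proj (T.mapsTo hu)]

theorem contDiffOn_moment {c : LocalChart (2 * n) D.Reduced} (hc : c ∈ D.atlas) :
    ContDiffOn ℝ ∞ (fun u => D.moment (c.proj u)) c.dom := by
  intro u hu
  obtain ⟨T⟩ := nonempty_coordinates hc hu
  refine ContDiffAt.contDiffWithinAt (ContDiffAt.congr_of_eventuallyEq
    (T.V.contDiff_pt.contDiffAt.comp u T.contDiffAt) ?_)
  filter_upwards [T.isOpen.mem_nhds T.mem] with x hx using T.moment_proj hx

theorem moment_equation {c : LocalChart (2 * n) D.Reduced} (hc : c ∈ D.atlas) (ξ : LieAlg n)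
    {u : EuclideanSpace ℝ (Fin (2 * n))} (hu : u ∈ c.dom) (v : EuclideanSpace ℝ (Fin (2 * n))) :
    -(D.formAt c u ![D.fundamentalField ξ c u, v]) =
      fderiv ℝ (fun u => pair (D.moment (c.proj u)) ξ) u v := by
  obtain ⟨T, hT⟩ := exists_fundamentalField_eq ξ hc hu
  rw [T.formAt_eq hc T.mem, T.pull_eq, hT, T.fderiv_apply_inv, T.V.pull_field (T.mapsTo T.mem)]
  obtain ⟨L, hL, hL'⟩ := T.V.hasFDerivAt_pair_pt ξ (T.toFun u)
  have h1 : (fun u => pair (D.moment (c.proj u)) ξ) =ᶠ[nhds u]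
      (fun z => pair (T.V.pt z) ξ) ∘ T.toFun := by
    filter_upwards [T.isOpen.mem_nhds T.mem] with x hx
    rw [T.moment_proj hx]; rfl
  rw [h1.fderiv_eq, (hL.comp u T.hasFDerivAt).fderiv]
  exact (hL' _).symm

/-- At a principal point all coordinates are nonzero, so two rotations with the same effect on its
class differ by an element of `K`. -/
instance : FaithfulSMul (Torus n) D.Reduced := by
  constructor
  intro t₁ t₂ h
  obtain ⟨V⟩ := D.nonempty_vertex
  obtain ⟨z, hz, hz0⟩ := Vertex.dense_ne_zero.inter_open_nonempty V.dom V.isOpen_dom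
    ⟨0, V.zero_mem_dom⟩
  obtain ⟨τ₁, rfl⟩ := D.torusMap_surjective t₁
  obtain ⟨τ₂, rfl⟩ := D.torusMap_surjective t₂
  have hne := V.isLift_sec.ne_zero hz (V.isPrincipal_proj hz hz0)
  have h1 := h (V.proj z)
  rw [V.proj_eq hz, torusMap_smul_quot, torusMap_smul_quot, quot_eq_iff] at h1
  obtain ⟨k, hk, he⟩ := h1
  have h2 : τ₂ = k * τ₁ := by
    funext i
    have h3 : (τ₂ i : ℂ) * V.sec z i = k i * (τ₁ i * V.sec z i) :=
      congrFun (congrArg Subtype.val he) i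
    rw [← mul_assoc] at h3
    exact Circle.ext (by rw [Pi.mul_apply, Circle.coe_mul]; exact mul_right_cancel₀ (hne i) h3)
  rw [h2, torusMap_mul, hk, one_mul]

/-! ### Fixed points -/

/-- If `w k ≠ 0`, rotate the `k`-th coordinate by `π / d`, where `d`-th powers are trivial on the
local group. A local group element that undoes this rotation would give `-1 = 1` on taking `d`-th
powers. -/
theorem Vertex.eq_zero_of_fixed (V : D.Vertex) {w : Fin n → ℂ} (hw : w ∈ V.dom)
    (h : ∀ t : Torus n, t • V.proj w = V.proj w) : w = 0 := by
  funext k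
  by_contra hk
  set d : ℤ := ∑ j, V.edge k j * D.weight (V.idx k) j with hd
  have hd0 : (0 : ℝ) < d := by exact_mod_cast V.pos k
  set ξ : LieAlg n := (Real.pi / d) • intVec (D.weight (V.idx k)) with hξ
  have h1 : V.proj (V.flow ξ w) = V.proj w := by rw [V.proj_flow ξ hw, h]
  obtain ⟨γ, hγ, he⟩ := (V.proj_eq_iff ((V.flow_mem_dom_iff ξ).2 hw) hw).1 h1
  have h2 : γ (V.idx k) * Circle.exp (Real.pi / d) = 1 := by
    have h3 := congrFun he k
    rw [flow, ← act_mul] at h3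
    have h4 : ((γ * torusExp (V.lift ξ)) (V.idx k) : ℂ) * w k = w k := h3
    have h5 : (γ * torusExp (V.lift ξ)) (V.idx k) = 1 := Circle.ext (by
      rw [Circle.coe_one]; exact (mul_left_eq_self₀.1 h4).resolve_right hk)
    rwa [Pi.mul_apply, torusExp, lift_idx, hξ, coeff_smul, coeff_weight_idx, if_pos rfl, mul_one] at h5
  have h3 := congrArg (· ^ d) h2
  simp only [mul_zpow, one_zpow] at h3
  rw [V.zpow_eq_one_of_mem_group hγ k, one_mul, ← Circle.exp_intCast_mul,
    mul_div_cancel₀ _ hd0.ne'] at h3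
  have h4 := congrArg (fun t : Circle => (t : ℂ)) h3
  rw [Circle.coe_exp, Complex.exp_pi_mul_I, Circle.coe_one] at h4
  norm_num at h4

variable (D) in
-- A fixed point lies over a vertex, so its active facets determine its moment; points with equal
-- moment are in one torus orbit.
theorem finite_fixedPoints : {x : D.Reduced | ∀ t : Torus n, t • x = x}.Finite := by
  refine Set.Finite.of_finite_image (f := fun x => {i | D.slack i (D.moment x) = 0})
    (Set.toFinite _) fun x hx y hy hxy => ?_
  replace hxy : {i | D.slack i (D.moment x) = 0} = {i | D.slack i (D.moment y) = 0} := hxy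
  obtain ⟨V, w, hw, rfl, -⟩ := exists_mem_dom x
  have hw0 := V.eq_zero_of_fixed hw hx
  have h1 : ∀ k, D.slack (V.idx k) (D.moment (V.proj w)) = 0 := fun k => by
    rw [V.moment_proj hw, Vertex.pt, V.slack_coord_idx, hw0]; simp
  have h2 : D.moment (V.proj w) = D.moment y := V.ext_slack fun k => by
    have : V.idx k ∈ {i | D.slack i (D.moment y) = 0} := hxy ▸ h1 k
    rw [h1 k]; exact this.symm
  obtain ⟨z, hz⟩ := D.quot_surjective (V.proj w)
  obtain ⟨z', rfl⟩ := D.quot_surjective y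
  rw [← hz] at hx h2 ⊢
  obtain ⟨t, rfl⟩ := D.exists_rot_eq (z := z) (w := z') h2
  rw [← torusMap_smul_quot]
  exact (hx _).symm

end FacetPresentation

namespace FacetPresentation

variable {n : ℕ} {P : LabeledPolyhedron n} {D : FacetPresentation P}

/-! ### Structure groups over the facets -/

/-- The order of `x` divides all entries of a primitive vector, so it is `1`. Infinite order,
recorded as `0`, would make the vector zero, which is not primitive. -/
theorem eq_one_of_zpow_normal (i : Fin D.N) {x : Circle} (h : ∀ j, x ^ D.normal i j = 1) : x = 1 := by
  have hdvd : ∀ j, (orderOf x : ℤ) ∣ D.normal i j := fun j => orderOf_dvd_iff_zpow_eq_one.2 (h j)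
  choose μ hμ using hdvd
  rcases Nat.lt_trichotomy (orderOf x) 1 with h1 | h1 | h1
  · have h0 : orderOf x = 0 := by omega
    refine absurd ⟨0, ?_⟩ (D.primitive i 2 one_lt_two)
    funext j
    rw [hμ j, h0]; simp
  · exact orderOf_eq_one_iff.1 h1
  · exact absurd ⟨μ, funext hμ⟩ (D.primitive i _ h1)

/-- On the `i`-th circle the homomorphism is the `m`-th power followed by the injective map given by
the primitive normal. This is where the label becomes an isotropy group. -/
theorem torusMap_eq_one_iff {i : Fin D.N} {t : Torus D.N} (ht : ∀ j, j ≠ i → t j = 1) :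
    D.torusMap t = 1 ↔ t i ^ (P.label (D.facet i) : ℕ) = 1 := by
  have h1 : ∀ j, D.torusMap t j = (t i ^ (P.label (D.facet i) : ℕ)) ^ D.normal i j := fun j => by
    rw [torusMap, Finset.prod_eq_single i (fun i' _ h => by rw [ht i' h, one_zpow]) (by simp), weight,
      zpow_mul, zpow_natCast]
  constructor
  · intro h
    exact eq_one_of_zpow_normal i fun j => by rw [← h1, h]; rfl
  · intro h
    funext j
    rw [h1, h, one_zpow]; rfl

variable (D) in
/-- The inclusion of the `i`-th circle in the torus. -/
def circleInclusion (i : Fin D.N) : Circleˣ →* Torus D.N :=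
  (MonoidHom.mulSingle (fun _ => Circle) i).comp (Units.coeHom Circle)

theorem circleInclusion_apply (i : Fin D.N) (x : Circleˣ) :
    D.circleInclusion i x = Pi.mulSingle i (x : Circle) := rfl

theorem circleInclusion_injective (i : Fin D.N) : Function.Injective (D.circleInclusion i) :=
  fun _ _ h => Units.ext (Pi.mulSingle_injective i h)

theorem nonempty_rootsOfUnity_mulEquiv (m : ℕ+) :
    Nonempty (rootsOfUnity (m : ℕ) Circle ≃* Multiplicative (ZMod (m : ℕ))) := by
  have : NeZero (m : ℕ) := ⟨m.ne_zero⟩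
  refine ⟨(rootsOfUnityCircleEquiv m).trans (mulEquivOfCyclicCardEq ?_)⟩
  rw [Complex.card_rootsOfUnity]
  exact (Nat.card_zmod m).symm

theorem Vertex.stab_eq_map (V : D.Vertex) {i : Fin D.N} (hi : i ∈ Set.range V.idx) {w : Fin n → ℂ}
    (hw : ∀ j, V.sec w j = 0 ↔ j = i) :
    V.stab w = (rootsOfUnity (P.label (D.facet i) : ℕ) Circle).map (D.circleInclusion i) := by
  ext γ
  have h1 : γ ∈ V.stab w ↔ D.torusMap γ = 1 ∧ ∀ j, j ≠ i → γ j = 1 := by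
    constructor
    · rintro ⟨hγ, h⟩
      exact ⟨hγ.1, fun j hj => (act_eq_self_iff hγ.2 w).1 h j fun h' => hj ((hw j).1 h')⟩
    · rintro ⟨h, h'⟩
      have h2 : ∀ j, j ∉ Set.range V.idx → γ j = 1 := fun j hj => h' j fun hji => hj (hji ▸ hi)
      exact ⟨⟨h, h2⟩, (act_eq_self_iff h2 w).2 fun j hj => h' j fun hji => hj ((hw j).2 hji)⟩
  rw [h1, Subgroup.mem_map]
  constructor
  · rintro ⟨h, h'⟩
    refine ⟨toUnits (γ i), ?_, ?_⟩
    · rw [mem_rootsOfUnity']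
      exact (torusMap_eq_one_iff h').1 h
    · funext j
      rw [circleInclusion_apply]
      by_cases hj : j = i
      · subst hj; simp
      · rw [Pi.mulSingle_eq_of_ne hj, h' j hj]
  · rintro ⟨x, hx, rfl⟩
    rw [mem_rootsOfUnity'] at hx
    have h' : ∀ j, j ≠ i → D.circleInclusion i x j = 1 := fun j hj => Pi.mulSingle_eq_of_ne hj _
    refine ⟨(torusMap_eq_one_iff h').2 ?_, h'⟩
    rw [circleInclusion_apply, Pi.mulSingle_eq_same, hx]

/-- Another point of the fibre in the patch would be a translate of `w` by an element of the patch
group, and that group fixes `w`. -/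
theorem Vertex.Patch.isGoodAt {V : D.Vertex} (Q : V.Patch) {w : Fin n → ℂ} (hw : w ∈ Q.B)
    (hQ : Q.H = V.stab w) : Q.chart.IsGoodAt (V.proj w) := by
  refine ⟨(euclid n).symm w, Set.Subset.antisymm ?_ ?_⟩
  · rintro u ⟨hu, hp⟩
    obtain ⟨γ, hγ, he⟩ := (V.proj_eq_iff (Q.subset hw) (Q.subset hu)).1 hp.symm
    have h1 := Q.sep γ hγ w hw (he ▸ hu)
    rw [hQ] at h1
    rw [h1.2] at he
    rw [Set.mem_singleton_iff, he]; simp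
  · rintro _ rfl
    exact ⟨by simpa [chart] using hw, by simp [chart]⟩

theorem hasStructureGroup (i : Fin D.N) {p : D.Reduced}
    (hp : D.moment p ∈ intrinsicInterior ℝ (D.facet i : Set (LieDual n))) :
    D.orbifold.HasStructureGroup p (Multiplicative (ZMod (P.label (D.facet i) : ℕ))) := by
  obtain ⟨h0, hpos⟩ := D.slack_of_mem_intrinsicInterior hp
  obtain ⟨V, w, hw, rfl, hact⟩ := exists_mem_dom p
  have hsec : ∀ j, V.sec w j = 0 ↔ j = i := by
    intro j
    have h1 := V.norm_sq_sec hw j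
    rw [← V.moment_proj hw] at h1
    constructor
    · intro h
      by_contra hj
      have := hpos j hj
      rw [← h1, h] at this
      simp at this
    · rintro rfl
      rw [h0] at h1
      simpa using h1
  obtain ⟨Q, -, hwQ, hQ⟩ := V.exists_small_patch hw isOpen_univ (Set.mem_univ w)
  obtain ⟨e⟩ := nonempty_rootsOfUnity_mulEquiv (P.label (D.facet i))
  have hQ' := hQ.trans (V.stab_eq_map (hact i h0) hsec)
  exact SmoothOrbifold.hasStructureGroup_of_chart (M := D.orbifold) Q.chart_mem (Q.isGoodAt hwQ hQ)
    (((MulEquiv.subgroupCongr hQ').trans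
      (Subgroup.equivMapOfInjective _ _ (circleInclusion_injective i)).symm).trans e)

/-! ### The reduced space as a symplectic toric orbifold -/

variable (D) in
/-- The reduced symplectic form. -/
def form : TwoForm D.orbifold where
  toFun := D.formAt
  smooth _ hc := contDiffOn_formAt hc
  compatible c hc c' hc' φ u hu := formAt_comp hc hc' 1 c.isOpen_dom subset_rfl φ.mapsTo φ.smooth
    (fun u hu => by rw [one_smul, φ.proj_comp u hu]) hu

variable (D) in
/-- The symplectic reduction of `ℂᴺ` as a symplectic toric orbifold. -/
def toricOrbifold : SymplecticToricOrbifold n where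
  toSmoothOrbifold := D.orbifold
  form := D.form
  symplectic := ⟨fun _ hc _ hu => extDeriv_formAt hc hu, fun _ hc _ hu _ hv =>
    formAt_nondegenerate hc hu hv⟩
  action := inferInstanceAs (MulAction (Torus n) D.Reduced)
  smooth_action := D.isSmoothAction
  effective := inferInstanceAs (FaithfulSMul (Torus n) D.Reduced)
  invariant t _ hc _ hc' _ _ hW hWd hg hgs hgp _ hu := formAt_comp hc hc' t hW hWd hg hgs hgp hu
  moment := D.moment
  isMomentMap := ⟨D.continuous_moment, fun _ hc => contDiffOn_moment hc, D.moment_smul, fun ξ =>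
    ⟨D.fundamentalField ξ, D.isFundamentalField ξ, fun _ hc _ hu v => moment_equation hc ξ hu v⟩⟩

variable (D) in
theorem dagger_toricOrbifold : D.toricOrbifold.Dagger :=
  ⟨D.finite_fixedPoints, D.properDirection, D.isProperMap_moment, D.bddBelow_moment⟩

variable (D) in
theorem isReduction_toricOrbifold : D.IsReduction D.toricOrbifold := by
  refine ⟨D.quot, D.isOpenQuotientMap_quot.isQuotientMap, fun z w => ?_, fun t z w h => ?_,
    D.norm_sq_eq, fun c hc u₀ hu₀ => ?_⟩
  · refine D.quot_eq_iff.trans ?_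
    exact exists_congr fun t => and_congr_right fun _ => Subtype.ext_iff
  · have h1 : w = D.rot t z := Subtype.ext h
    rw [h1]
    exact (D.torusMap_smul_quot t z).symm
  · obtain ⟨T⟩ := nonempty_coordinates hc hu₀
    exact ⟨T.W, fun u => T.V.sec (T.toFun u), T.isOpen, T.mem, T.subset, T.isLift.smooth,
      T.isLift.spec, fun u hu v w => by
        change D.formAt c u ![v, w] = _
        rw [T.formAt_eq hc hu, pull_apply]⟩

end FacetPresentation

end ToricOrbifold
end

theorem theoremT206 (n : ℕ) (P : ToricOrbifold.LabeledPolyhedron n) :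
    ∃ M : ToricOrbifold.SymplecticToricOrbifold n,
      M.Dagger ∧
      Set.range M.moment = P.carrier ∧
      (∀ (F : {F : Set (ToricOrbifold.LieDual n) // ToricOrbifold.IsFacet P.carrier F})
        (x : M.carrier), M.moment x ∈ intrinsicInterior ℝ (F : Set (ToricOrbifold.LieDual n)) →
        M.HasStructureGroup x (Multiplicative (ZMod (P.label F : ℕ)))) ∧
      ∃ D : ToricOrbifold.FacetPresentation P, D.IsReduction M := by
  obtain ⟨D⟩ := ToricOrbifold.exists_facetPresentation P
  refine ⟨D.toricOrbifold, D.dagger_toricOrbifold, D.range_moment, fun F x hx => ?_, D,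
    D.isReduction_toricOrbifold⟩
  obtain ⟨i, rfl⟩ := D.facet.surjective F
  exact ToricOrbifold.FacetPresentation.hasStructureGroup i hx
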